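/- Let $d,N\ge 1$ and let $H(\mathbf z)=\sum_{\mathbf k\in\mathbb Z^d}\mathbf z^{\mathbf k}T_{\mathbf k}$ (finite sum, $T_{\mathbf k}\in\mathbb C^{N\times N}$) be the symbol of a finite-range $N$-band Hamiltonian on $\mathbb Z^d$, with $\mathbf z\in(\mathbb C\setminus\{0\})^d$. Put $p(\mathbf z,E)=\det(E-H(\mathbf z))$ and $\mathcal M=\{(\mathbf z,E): p(\mathbf z,E)=0\}$. The Brillouin zone (BZ) is the torus $|z_1|=\dots=|z_d|=1$, and $\Sigma_{\mathrm{PBC}}$ is the set of all eigenvalues of $H(\mathbf z)$ with $\mathbf z$ in the BZ. A saddle point (SP) is a point $(\mathbf z_s,E_s)\in\mathcal M$ with $\partial_{\mathbf z}p(\mathbf z_s,E_s)=0$. It is nondegenerate if $\partial_Ep(\mathbf z_s,E_s)\neq0$, so that near it $\mathcal M$ is the graph of a holomorphic function $E(\mathbf z)$, and if the Hessian $\partial^2E/\partial z_i\partial z_j$ at $\mathbf z_s$ is invertible; the real Hessian of $h=\operatorname{Im}E$ at $\mathbf z_s$, in the coordinates $(\operatorname{Re}\mathbf z,\operatorname{Im}\mathbf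 z)$, then has $d$ positive and $d$ negative eigenvalues. Let $T_+\subset\mathbb C^d$ be the real span of its eigenvectors with positive eigenvalue. The ascending flow lines of the SP are the curves $(\mathbf z(t),E_s+it)$, $t>0$, in $\mathcal M$ that solve $\dot P=\nabla h/|\nabla h|^2$ (that is, $\dot z_j=-i\,\partial_Ep\,\overline{\partial_{z_j}p}\,/\sum_k|\partial_{z_k}p|^2$), pass only through points with $\partial_{\mathbf z}p\ne0$, and converge to the SP as $t\downarrow0$. Assume that they all extend to $0<t<\infty$, and let $\mathbf z(t,\boldsymbol\xi)$, $t>0$, $\boldsymbol\xi\in S^{d-1}$, be a smooth parametrization of the ascending manifold: the curves $t\mapsto\mathbf z(t,\boldsymbol\xi)$ are all the ascending flow lines, each occurring once, $\mathbf z$ is smooth in $(t,\boldsymbol\xi)$, and for every fixed $t$ the map $\boldsymbol\xi\mapsto\mathbf z(t,\boldsymbol\xi)$ is an injective immersion. Put $\boldsymbol\mu(\mathbf z)=(\log|z_1|,\dots,\log|z_d|)$, so that the BZ is $\boldsymbol\mu=0$. The weight of the SP is $$n=\lim_{t\to\infty}\frac1{A_{d-1}}\int_{S^{d-1}}\epsilon_{i_1\dots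 i_d}\,\hat\mu_{i_1}\,\partial_{\xi_1}\hat\mu_{i_2}\cdots\partial_{\xi_{d-1}}\hat\mu_{i_d}\,d\boldsymbol\xi,\qquad \hat{\boldsymbol\mu}(t,\boldsymbol\xi)=\frac{\boldsymbol\mu(\mathbf z(t,\boldsymbol\xi))}{\|\boldsymbol\mu(\mathbf z(t,\boldsymbol\xi))\|},$$ the large-$t$ winding number about the origin of the surface $\boldsymbol\xi\mapsto\boldsymbol\mu(\mathbf z(t,\boldsymbol\xi))$, where $A_{d-1}$ is the area of $S^{d-1}$ (for $d=1$ it is $\lim_{t\to\infty}\frac12[\operatorname{sgn}\mu(t,+1)-\operatorname{sgn}\mu(t,-1)]$). The SP is relevant if $n\neq0$. Proposition. Let $(\mathbf z_s,E_s)$ be a nondegenerate saddle point with ascending manifold parametrized as above. Suppose that $\mathbf z_s$ lies on the BZ, that the ascending directions are transverse to the BZ there, i.e. the differential of $\boldsymbol\mu$ at $\mathbf z_s$, $\mathbf v\mapsto(\operatorname{Re}(v_j/z_{s,j}))_j$, is injective on $T_+$, and that $E_s+it\notin\Sigma_{\mathrm{PBC}}$ for every real $t>0$. Then the limit defining the weight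 $n$ exists, $n$ is an integer, and $n\neq0$: the saddle point is relevant. -/

import Mathlib

open Filter Topology MeasureTheory
open scoped ContDiff ComplexConjugate

noncomputable section

namespace BandFlow

/-! ### Finite-range lattice Hamiltonians and their energy surface

`hop k` is the hopping matrix at lattice displacement `k ∈ ℤ^d`; finite support means finite
range, so each entry of the symbol `H(z)` is a Laurent polynomial in `z_1, …, z_d`. -/

/-- The symbol `H(z) = ∑_k z^k T_k`, an `N × N` matrix of Laurent polynomials in `z`. -/
def symbol {d N : ℕ} (hop : (Fin d → ℤ) →₀ Matrix (Fin N) (Fin N) ℂ) (z : Fin d → ℂ) :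
    Matrix (Fin N) (Fin N) ℂ :=
  hop.sum fun k T => (∏ j, z j ^ k j) • T

/-- `p(z, E) = det (E - H(z))`. The energy surface is `{(z, E) | z_j ≠ 0, p(z, E) = 0}`. -/
def charDet {d N : ℕ} (hop : (Fin d → ℤ) →₀ Matrix (Fin N) (Fin N) ℂ) (z : Fin d → ℂ) (E : ℂ) :
    ℂ :=
  (E • (1 : Matrix (Fin N) (Fin N) ℂ) - symbol hop z).det

/-- `∂p/∂z_j`. -/
def charDetZ {d N : ℕ} (hop : (Fin d → ℤ) →₀ Matrix (Fin N) (Fin N) ℂ) (j : Fin d)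
    (z : Fin d → ℂ) (E : ℂ) : ℂ :=
  fderiv ℂ (fun w => charDet hop w E) z (Pi.single j 1)

/-- `∂²p/∂z_j∂z_k`. -/
def charDetZZ {d N : ℕ} (hop : (Fin d → ℤ) →₀ Matrix (Fin N) (Fin N) ℂ) (j k : Fin d)
    (z : Fin d → ℂ) (E : ℂ) : ℂ :=
  fderiv ℂ (fun w => charDetZ hop j w E) z (Pi.single k 1)

/-- `∂p/∂E`. -/
def charDetE {d N : ℕ} (hop : (Fin d → ℤ) →₀ Matrix (Fin N) (Fin N) ℂ)
    (z : Fin d → ℂ) (E : ℂ) : ℂ :=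
  deriv (fun e => charDet hop z e) E

/-- The Brillouin zone: the unit torus `|z_j| = 1` for all `j`. -/
def brillouinZone (d : ℕ) : Set (Fin d → ℂ) := {z | ∀ j, ‖z j‖ = 1}

/-- The spectrum under periodic boundary conditions: all eigenvalues of `H(z)`, `z` on the
Brillouin zone. -/
def pbcSpectrum {d N : ℕ} (hop : (Fin d → ℤ) →₀ Matrix (Fin N) (Fin N) ℂ) : Set ℂ :=
  {E | ∃ z ∈ brillouinZone d, charDet hop z E = 0}

/-! ### Saddle points -/

/-- `(z, E)` is a saddle point: `det (E - H(z)) = 0` and `∂_z det (E - H(z)) = 0`. -/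
structure IsSaddlePoint {d N : ℕ} (hop : (Fin d → ℤ) →₀ Matrix (Fin N) (Fin N) ℂ)
    (z : Fin d → ℂ) (E : ℂ) : Prop where
  ne_zero : ∀ j, z j ≠ 0
  on_surface : charDet hop z E = 0
  critical : ∀ j, charDetZ hop j z E = 0

/-- The complex Hessian `∂²E/∂z_j∂z_k` of the energy, at a saddle point with `∂p/∂E ≠ 0`:
there the energy surface is locally a graph `E = E(z)`, and since `∂p/∂z = 0`, implicit
differentiation of `p(z, E(z)) = 0` gives `∂²E/∂z_j∂z_k = - (∂²p/∂z_j∂z_k) / (∂p/∂E)`. -/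
def energyHessian {d N : ℕ} (hop : (Fin d → ℤ) →₀ Matrix (Fin N) (Fin N) ℂ)
    (z : Fin d → ℂ) (E : ℂ) : Matrix (Fin d) (Fin d) ℂ :=
  Matrix.of fun j k => - charDetZZ hop j k z E / charDetE hop z E

/-- The saddle point is nondegenerate: `E` is a simple eigenvalue of `H(z)`, and the Hessian
of the energy is invertible. -/
structure IsNondegenerate {d N : ℕ} (hop : (Fin d → ℤ) →₀ Matrix (Fin N) (Fin N) ℂ)
    (z : Fin d → ℂ) (E : ℂ) : Prop where
  simple : charDetE hop z E ≠ 0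
  hessian : (energyHessian hop z E).det ≠ 0

/-- The span of the ascending directions at a saddle point: the real span of the eigenvectors
with positive eigenvalue of the real Hessian of `h = Im E` in the coordinates
`(Re z, Im z)`. With `A = ∂²E/∂z²`, that real Hessian is the real-linear map
`v ↦ i * conj (A v)` of `ℂ^d = ℝ^{2d}`. -/
def ascendingDirections {d N : ℕ} (hop : (Fin d → ℤ) →₀ Matrix (Fin N) (Fin N) ℂ)
    (z : Fin d → ℂ) (E : ℂ) : Submodule ℝ (Fin d → ℂ) :=
  Submodule.span ℝ {v | ∃ a : ℝ, 0 < a ∧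
    ∀ j, Complex.I * conj ((energyHessian hop z E).mulVec v j) = (a : ℂ) * v j}

/-- The differential of `z ↦ (log |z_1|, …, log |z_d|)` at `z`, whose `j`-th component is
`v ↦ Re (v_j / z_j)`, is nondegenerate on the ascending directions. For `z` on the Brillouin zone
its kernel is the tangent space of the Brillouin zone, so that the ascending manifold then meets
the Brillouin zone transversally at `z`. -/
def IsTransverse {d N : ℕ} (hop : (Fin d → ℤ) →₀ Matrix (Fin N) (Fin N) ℂ)
    (z : Fin d → ℂ) (E : ℂ) : Prop :=
  ∀ v ∈ ascendingDirections hop z E, (∀ j, (v j / z j).re = 0) → v = 0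

/-! ### The ascending gradient flow -/

/-- The `z`-velocity of the flow `∇h / |∇h|²` of `h = Im E` on the energy surface. With
`E_j = ∂E/∂z_j = - p_j / p_E` it is `i conj(E_j) / ∑_k |E_k|²`, that is
`- i p_E conj(p_j) / ∑_k |p_k|²`, and along it `dE/dt = i`. The second form makes sense wherever
`∂p/∂z ≠ 0`. -/
def ascentVelocity {d N : ℕ} (hop : (Fin d → ℤ) →₀ Matrix (Fin N) (Fin N) ℂ)
    (z : Fin d → ℂ) (E : ℂ) : Fin d → ℂ := fun j =>
  - Complex.I * charDetE hop z E * conj (charDetZ hop j z E) /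
    ((∑ k, ‖charDetZ hop k z E‖ ^ 2 : ℝ) : ℂ)

/-- `w` is an ascending flow line that issues from the saddle point `(zs, Es)`, over the
parameter set `T` of values of `t = h - h_s`: the point at parameter `t` is
`(w t, Es + i t)`, it is a regular point of the flow, and it tends to the saddle point
as `t ↓ 0`. -/
structure IsAscendingLine {d N : ℕ} (hop : (Fin d → ℤ) →₀ Matrix (Fin N) (Fin N) ℂ)
    (zs : Fin d → ℂ) (Es : ℂ) (T : Set ℝ) (w : ℝ → Fin d → ℂ) : Prop where
  ne_zero : ∀ t ∈ T, ∀ j, w t j ≠ 0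
  on_surface : ∀ t ∈ T, charDet hop (w t) (Es + Complex.I * t) = 0
  regular : ∀ t ∈ T, ∃ j, charDetZ hop j (w t) (Es + Complex.I * t) ≠ 0
  flow : ∀ t ∈ T, HasDerivAt w (ascentVelocity hop (w t) (Es + Complex.I * t)) t
  start : Tendsto w (𝓝[>] 0) (𝓝 zs)

/-- `Z t ξ`, for `t > 0` and `ξ ∈ S^{d-1}`, is a smooth parametrization of the ascending manifold
of the saddle point `(zs, Es)`: the curves `t ↦ Z t ξ` are the ascending flow lines issuing from
the saddle point, each of them once, they exist for all `t > 0`, and at every level `t` the map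
`ξ ↦ Z t ξ` is an injective immersion. Only the values at unit vectors `ξ` matter. -/
structure IsAscendingParametrization {d N : ℕ}
    (hop : (Fin d → ℤ) →₀ Matrix (Fin N) (Fin N) ℂ) (zs : Fin d → ℂ) (Es : ℂ)
    (Z : ℝ → EuclideanSpace ℝ (Fin d) → Fin d → ℂ) : Prop where
  line : ∀ ξ, ‖ξ‖ = 1 → IsAscendingLine hop zs Es (Set.Ioi 0) (fun t => Z t ξ)
  exhaust : ∀ τ > 0, ∀ w, IsAscendingLine hop zs Es (Set.Ioo 0 τ) w →
    ∃ ξ, ‖ξ‖ = 1 ∧ ∀ t ∈ Set.Ioo 0 τ, w t = Z t ξ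
  inj : ∀ t > 0, Set.InjOn (Z t) (Metric.sphere 0 1)
  smooth : ContDiffOn ℝ ∞
    (fun q : ℝ × EuclideanSpace ℝ (Fin d) => Z q.1 (‖q.2‖⁻¹ • q.2)) (Set.Ioi 0 ×ˢ {0}ᶜ)
  immersion : ∀ t > 0, ∀ ξ v : EuclideanSpace ℝ (Fin d), ‖ξ‖ = 1 → inner ℝ ξ v = 0 → v ≠ 0 →
    fderiv ℝ (fun x : EuclideanSpace ℝ (Fin d) => Z t (‖x‖⁻¹ • x)) ξ v ≠ 0

/-! ### Winding number and weight -/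

/-- The degree-one homogeneous extension `x ↦ ‖x‖ f̂(x/‖x‖)` of `f̂ = f/‖f‖ : S^{d-1} → S^{d-1}`.
Its derivative at a unit vector `ξ` maps `ξ` to `f̂(ξ)`, and a tangent vector `τ` of the sphere
to the derivative of `f̂` along `τ`. -/
def unitConeMap {d : ℕ} (f : EuclideanSpace ℝ (Fin d) → EuclideanSpace ℝ (Fin d))
    (x : EuclideanSpace ℝ (Fin d)) : EuclideanSpace ℝ (Fin d) :=
  ‖x‖ • (‖f (‖x‖⁻¹ • x)‖⁻¹ • f (‖x‖⁻¹ • x))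

/-- The winding number about the origin of a surface `f : S^{d-1} → ℝ^d ∖ {0}`,
`(1 / A_{d-1}) ∫_{S^{d-1}} ∑ ε_{i_1 … i_d} f̂_{i_1} ∂_1 f̂_{i_2} ⋯ ∂_{d-1} f̂_{i_d} dξ`.
In a positively oriented orthonormal frame `(ξ, τ_1, …, τ_{d-1})` the integrand is
`det (f̂, ∂_1 f̂, …, ∂_{d-1} f̂)`, the determinant of the derivative of `unitConeMap f` at `ξ`.
For `d = 1` the surface measure is the counting measure of `{1, -1}`, and this is
`(sgn f(1) - sgn f(-1)) / 2`. -/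
def windingNumber {d : ℕ} (f : EuclideanSpace ℝ (Fin d) → EuclideanSpace ℝ (Fin d)) : ℝ :=
  (∫ ξ : Metric.sphere (0 : EuclideanSpace ℝ (Fin d)) 1,
      (fderiv ℝ (unitConeMap f) (ξ : EuclideanSpace ℝ (Fin d))).det
        ∂(volume : Measure (EuclideanSpace ℝ (Fin d))).toSphere) /
    (volume : Measure (EuclideanSpace ℝ (Fin d))).toSphere.real Set.univ

/-- `μ(z) = (log |z_1|, …, log |z_d|)`; the Brillouin zone is `μ = 0`. -/
def logModulus {d : ℕ} (z : Fin d → ℂ) : EuclideanSpace ℝ (Fin d) :=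
  WithLp.toLp 2 fun j => Real.log ‖z j‖

/-- The saddle point has weight `n`, for the orientation of its ascending manifold given by the
parametrization `Z`: `n` is the winding number about the origin of `ξ ↦ μ(Z t ξ)` in the limit
of large `t`. -/
def HasWeight {d : ℕ} (Z : ℝ → EuclideanSpace ℝ (Fin d) → Fin d → ℂ) (n : ℤ) : Prop :=
  Tendsto (fun t => windingNumber fun ξ => logModulus (Z t ξ)) atTop (𝓝 (n : ℝ))

end BandFlow

end

/-! No ascending line meets the Brillouin zone at a level t > 0, since its energy Es + it is not in
the PBC spectrum. So μ(Z t ξ) never vanishes, and the winding number of ξ ↦ μ(Z t ξ) is defined and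
independent of t > 0. The limit at infinity is therefore its value at any one small level. There the
level set of the ascending manifold is close to an ellipsoid in the span T₊ of the ascending
directions, and μ is close to its differential L at zs, which is injective on T₊. The normalized map
is then an injective immersion of the sphere, and its winding number is 1 or -1.

Homotopy invariance is proved analytically. The winding number is written as the integral of φ(‖x‖)
det DF over ℝ^d, divided by the integral of φ(‖x‖), where F is the norm preserving cone map
`unitConeMap` (`windingNumber_mul_integral`). By the Piola identity the t-derivative of the Jacobian
is a divergence. The terms in which a derivative falls on φ cancel because F preserves the norm
(`integral_cutoff_mul_det_eq`). For an injective immersion the change of variables formula evaluates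
the same integral (`integral_radial_mul_det`).

The small-level statement is proved without constructing an unstable manifold. After a positive
change of time an ascending line follows the gradient of Im E, which is nearly the real Hessian S
applied to the displacement from zs. Cone estimates keep displacements, and differences of
displacements, close to T₊. If μ(z) were nearly l μ(z') for two points z, z' of one level, then z -
zs would be nearly l (z' - zs), and equality of the heights would force l = 1 and z = z'. The
quantitative form is κ ‖z - z'‖ ≤ ‖μ(z) - l μ(z')‖ for all l ≥ 0 (`exists_uniform_separation`,
`exists_level_separation`). It carries injectivity and immersivity from the given parametrization
over to F. -/

noncomputable section

namespace BandFlow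

/-! ### Jacobian determinants: Cramer's rule and the Piola identity. -/

section Piola

/-- The determinant of `d` vectors of `ℝ^d`, as a continuous alternating map. -/
def euclideanDet (d : ℕ) :
    (EuclideanSpace ℝ (Fin d)) [⋀^Fin d]→L[ℝ] ℝ :=
  { (EuclideanSpace.basisFun (Fin d) ℝ).toBasis.det with
    cont := by
      change Continuous fun v : Fin d → EuclideanSpace ℝ (Fin d) =>
        ((EuclideanSpace.basisFun (Fin d) ℝ).toBasis.toMatrix v).det
      refine Continuous.matrix_det (continuous_matrix fun i j => ?_)
      simp only [Module.Basis.toMatrix_apply, OrthonormalBasis.coe_toBasis_repr_apply,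
        EuclideanSpace.basisFun_repr]
      fun_prop }

theorem euclideanDet_apply {d : ℕ} (v : Fin d → EuclideanSpace ℝ (Fin d)) :
    euclideanDet d v = (Matrix.of fun i j => v j i).det := rfl

theorem euclideanDet_map_basis {d : ℕ}
    (A : EuclideanSpace ℝ (Fin d) →L[ℝ] EuclideanSpace ℝ (Fin d)) :
    euclideanDet d (fun j => A (EuclideanSpace.single j 1)) = A.det := by
  have h := (EuclideanSpace.basisFun (Fin d) ℝ).toBasis.det_comp
    (A : EuclideanSpace ℝ (Fin d) →ₗ[ℝ] EuclideanSpace ℝ (Fin d))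
    (EuclideanSpace.basisFun (Fin d) ℝ).toBasis
  rw [Module.Basis.det_self, mul_one] at h
  rw [ContinuousLinearMap.det, ← h]
  change (EuclideanSpace.basisFun (Fin d) ℝ).toBasis.det _ = _
  congr 1
  ext j
  simp

/-- Cramer's rule, tested against a linear functional. -/
theorem sum_mul_euclideanDet_update {d : ℕ} (l : EuclideanSpace ℝ (Fin d) →ₗ[ℝ] ℝ)
    (v : Fin d → EuclideanSpace ℝ (Fin d)) (u : EuclideanSpace ℝ (Fin d)) :
    ∑ j, l (v j) * euclideanDet d (Function.update v j u) = l u * euclideanDet d v := by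
  set A : Matrix (Fin d) (Fin d) ℝ := Matrix.of fun i j => v j i with hA
  have hup : ∀ j, euclideanDet d (Function.update v j u) = A.cramer (WithLp.ofLp u) j := by
    intro j
    rw [Matrix.cramer_apply, euclideanDet_apply]
    congr 1
    ext i k
    by_cases h : k = j
    · subst h; simp
    · simp [h, hA]
  have hc := Matrix.mulVec_cramer A (WithLp.ofLp u)
  have hvec : ∑ j, A.cramer (WithLp.ofLp u) j • v j = A.det • u := by
    ext i
    have := congrFun hc i
    simp only [Matrix.mulVec, dotProduct, Pi.smul_apply, smul_eq_mul] at this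
    simp only [WithLp.ofLp_sum, WithLp.ofLp_smul, Finset.sum_apply, Pi.smul_apply, smul_eq_mul]
    rw [← this]
    exact Finset.sum_congr rfl fun j _ => by simp [hA, mul_comm]
  have := congrArg l hvec
  simp only [map_sum, map_smul, smul_eq_mul] at this
  simp only [hup, euclideanDet_apply]
  rw [mul_comm (l u), ← hA, ← this]
  exact Finset.sum_congr rfl fun j _ => mul_comm _ _

variable {X : Type*} [NormedAddCommGroup X] [NormedSpace ℝ X]

theorem fderiv_euclideanDet {d : ℕ} {V : Fin d → X → EuclideanSpace ℝ (Fin d)} {q : X}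
    (hV : ∀ j, DifferentiableAt ℝ (V j) q) (a : X) :
    fderiv ℝ (fun x => euclideanDet d fun j => V j x) q a =
      ∑ j, euclideanDet d (Function.update (fun i => V i q) j (fderiv ℝ (V j) q a)) := by
  have h := HasFDerivAt.multilinear_comp (f := (euclideanDet d).toContinuousMultilinearMap)
    (fun j => (hV j).hasFDerivAt)
  have h2 := h.fderiv
  change fderiv ℝ (fun x => euclideanDet d fun j => V j x) q = _ at h2
  rw [h2]
  simp

/-- The Piola identity: the variation of a Jacobian determinant is a divergence. -/
theorem fderiv_euclideanDet_eq_sum {d : ℕ} {V : Fin d → X → EuclideanSpace ℝ (Fin d)}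
    {U : X → EuclideanSpace ℝ (Fin d)} {q a : X} {b : Fin d → X}
    (hV : ∀ j, DifferentiableAt ℝ (V j) q) (hU : DifferentiableAt ℝ U q)
    (hVV : ∀ j k, fderiv ℝ (V j) q (b k) = fderiv ℝ (V k) q (b j))
    (hVU : ∀ j, fderiv ℝ (V j) q a = fderiv ℝ U q (b j)) :
    fderiv ℝ (fun x => euclideanDet d fun j => V j x) q a =
      ∑ j, fderiv ℝ (fun x => euclideanDet d (Function.update (fun i => V i x) j (U x))) q
        (b j) := by
  have hW : ∀ j i, DifferentiableAt ℝ (Function.update V j U i) q := by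
    intro j i
    by_cases h : i = j
    · subst h; simpa using hU
    · simpa [h] using hV i
  have hupd : ∀ j x, Function.update (fun i => V i x) j (U x) =
      fun i => Function.update V j U i x := by
    intro j x
    ext1 i
    by_cases h : i = j
    · subst h; simp
    · simp [h]
  -- These are the terms of the divergence with U in slot j and a second derivative in slot k.
  -- Exchanging the two slots changes the sign, and by `hVV` it also exchanges j and k, so the
  -- double sum vanishes.
  set T : Fin d → Fin d → ℝ := fun j k => if k = j then 0 else
    euclideanDet d (Function.update (Function.update (fun i => V i q) j (U q)) k
      (fderiv ℝ (V k) q (b j))) with hT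
  have hanti : ∀ j k, T j k = - T k j := by
    intro j k
    by_cases h : k = j
    · subst h; simp [hT]
    · have h' : j ≠ k := fun e => h e.symm
      simp only [hT, h, h', if_false]
      have hswap := (euclideanDet d).toAlternatingMap.map_swap (Function.update
        (Function.update (fun i => V i q) k (U q)) j (fderiv ℝ (V j) q (b k))) h'
      change euclideanDet d (_ ∘ _) = - euclideanDet d _ at hswap
      rw [hVV k j, ← hswap]
      congr 1
      ext1 i
      simp only [Function.comp_apply]
      by_cases hi : i = j
      · subst hi; rw [Equiv.swap_apply_left]; simp [h, h']
      · by_cases hk : i = k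
        · subst hk; rw [Equiv.swap_apply_right]; simp
        · rw [Equiv.swap_apply_of_ne_of_ne hi hk]; simp [hi, hk]
  have hsum : ∑ j, ∑ k, T j k = 0 := by
    have h1 : ∑ j, ∑ k, T j k = - ∑ j, ∑ k, T j k := by
      conv_lhs => rw [Finset.sum_comm]
      simp only [← Finset.sum_neg_distrib]
      exact Finset.sum_congr rfl fun j _ => Finset.sum_congr rfl fun k _ => hanti k j
    linarith
  rw [fderiv_euclideanDet hV]
  have hterm : ∀ j, fderiv ℝ (fun x => euclideanDet d (Function.update (fun i => V i x) j (U x))) q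
      (b j) = euclideanDet d (Function.update (fun i => V i q) j (fderiv ℝ (V j) q a)) +
        ∑ k, T j k := by
    intro j
    simp only [hupd]
    rw [fderiv_euclideanDet (hW j)]
    simp only [← hupd]
    rw [← Finset.add_sum_erase _ _ (Finset.mem_univ j),
      ← Finset.add_sum_erase (f := T j) _ (Finset.mem_univ j)]
    simp only [Function.update_self, Function.update_idem, hVU j]
    simp only [hT, if_true, zero_add]
    congr 1
    refine Finset.sum_congr rfl fun k hk => ?_
    have hk' := Finset.ne_of_mem_erase hk
    simp [hk']
  simp only [hterm, Finset.sum_add_distrib, hsum, add_zero]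

end Piola

/-! ### Invariance of the degree integral under homotopy. -/

section Homotopy

/-- The integral of a directional derivative of a compactly supported function vanishes. -/
theorem integral_fderiv_apply_eq_zero {d : ℕ} {g : EuclideanSpace ℝ (Fin d) → ℝ}
    (hg : ContDiff ℝ 1 g) (hc : HasCompactSupport g) (v : EuclideanSpace ℝ (Fin d)) :
    ∫ x, fderiv ℝ g x v = 0 := by
  have hint : Integrable fun x => fderiv ℝ g x v :=
    ((hg.continuous_fderiv one_ne_zero).clm_apply continuous_const).integrable_of_hasCompactSupport
      (hc.fderiv_apply ℝ v)
  have h := integral_mul_fderiv_eq_neg_fderiv_mul_of_integrable (𝕜 := ℝ)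
    (μ := (volume : Measure (EuclideanSpace ℝ (Fin d)))) (f := fun _ => (1 : ℝ)) (g := g) (v := v)
    (by simp) (by simpa using hint)
    (by simpa using hg.continuous.integrable_of_hasCompactSupport hc)
    (fun _ _ => differentiableAt_const _) (fun x _ => hg.differentiable one_ne_zero x)
  simpa using h

variable {d : ℕ} {φ : ℝ → ℝ} {a b : ℝ}

/-- Multiplication by a radial cutoff supported away from the origin removes a singularity at
the origin. -/
theorem contDiffOn_cutoff_mul (hφ : ContDiff ℝ ∞ φ) (ha : 0 < a)
    (hsupp : ∀ r, φ r ≠ 0 → r ∈ Set.Icc a b) {g : ℝ × EuclideanSpace ℝ (Fin d) → ℝ}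
    (hg : ContDiffOn ℝ 1 g (Set.Ioi 0 ×ˢ {0}ᶜ)) :
    ContDiffOn ℝ 1 (fun q : ℝ × EuclideanSpace ℝ (Fin d) => φ ‖q.2‖ * g q)
      (Set.Ioi 0 ×ˢ Set.univ) := by
  intro q hq
  refine ContDiffAt.contDiffWithinAt ?_
  by_cases h0 : q.2 = 0
  · have hev : (fun q : ℝ × EuclideanSpace ℝ (Fin d) => φ ‖q.2‖ * g q) =ᶠ[𝓝 q] fun _ => 0 := by
      have : ∀ᶠ p : ℝ × EuclideanSpace ℝ (Fin d) in 𝓝 q, ‖p.2‖ < a :=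
        (continuous_norm.comp continuous_snd).continuousAt.eventually_lt
          (by exact continuousAt_const) (by simpa [h0] using ha)
      filter_upwards [this] with p hp
      have : φ ‖p.2‖ = 0 := by
        by_contra h
        exact absurd (hsupp _ h).1 (not_le.2 hp)
      simp [this]
    exact contDiffAt_const.congr_of_eventuallyEq hev
  · have hopen : IsOpen (Set.Ioi (0 : ℝ) ×ˢ ({0}ᶜ : Set (EuclideanSpace ℝ (Fin d)))) :=
      isOpen_Ioi.prod isOpen_compl_singleton
    have hgq : ContDiffAt ℝ 1 g q := hg.contDiffAt (hopen.mem_nhds ⟨hq.1, h0⟩)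
    have hn : ContDiffAt ℝ 1 (fun p : ℝ × EuclideanSpace ℝ (Fin d) => ‖p.2‖) q :=
      contDiffAt_snd.norm ℝ h0
    exact ((hφ.of_le (by simp)).contDiffAt.comp q hn).mul hgq

/-- If the `t`-derivative of a family of functions supported in a fixed ball is a divergence of a
field supported in that ball, the integral does not depend on `t`. -/
theorem integral_eq_of_deriv_eq_divergence (hd : 0 < d)
    {K : ℝ × EuclideanSpace ℝ (Fin d) → ℝ} {Y : Fin d → ℝ × EuclideanSpace ℝ (Fin d) → ℝ}
    (hK : ContDiffOn ℝ 1 K (Set.Ioi 0 ×ˢ Set.univ))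
    (hY : ∀ j, ContDiffOn ℝ 1 (Y j) (Set.Ioi 0 ×ˢ Set.univ))
    (hK0 : ∀ q, K q ≠ 0 → ‖q.2‖ ≤ b) (hY0 : ∀ j q, Y j q ≠ 0 → ‖q.2‖ ≤ b)
    (hdiv : ∀ t > 0, ∀ x : EuclideanSpace ℝ (Fin d), x ≠ 0 → fderiv ℝ K (t, x) (1, 0) =
      ∑ j, fderiv ℝ (Y j) (t, x) (0, EuclideanSpace.single j 1))
    {s t : ℝ} (hs : 0 < s) (ht : 0 < t) : ∫ x, K (s, x) = ∫ x, K (t, x) := by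
  have : NeZero d := ⟨hd.ne'⟩
  have hopen : IsOpen (Set.Ioi (0 : ℝ) ×ˢ (Set.univ : Set (EuclideanSpace ℝ (Fin d)))) :=
    isOpen_Ioi.prod isOpen_univ
  have hslice : ∀ {g : ℝ × EuclideanSpace ℝ (Fin d) → ℝ},
      ContDiffOn ℝ 1 g (Set.Ioi 0 ×ˢ Set.univ) → ∀ t > 0, ContDiff ℝ 1 fun x => g (t, x) := by
    intro g hg t ht
    rw [← contDiffOn_univ]
    exact hg.comp (contDiff_prodMk_right t).contDiffOn fun x _ => ⟨ht, Set.mem_univ _⟩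
  have hcomp : ∀ {g : ℝ × EuclideanSpace ℝ (Fin d) → ℝ}, (∀ q, g q ≠ 0 → ‖q.2‖ ≤ b) →
      ∀ t, HasCompactSupport fun x => g (t, x) := by
    intro g hg t
    refine HasCompactSupport.intro (isCompact_closedBall (0 : EuclideanSpace ℝ (Fin d)) b)
      fun x hx => ?_
    by_contra h
    exact hx (by simpa using hg _ h)
  have hdiffK : ∀ {g : ℝ × EuclideanSpace ℝ (Fin d) → ℝ},
      ContDiffOn ℝ 1 g (Set.Ioi 0 ×ˢ Set.univ) → ∀ t > 0, ∀ x, DifferentiableAt ℝ g (t, x) :=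
    fun hg t ht x => (hg.contDiffAt (hopen.mem_nhds (Set.mk_mem_prod ht (Set.mem_univ _)))).differentiableAt
      one_ne_zero
  have hzero : ∀ t > 0, ∫ x, fderiv ℝ K (t, x) (1, 0) = 0 := by
    intro t ht
    have hae : (fun x => fderiv ℝ K (t, x) (1, 0)) =ᵐ[volume] fun x =>
        ∑ j, fderiv ℝ (fun y => Y j (t, y)) x (EuclideanSpace.single j 1) := by
      -- The divergence identity is assumed off the origin only, a null set because 0 < d.
      have h0 : ∀ᵐ x : EuclideanSpace ℝ (Fin d), x ≠ 0 := by
        simp [ae_iff, measure_singleton]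
      filter_upwards [h0] with x hx
      rw [hdiv t ht x hx]
      refine Finset.sum_congr rfl fun j _ => ?_
      have h1 : HasFDerivAt (fun y => Y j (t, y))
          ((fderiv ℝ (Y j) (t, x)).comp (ContinuousLinearMap.inr ℝ ℝ _)) x :=
        (hdiffK (hY j) t ht x).hasFDerivAt.comp x (hasFDerivAt_prodMk_right t x)
      rw [h1.fderiv]
      rfl
    rw [integral_congr_ae hae, integral_finsetSum]
    · exact Finset.sum_eq_zero fun j _ => integral_fderiv_apply_eq_zero (hslice (hY j) t ht)
        (hcomp (hY0 j) t) _
    · intro j _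
      exact (((hslice (hY j) t ht).continuous_fderiv one_ne_zero).clm_apply
        continuous_const).integrable_of_hasCompactSupport ((hcomp (hY0 j) t).fderiv_apply ℝ _)
  have hderiv : ∀ t > 0, HasDerivAt (fun r => ∫ x, K (r, x)) 0 t := by
    intro t ht
    have hKd : ContinuousOn (fun q => fderiv ℝ K q (1, 0))
        (Set.Ioi (0 : ℝ) ×ˢ (Set.univ : Set (EuclideanSpace ℝ (Fin d)))) :=
      (hK.continuousOn_fderiv_of_isOpen hopen le_rfl).clm_apply continuousOn_const
    -- Dominating function for differentiation under the integral: C on the ball of radius b, zero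
    -- outside, uniformly for times in [t/2, 2t].
    obtain ⟨C, hC⟩ := (isCompact_Icc.prod (isCompact_closedBall (0 : EuclideanSpace ℝ (Fin d)) b) :
      IsCompact (Set.Icc (t / 2) (2 * t) ×ˢ
        Metric.closedBall (0 : EuclideanSpace ℝ (Fin d)) b)).exists_bound_of_continuousOn
      (hKd.mono fun q hq => ⟨lt_of_lt_of_le (half_pos ht) hq.1.1, Set.mem_univ _⟩)
    have hout : ∀ r, ∀ x : EuclideanSpace ℝ (Fin d), b < ‖x‖ → fderiv ℝ K (r, x) = 0 := by
      intro r x hx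
      have hev : K =ᶠ[𝓝 (r, x)] fun _ => 0 := by
        have : ∀ᶠ p : ℝ × EuclideanSpace ℝ (Fin d) in 𝓝 (r, x), b < ‖p.2‖ :=
          ContinuousAt.eventually_lt (by exact continuousAt_const)
            (continuous_norm.comp continuous_snd).continuousAt hx
        filter_upwards [this] with p hp
        by_contra h
        exact absurd (hK0 p h) (not_le.2 hp)
      rw [hev.fderiv_eq]
      simp
    have hmain := hasDerivAt_integral_of_dominated_loc_of_deriv_le (𝕜 := ℝ)
      (μ := (volume : Measure (EuclideanSpace ℝ (Fin d)))) (F := fun r x => K (r, x))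
      (F' := fun r x => fderiv ℝ K (r, x) (1, 0)) (x₀ := t) (s := Set.Ioo (t / 2) (2 * t))
      (bound := (Metric.closedBall (0 : EuclideanSpace ℝ (Fin d)) b).indicator fun _ => C)
      (Ioo_mem_nhds (by linarith) (by linarith)) ?_
      ((hslice hK t ht).continuous.integrable_of_hasCompactSupport (hcomp hK0 t)) ?_ ?_ ?_ ?_
    · simpa [hzero t ht] using hmain.2
    · filter_upwards [lt_mem_nhds ht] with r hr
      exact (hslice hK r hr).continuous.aestronglyMeasurable
    · have : Continuous fun x : EuclideanSpace ℝ (Fin d) => fderiv ℝ K (t, x) (1, 0) := by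
        rw [← continuousOn_univ]
        exact hKd.comp (by fun_prop) fun x _ => ⟨ht, Set.mem_univ _⟩
      exact this.aestronglyMeasurable
    · refine Eventually.of_forall fun x r hr => ?_
      by_cases hx : ‖x‖ ≤ b
      · rw [Set.indicator_of_mem (by simpa using hx)]
        exact hC (r, x) ⟨⟨hr.1.le, hr.2.le⟩, by simpa using hx⟩
      · rw [hout r x (not_le.1 hx), Set.indicator_of_notMem (by simpa using hx)]
        simp
    · exact (integrable_indicator_iff measurableSet_closedBall).2
        (integrableOn_const (isCompact_closedBall _ _).measure_lt_top.ne)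
    · refine Eventually.of_forall fun x r hr => ?_
      have hr0 : 0 < r := lt_trans (half_pos ht) hr.1
      exact (hdiffK hK r hr0 x).hasFDerivAt.comp_hasDerivAt r
        ((hasDerivAt_id r).prodMk (hasDerivAt_const r x))
  exact isOpen_Ioi.is_const_of_deriv_eq_zero isPreconnected_Ioi
    (fun r hr => (hderiv r hr).differentiableAt.differentiableWithinAt)
    (fun r hr => (hderiv r hr).deriv) hs ht

/-- Homotopy invariance of the degree integral, for a family of norm preserving maps. -/
theorem integral_cutoff_mul_det_eq (hd : 0 < d) (hφ : ContDiff ℝ ∞ φ) (ha : 0 < a)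
    (hsupp : ∀ r, φ r ≠ 0 → r ∈ Set.Icc a b)
    {F : ℝ × EuclideanSpace ℝ (Fin d) → EuclideanSpace ℝ (Fin d)}
    (hF : ContDiffOn ℝ ∞ F (Set.Ioi 0 ×ˢ {0}ᶜ))
    (hnorm : ∀ t > 0, ∀ x, x ≠ 0 → ‖F (t, x)‖ = ‖x‖) {s t : ℝ} (hs : 0 < s) (ht : 0 < t) :
    ∫ x, φ ‖x‖ * (fderiv ℝ (fun y => F (s, y)) x).det =
      ∫ x, φ ‖x‖ * (fderiv ℝ (fun y => F (t, y)) x).det := by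
  set O : Set (ℝ × EuclideanSpace ℝ (Fin d)) := Set.Ioi 0 ×ˢ {0}ᶜ with hO
  have hopen : IsOpen O := isOpen_Ioi.prod isOpen_compl_singleton
  set e : Fin d → ℝ × EuclideanSpace ℝ (Fin d) := fun j => (0, EuclideanSpace.single j 1) with he
  set V : Fin d → ℝ × EuclideanSpace ℝ (Fin d) → EuclideanSpace ℝ (Fin d) :=
    fun j q => fderiv ℝ F q (e j) with hV
  set U : ℝ × EuclideanSpace ℝ (Fin d) → EuclideanSpace ℝ (Fin d) :=
    fun q => fderiv ℝ F q (1, 0) with hU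
  have hdF : ∀ q ∈ O, DifferentiableAt ℝ F q := fun q hq =>
    (hF.contDiffAt (hopen.mem_nhds hq)).differentiableAt (by simp)
  have hddF : ContDiffOn ℝ 1 (fderiv ℝ F) O := hF.fderiv_of_isOpen hopen (by norm_cast)
  have hdV : ∀ v, ContDiffOn ℝ 1 (fun q => fderiv ℝ F q v) O := fun v =>
    hddF.clm_apply contDiffOn_const
  have hdd : ∀ q ∈ O, ∀ v w, fderiv ℝ (fun p => fderiv ℝ F p v) q w =
      fderiv ℝ (fun p => fderiv ℝ F p w) q v := by
    intro q hq v w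
    have h1 : DifferentiableAt ℝ (fderiv ℝ F) q :=
      (hddF.contDiffAt (hopen.mem_nhds hq)).differentiableAt one_ne_zero
    rw [fderiv_clm_apply h1 (differentiableAt_const _),
      fderiv_clm_apply h1 (differentiableAt_const _)]
    have := ((hF.contDiffAt (hopen.mem_nhds hq)).isSymmSndFDerivAt (by simp; exact WithTop.coe_le_coe.2 le_top)) v w
    simpa using this.symm
  have hslice : ∀ t > 0, ∀ x, x ≠ 0 →
      (fderiv ℝ (fun y => F (t, y)) x).det = euclideanDet d (fun j => V j (t, x)) := by
    intro t ht x hx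
    rw [← euclideanDet_map_basis]
    have h1 : HasFDerivAt (fun y => F (t, y))
        ((fderiv ℝ F (t, x)).comp (ContinuousLinearMap.inr ℝ ℝ _)) x :=
      (hdF (t, x) ⟨ht, hx⟩).hasFDerivAt.comp x (hasFDerivAt_prodMk_right t x)
    rw [h1.fderiv]
    rfl
  have hdetV : ContDiffOn ℝ 1 (fun q => euclideanDet d (fun j => V j q)) O :=
    (euclideanDet d).toContinuousMultilinearMap.contDiff.comp_contDiffOn
      (contDiffOn_pi.2 fun j => hdV _)
  have hdetU : ∀ j, ContDiffOn ℝ 1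
      (fun q => euclideanDet d (Function.update (fun i => V i q) j (U q))) O := by
    intro j
    refine (euclideanDet d).toContinuousMultilinearMap.contDiff.comp_contDiffOn
      (contDiffOn_pi.2 fun i => ?_)
    by_cases h : i = j
    · subst h; simpa using hdV _
    · simpa [h] using hdV _
  have key := integral_eq_of_deriv_eq_divergence (b := b) hd
    (contDiffOn_cutoff_mul hφ ha hsupp hdetV)
    (fun j => contDiffOn_cutoff_mul hφ ha hsupp (hdetU j))
    (fun q hq => (hsupp _ (left_ne_zero_of_mul hq)).2)
    (fun j q hq => (hsupp _ (left_ne_zero_of_mul hq)).2) ?_ hs ht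
  · have hcongr : ∀ r > 0, ∫ x, φ ‖x‖ * (fderiv ℝ (fun y => F (r, y)) x).det =
        ∫ x, φ ‖x‖ * euclideanDet d (fun j => V j (r, x)) := by
      intro r hr
      refine integral_congr_ae (Eventually.of_forall fun x => ?_)
      by_cases hx : x = 0
      · have : φ ‖x‖ = 0 := by
          by_contra h
          have := (hsupp _ h).1
          rw [hx, norm_zero] at this
          linarith
        simp [this]
      · simp only [hslice r hr x hx]
    rw [hcongr s hs, hcongr t ht]
    exact key
  · intro r hr x hx
    have hq : ((r, x) : ℝ × EuclideanSpace ℝ (Fin d)) ∈ O := ⟨hr, hx⟩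
    have hnx : DifferentiableAt ℝ (fun p : ℝ × EuclideanSpace ℝ (Fin d) => φ ‖p.2‖) (r, x) :=
      ((hφ.differentiable (by simp)) _).comp _
        (differentiableAt_snd.norm ℝ hx)
    have hdiff : ∀ {g : ℝ × EuclideanSpace ℝ (Fin d) → ℝ}, ContDiffOn ℝ 1 g O →
        DifferentiableAt ℝ g (r, x) := fun hg =>
      (hg.contDiffAt (hopen.mem_nhds hq)).differentiableAt one_ne_zero
    -- the logarithmic derivative of the cutoff
    obtain ⟨c, hc⟩ : ∃ c : ℝ, ∀ w, fderiv ℝ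
        (fun p : ℝ × EuclideanSpace ℝ (Fin d) => φ ‖p.2‖) (r, x) w = c * inner ℝ x w.2 := by
      refine ⟨deriv φ ‖x‖ * ‖x‖⁻¹, fun w => ?_⟩
      have h1 : HasFDerivAt (fun p : ℝ × EuclideanSpace ℝ (Fin d) => ‖p.2‖)
          ((‖x‖⁻¹ • innerSL ℝ x).comp (ContinuousLinearMap.snd ℝ ℝ _)) (r, x) := by
        have h2 : HasFDerivAt (fun y : EuclideanSpace ℝ (Fin d) => ‖y‖) (‖x‖⁻¹ • innerSL ℝ x) x := by
          have h3 := (hasStrictFDerivAt_norm_sq x).hasFDerivAt.sqrt (by simpa using hx)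
          simp only [Real.sqrt_sq (norm_nonneg _)] at h3
          refine h3.congr_fderiv ?_
          ext w
          simp only [smul_apply, two_smul, add_apply, smul_eq_mul, smul_add]
          ring
        exact h2.comp (r, x) hasFDerivAt_snd
      have h3 := ((hφ.differentiable (by simp)) ‖x‖).hasDerivAt.comp_hasFDerivAt (r, x) h1
      have h4 := h3.fderiv
      change fderiv ℝ (fun p : ℝ × EuclideanSpace ℝ (Fin d) => φ ‖p.2‖) (r, x) = _ at h4
      rw [h4]
      simp [mul_assoc]
    -- Differentiate ‖F‖² = ‖x‖². A spatial basis direction gives ⟨F, V_j⟩ = x_j, and the time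
    -- direction gives ⟨F, U⟩ = 0.
    have hinner : ∀ w, inner ℝ (F (r, x)) (fderiv ℝ F (r, x) w) = inner ℝ x w.2 := by
      intro w
      have h1 : HasFDerivAt (fun p => ‖F p‖ ^ 2) _ (r, x) := (hdF _ hq).hasFDerivAt.norm_sq
      have h2 : HasFDerivAt (fun p : ℝ × EuclideanSpace ℝ (Fin d) => ‖p.2‖ ^ 2) _ (r, x) :=
        (hasFDerivAt_snd (𝕜 := ℝ) (p := ((r, x) : ℝ × EuclideanSpace ℝ (Fin d)))).norm_sq
      have h3 : (fun p => ‖F p‖ ^ 2) =ᶠ[𝓝 (r, x)] fun p => ‖p.2‖ ^ 2 := by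
        filter_upwards [hopen.mem_nhds hq] with p hp
        rw [hnorm p.1 hp.1 p.2 hp.2]
      have h4 := (h2.congr_of_eventuallyEq h3).unique h1
      have h5 := congrArg (fun A => A w) h4
      simpa using h5.symm
    have hpiola := fderiv_euclideanDet_eq_sum (V := V) (U := U) (q := (r, x)) (a := (1, 0)) (b := e)
      (fun j => ((hdV _).contDiffAt (hopen.mem_nhds hq)).differentiableAt one_ne_zero)
      (((hdV _).contDiffAt (hopen.mem_nhds hq)).differentiableAt one_ne_zero)
      (fun j k => hdd _ hq _ _) (fun j => hdd _ hq _ _)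
    -- The derivatives of the cutoff contribute a multiple of ∑ x_j det(V with U in slot j). As x_j
    -- = ⟨F, V_j⟩, Cramer's rule turns this sum into ⟨F, U⟩ det V = 0.
    have hcramer := sum_mul_euclideanDet_update
      (innerSL ℝ (F (r, x))).toLinearMap (fun j => V j (r, x)) (U (r, x))
    simp only [ContinuousLinearMap.coe_coe, innerSL_apply_apply, hV, hU, hinner] at hcramer
    rw [fderiv_fun_mul hnx (hdiff hdetV)]
    simp only [fderiv_fun_mul hnx (hdiff (hdetU _))]
    simp only [add_apply, smul_apply, hpiola, hc,
      smul_eq_mul, inner_zero_right, mul_zero, add_zero, Finset.sum_add_distrib, Finset.mul_sum]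
    rw [left_eq_add]
    have : ∑ j, c * (inner ℝ x (e j).2 *
        euclideanDet d (Function.update (fun i => V i (r, x)) j (U (r, x)))) = 0 := by
      rw [← Finset.mul_sum]
      simp only [hV, hU]
      rw [hcramer]
      simp
    rw [← this]
    exact Finset.sum_congr rfl fun j _ => by simp only [he]; ring

end Homotopy

/-! ### The degree of homogeneous, norm preserving maps. -/

section Degree

variable {d : ℕ} {F : EuclideanSpace ℝ (Fin d) → EuclideanSpace ℝ (Fin d)}

/-- Polar coordinates, for the product of a radial function and a `0`-homogeneous function. -/
theorem integral_radial_mul_homogeneous (hd : 0 < d) (φ : ℝ → ℝ)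
    (g : EuclideanSpace ℝ (Fin d) → ℝ)
    (hg : ∀ c > (0 : ℝ), ∀ x, x ≠ 0 → g (c • x) = g x) :
    ∫ x, φ ‖x‖ * g x =
      (∫ ξ : Metric.sphere (0 : EuclideanSpace ℝ (Fin d)) 1, g ξ ∂volume.toSphere) *
        ∫ r : Set.Ioi (0 : ℝ), φ r ∂(Measure.volumeIoiPow
          (Module.finrank ℝ (EuclideanSpace ℝ (Fin d)) - 1)) := by
  have : NeZero d := ⟨hd.ne'⟩
  set μ := (volume : Measure (EuclideanSpace ℝ (Fin d))) with hμ
  calc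
    ∫ x, φ ‖x‖ * g x =
        ∫ x : ({(0)}ᶜ : Set (EuclideanSpace ℝ (Fin d))), φ ‖x.1‖ * g x.1 ∂(μ.comap (↑)) := by
      rw [integral_subtype_comap (measurableSet_singleton _).compl fun x => φ ‖x‖ * g x,
        restrict_compl_singleton]
    _ = ∫ x, g x.1 * φ x.2 ∂μ.toSphere.prod (.volumeIoiPow
          (Module.finrank ℝ (EuclideanSpace ℝ (Fin d)) - 1)) := by
      rw [← μ.measurePreserving_homeomorphUnitSphereProd.integral_comp
        (Homeomorph.measurableEmbedding _)]
      refine integral_congr_ae (Eventually.of_forall fun x => ?_)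
      have hx : (x : EuclideanSpace ℝ (Fin d)) ≠ 0 := x.2
      simp only [homeomorphUnitSphereProd_apply_fst_coe, homeomorphUnitSphereProd_apply_snd_coe]
      have := hg ‖(x : EuclideanSpace ℝ (Fin d))‖⁻¹ (inv_pos.2 (norm_pos_iff.2 hx)) _ hx
      rw [this, mul_comm]
    _ = _ := integral_prod_mul (fun ξ : Metric.sphere (0 : EuclideanSpace ℝ (Fin d)) 1 => g ξ)
          (fun r : Set.Ioi (0 : ℝ) => φ r)

theorem unitConeMap_smul (f : EuclideanSpace ℝ (Fin d) → EuclideanSpace ℝ (Fin d)) {c : ℝ}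
    (hc : 0 < c) (x : EuclideanSpace ℝ (Fin d)) :
    unitConeMap f (c • x) = c • unitConeMap f x := by
  have h : ‖c • x‖⁻¹ • c • x = ‖x‖⁻¹ • x := by
    rw [norm_smul, Real.norm_of_nonneg hc.le, smul_smul, mul_inv, mul_right_comm,
      inv_mul_cancel₀ hc.ne', one_mul]
  simp only [unitConeMap, h]
  rw [norm_smul, Real.norm_of_nonneg hc.le, mul_smul]

theorem norm_unitConeMap {f : EuclideanSpace ℝ (Fin d) → EuclideanSpace ℝ (Fin d)}
    (hf : ∀ ξ, ‖ξ‖ = 1 → f ξ ≠ 0) (x : EuclideanSpace ℝ (Fin d)) : ‖unitConeMap f x‖ = ‖x‖ := by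
  by_cases hx : x = 0
  · simp [hx, unitConeMap]
  · have h1 : f (‖x‖⁻¹ • x) ≠ 0 := hf _ (by simp [norm_smul, hx])
    simp [unitConeMap, norm_smul, h1]

theorem fderiv_homogeneous (hF : ∀ c > (0 : ℝ), ∀ x, F (c • x) = c • F x) {c : ℝ} (hc : 0 < c)
    (x : EuclideanSpace ℝ (Fin d)) : fderiv ℝ F (c • x) = fderiv ℝ F x := by
  have h1 : (F <| c • ·) = c • F := funext fun y => hF c hc y
  have h2 := fderiv_comp_smul (𝕜 := ℝ) (f := F) (x := x) c
  rw [h1, fderiv_const_smul_field] at h2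
  exact (smul_right_injective _ hc.ne' h2).symm

/-- The winding number as an integral over the whole space against a radial weight. -/
theorem windingNumber_mul_integral (hd : 0 < d) (φ : ℝ → ℝ)
    (f : EuclideanSpace ℝ (Fin d) → EuclideanSpace ℝ (Fin d)) :
    windingNumber f * ∫ x : EuclideanSpace ℝ (Fin d), φ ‖x‖ =
      ∫ x, φ ‖x‖ * (fderiv ℝ (unitConeMap f) x).det := by
  have : NeZero d := ⟨hd.ne'⟩
  have h1 := integral_radial_mul_homogeneous hd φ (fun _ => 1) (fun _ _ _ _ => rfl)
  -- The derivative of a 1-homogeneous map is 0-homogeneous, so polar coordinates split off the same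
  -- radial factor as in `h1`.
  have h2 := integral_radial_mul_homogeneous hd φ (fun x => (fderiv ℝ (unitConeMap f) x).det)
    (fun c hc x _ => by
      simp only [fderiv_homogeneous (fun c hc x => unitConeMap_smul f hc x) hc x])
  have h0 : (volume : Measure (EuclideanSpace ℝ (Fin d))).toSphere.real Set.univ ≠ 0 := by
    rw [Measure.real, ENNReal.toReal_ne_zero]
    exact ⟨by
      rw [Ne, Measure.measure_univ_eq_zero]
      exact Measure.toSphere_ne_zero volume, measure_ne_top _ _⟩
  simp only [mul_one, integral_const, smul_eq_mul] at h1
  rw [h1, h2, windingNumber]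
  field_simp

/-- A norm preserving homogeneous map of a line which is injective is odd. -/
theorem homogeneous_odd_of_finrank_eq_one (hd : d = 1) (hnorm : ∀ x, ‖F x‖ = ‖x‖)
    (hinj : Function.Injective F) (x : EuclideanSpace ℝ (Fin d)) : F (-x) = - F x := by
  by_cases hx : x = 0
  · have : F 0 = 0 := by simpa using hnorm 0
    simp [hx, this]
  have hFx : F x ≠ 0 := by
    rw [← norm_ne_zero_iff, hnorm]
    exact norm_ne_zero_iff.2 hx
  obtain ⟨c, hc⟩ := exists_smul_eq_of_finrank_eq_one (K := ℝ)
    (by simp [hd] : Module.finrank ℝ (EuclideanSpace ℝ (Fin d)) = 1) hFx (F (-x))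
  have habs : |c| = 1 := by
    have := congrArg norm hc
    rw [norm_smul, hnorm, hnorm, norm_neg, Real.norm_eq_abs] at this
    exact mul_right_cancel₀ (norm_ne_zero_iff.2 hx) (by rw [this, one_mul])
  rcases eq_or_eq_neg_of_abs_eq habs with h | h
  · rw [h, one_smul] at hc
    have h2 : (2 : ℝ) • x = 0 := by
      rw [two_smul]
      nth_rewrite 1 [hinj hc]
      exact neg_add_cancel x
    exact absurd ((smul_eq_zero.1 h2).resolve_left two_ne_zero) hx
  · rw [← hc, h, neg_one_smul]

theorem isPreconnected_compl_zero (hd : 1 < d) :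
    IsPreconnected ({0}ᶜ : Set (EuclideanSpace ℝ (Fin d))) := by
  refine (isConnected_compl_singleton_of_one_lt_rank ?_ _).isPreconnected
  rw [← Module.finrank_eq_rank]
  simpa using hd

/-- A norm preserving homogeneous injective immersion is onto. -/
theorem image_compl_zero_of_homogeneous (hd : 0 < d) (hnorm : ∀ x, ‖F x‖ = ‖x‖)
    (hhom : ∀ c > (0 : ℝ), ∀ x, F (c • x) = c • F x) (hsmooth : ContDiffOn ℝ 1 F {0}ᶜ)
    (hinj : Function.Injective F) (hdet : ∀ x, x ≠ 0 → (fderiv ℝ F x).det ≠ 0) :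
    F '' {0}ᶜ = {0}ᶜ := by
  have : NeZero d := ⟨hd.ne'⟩
  have hne : ∀ x, x ≠ 0 ↔ F x ≠ 0 := fun x => by
    rw [← norm_ne_zero_iff, ← hnorm, norm_ne_zero_iff]
  refine Set.Subset.antisymm ?_ ?_
  · rintro _ ⟨x, hx, rfl⟩
    exact (hne x).1 hx
  obtain ⟨x₀, hx₀⟩ := exists_ne (0 : EuclideanSpace ℝ (Fin d))
  -- For 1 < d the punctured space is connected, and the image is open in it by the inverse function
  -- theorem and closed in it because a continuous norm preserving map is proper. For d = 1 the
  -- punctured line has two components, and oddness replaces connectedness.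
  rcases Nat.lt_or_ge 1 d with h1 | h1
  · have hcont : Continuous F := by
      rw [continuous_iff_continuousAt]
      intro x
      by_cases hx : x = 0
      · have h0 : F 0 = 0 := by simpa using hnorm 0
        rw [hx, ContinuousAt, h0, tendsto_zero_iff_norm_tendsto_zero]
        simp only [hnorm]
        exact tendsto_norm_zero
      · exact (hsmooth.continuousOn).continuousAt (isOpen_compl_singleton.mem_nhds hx)
    have hclosed : IsClosed (Set.range F) := by
      refine (isProperMap_iff_tendsto_cocompact.2 ⟨hcont, ?_⟩).isClosedMap.isClosed_range
      rw [← Metric.cobounded_eq_cocompact, tendsto_norm_atTop_iff_cobounded.symm]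
      simp only [hnorm]
      exact tendsto_norm_cobounded_atTop
    have hopen : IsOpen (F '' {0}ᶜ) := by
      rw [isOpen_iff_mem_nhds]
      rintro _ ⟨x, hx, rfl⟩
      have hstrict : HasStrictFDerivAt F (fderiv ℝ F x) x :=
        (hsmooth.contDiffAt (isOpen_compl_singleton.mem_nhds hx)).hasStrictFDerivAt one_ne_zero
      rw [← (fderiv ℝ F x).coe_toContinuousLinearEquivOfDetNeZero (hdet x hx)] at hstrict
      rw [← hstrict.map_nhds_eq_of_equiv]
      exact image_mem_map (isOpen_compl_singleton.mem_nhds hx)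
    refine (isPreconnected_compl_zero h1).subset_of_closure_inter_subset hopen
      ⟨F x₀, (hne x₀).1 hx₀, x₀, hx₀, rfl⟩ ?_
    rintro y ⟨hy, hy0⟩
    obtain ⟨x, rfl⟩ := closure_minimal (Set.image_subset_range F _) hclosed hy
    exact ⟨x, (hne x).2 hy0, rfl⟩
  · intro y hy
    have hd1 : d = 1 := by omega
    obtain ⟨c, hc⟩ := exists_smul_eq_of_finrank_eq_one (K := ℝ)
      (by simp [hd1] : Module.finrank ℝ (EuclideanSpace ℝ (Fin d)) = 1) ((hne x₀).1 hx₀) y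
    have hc0 : c ≠ 0 := by
      rintro rfl
      exact hy (by simpa using hc.symm)
    rcases lt_or_gt_of_ne hc0 with h | h
    · refine ⟨(-c) • (-x₀), ?_, ?_⟩
      · simpa using ⟨hc0, hx₀⟩
      · rw [hhom _ (neg_pos.2 h), homogeneous_odd_of_finrank_eq_one hd1 hnorm hinj, smul_neg,
          neg_smul, neg_neg, hc]
    · exact ⟨c • x₀, by simpa using ⟨hc0, hx₀⟩, by rw [hhom _ h, hc]⟩

/-- The Jacobian determinant of a homogeneous injective immersion has constant sign. -/
theorem det_sign_of_homogeneous (hd : 0 < d) (hnorm : ∀ x, ‖F x‖ = ‖x‖)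
    (hhom : ∀ c > (0 : ℝ), ∀ x, F (c • x) = c • F x) (hsmooth : ContDiffOn ℝ 1 F {0}ᶜ)
    (hinj : Function.Injective F) (hdet : ∀ x, x ≠ 0 → (fderiv ℝ F x).det ≠ 0) :
    ∃ n : ℤ, n ≠ 0 ∧ ∀ x, x ≠ 0 → (fderiv ℝ F x).det = n * |(fderiv ℝ F x).det| := by
  have : NeZero d := ⟨hd.ne'⟩
  suffices h : (∀ x, x ≠ 0 → 0 < (fderiv ℝ F x).det) ∨ ∀ x, x ≠ 0 → (fderiv ℝ F x).det < 0 by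
    rcases h with h | h
    · exact ⟨1, one_ne_zero, fun x hx => by rw [abs_of_pos (h x hx)]; simp⟩
    · exact ⟨-1, by simp, fun x hx => by rw [abs_of_neg (h x hx)]; simp⟩
  obtain ⟨x₀, hx₀⟩ := exists_ne (0 : EuclideanSpace ℝ (Fin d))
  suffices h : ∀ x, x ≠ 0 → 0 < (fderiv ℝ F x₀).det * (fderiv ℝ F x).det by
    rcases lt_or_gt_of_ne (hdet x₀ hx₀) with h0 | h0
    · exact Or.inr fun x hx => neg_of_mul_pos_right (h x hx) h0.le
    · exact Or.inl fun x hx => pos_of_mul_pos_right (h x hx) h0.le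
  rcases Nat.lt_or_ge 1 d with h1 | h1
  · have hcont : ContinuousOn (fun x => (fderiv ℝ F x).det) {0}ᶜ :=
      ContinuousLinearMap.continuous_det.comp_continuousOn
        (hsmooth.continuousOn_fderiv_of_isOpen isOpen_compl_singleton le_rfl)
    intro x hx
    by_contra hle
    have hmem : (0 : ℝ) ∈ (fun x => (fderiv ℝ F x₀).det * (fderiv ℝ F x).det) '' {0}ᶜ :=
      (isPreconnected_compl_zero h1).intermediate_value hx hx₀ (continuousOn_const.mul hcont)
        ⟨not_lt.1 hle, mul_self_nonneg _⟩
    obtain ⟨y, hy, hy0⟩ := hmem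
    exact mul_ne_zero (hdet x₀ hx₀) (hdet y hy) hy0
  · intro x hx
    have hd1 : d = 1 := by omega
    obtain ⟨c, rfl⟩ := exists_smul_eq_of_finrank_eq_one (K := ℝ)
      (by simp [hd1] : Module.finrank ℝ (EuclideanSpace ℝ (Fin d)) = 1) hx₀ x
    have hpos := mul_self_pos.2 (hdet x₀ hx₀)
    have hc0 : c ≠ 0 := by
      rintro rfl
      exact hx (by simp)
    rcases lt_or_gt_of_ne hc0 with h | h
    · have hodd := homogeneous_odd_of_finrank_eq_one hd1 hnorm hinj
      -- The derivative of an odd function is even, which carries the sign from one half-line to the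
      -- other.
      have h2 : fderiv ℝ F (-x₀) = fderiv ℝ F x₀ := by
        have h3 := fderiv_comp_smul (𝕜 := ℝ) (f := F) (x := x₀) (-1)
        have h4 : (F <| (-1 : ℝ) • ·) = (-1 : ℝ) • F := funext fun y => by simpa using hodd y
        rw [h4, fderiv_const_smul_field] at h3
        simpa using h3.symm
      rw [show c • x₀ = (-c) • (-x₀) by simp, fderiv_homogeneous hhom (neg_pos.2 h), h2]
      exact hpos
    · rw [fderiv_homogeneous hhom h]
      exact hpos

/-- The degree integral of a norm preserving homogeneous injective immersion is a nonzero integer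
multiple of the volume. -/
theorem integral_radial_mul_det (hd : 0 < d) (φ : ℝ → ℝ) (hnorm : ∀ x, ‖F x‖ = ‖x‖)
    (hhom : ∀ c > (0 : ℝ), ∀ x, F (c • x) = c • F x) (hsmooth : ContDiffOn ℝ 1 F {0}ᶜ)
    (hinj : Function.Injective F) (himm : ∀ x, x ≠ 0 → ∀ k, fderiv ℝ F x k = 0 → k = 0) :
    ∃ n : ℤ, n ≠ 0 ∧ ∫ x, φ ‖x‖ * (fderiv ℝ F x).det =
      n * ∫ x : EuclideanSpace ℝ (Fin d), φ ‖x‖ := by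
  have : NeZero d := ⟨hd.ne'⟩
  have hdet : ∀ x, x ≠ 0 → (fderiv ℝ F x).det ≠ 0 := by
    intro x hx h
    obtain ⟨k, hk, hk0⟩ := (Submodule.ne_bot_iff _).1
      (LinearMap.bot_lt_ker_of_det_eq_zero h).ne'
    exact hk0 (himm x hx k hk)
  obtain ⟨n, hn, hsign⟩ := det_sign_of_homogeneous hd hnorm hhom hsmooth hinj hdet
  refine ⟨n, hn, ?_⟩
  have hae : ∀ g : EuclideanSpace ℝ (Fin d) → ℝ, ∫ x, g x = ∫ x in {0}ᶜ, g x := fun g => by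
    rw [restrict_compl_singleton]
  -- F is a norm preserving bijection of the punctured space, so the integral of φ(‖x‖) |det DF|
  -- equals that of φ(‖x‖). Only the constant sign n of the determinant is left over.
  have hcv := integral_image_eq_integral_abs_det_fderiv_smul
    (volume : Measure (EuclideanSpace ℝ (Fin d))) (measurableSet_singleton 0).compl
    (f := F) (f' := fderiv ℝ F)
    (fun x hx => ((hsmooth.contDiffAt (isOpen_compl_singleton.mem_nhds hx)).differentiableAt
      one_ne_zero).hasFDerivAt.hasFDerivWithinAt) hinj.injOn (fun x => φ ‖x‖)
  rw [image_compl_zero_of_homogeneous hd hnorm hhom hsmooth hinj hdet] at hcv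
  rw [hae, hae (fun x => φ ‖x‖), hcv, ← integral_const_mul]
  refine setIntegral_congr_fun (measurableSet_singleton 0).compl fun x hx => ?_
  simp only [hnorm, smul_eq_mul]
  rw [hsign x hx, abs_mul, abs_abs]
  have : |(n : ℝ)| * |(fderiv ℝ F x).det| = |(fderiv ℝ F x).det| := by
    rw [← abs_abs (fderiv ℝ F x).det, ← abs_mul, ← hsign x hx, abs_abs]
  rw [this]
  ring

end Degree

/-! ### Cone estimates for curves issuing from a hyperbolic saddle. -/

section Cone

/-- Used to contradict maximality: a small step backwards in time increases the cone form. -/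
theorem HasDerivAt.eventually_lt_left_of_neg {f : ℝ → ℝ} {f' x : ℝ} (h : HasDerivAt f f' x)
    (hf' : f' < 0) : ∀ᶠ y in 𝓝[<] x, f x < f y := by
  have h1 : Tendsto (slope f x) (𝓝[<] x) (𝓝 f') :=
    (hasDerivWithinAt_iff_tendsto_slope' (by simp)).1 h.hasDerivWithinAt
  filter_upwards [h1.eventually_lt_const hf', self_mem_nhdsWithin] with y hy hyx
  rw [slope_def_field, div_neg_iff] at hy
  have hyx' : y - x < 0 := sub_neg.2 hyx
  rcases hy with hy | hy
  · linarith [hy.1]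
  · linarith [hy.2]

variable {V : Type*} [NormedAddCommGroup V] [InnerProductSpace ℝ V] {S P : V →L[ℝ] V} {a ε η : ℝ}

/-- The quadratic form whose nonpositivity defines a cone about the range of a projection. -/
def coneForm (P : V →L[ℝ] V) (ε : ℝ) (x : V) : ℝ := ‖x - P x‖ ^ 2 - ε ^ 2 * ‖P x‖ ^ 2

/-- `P` is an orthogonal projection, and the quadratic form of `S` is at least `a` on its range
and at most `-a` on its kernel. -/
structure IsHyperbolicSplitting (S P : V →L[ℝ] V) (a : ℝ) : Prop where
  pos : 0 < a
  orthogonal : ∀ x y, inner ℝ (P x) (y - P y) = 0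
  expanding : ∀ x, a * ‖P x‖ ^ 2 ≤ inner ℝ (S x) (P x)
  contracting : ∀ x, inner ℝ (S x) (x - P x) ≤ - (a * ‖x - P x‖ ^ 2)

namespace IsHyperbolicSplitting

theorem norm_sq_eq (h : IsHyperbolicSplitting S P a) (x : V) :
    ‖x‖ ^ 2 = ‖P x‖ ^ 2 + ‖x - P x‖ ^ 2 := by
  have h1 := norm_add_sq_real (P x) (x - P x)
  rw [h.orthogonal, add_sub_cancel] at h1
  linarith

theorem norm_compl_le_of_coneForm (hε : 0 ≤ ε) {x : V}
    (hx : coneForm P ε x ≤ 0) : ‖x - P x‖ ≤ ε * ‖P x‖ := by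
  rw [coneForm] at hx
  exact le_of_sq_le_sq (by rw [mul_pow]; linarith) (by positivity)

theorem norm_compl_le (h : IsHyperbolicSplitting S P a) (hε : 0 ≤ ε) {x : V}
    (hx : coneForm P ε x ≤ 0) : ‖x - P x‖ ≤ ε * ‖x‖ := by
  refine (norm_compl_le_of_coneForm hε hx).trans (mul_le_mul_of_nonneg_left ?_ hε)
  have := h.norm_sq_eq x
  exact le_of_sq_le_sq (by nlinarith [sq_nonneg ‖x - P x‖]) (norm_nonneg _)

/-- The quadratic form of `S` is coercive on narrow cones about the range of `P`. -/
theorem coercive (h : IsHyperbolicSplitting S P a) (hε : 0 ≤ ε) (hε1 : ε ≤ 1)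
    (hεS : 4 * ‖S‖ * ε ≤ a) {x : V} (hx : coneForm P ε x ≤ 0) :
    a / 4 * ‖x‖ ^ 2 ≤ inner ℝ (S x) x := by
  have hQ := norm_compl_le_of_coneForm hε hx
  -- The first term is at least a ‖P x‖². In the cone ‖x‖ ≤ 2 ‖P x‖, so the second is at most 2 ‖S‖
  -- ε ‖P x‖² ≤ (a/2) ‖P x‖² in size. Finally ‖P x‖² ≥ ‖x‖²/2.
  have h1 : inner ℝ (S x) x = inner ℝ (S x) (P x) + inner ℝ (S x) (x - P x) := by
    rw [← inner_add_right, add_sub_cancel]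
  have h2 : |inner ℝ (S x) (x - P x)| ≤ ‖S‖ * ‖x‖ * ‖x - P x‖ :=
    (abs_real_inner_le_norm _ _).trans
      (mul_le_mul_of_nonneg_right (S.le_opNorm x) (norm_nonneg _))
  have h3 : ‖x‖ ≤ 2 * ‖P x‖ := by
    have : ‖x‖ ≤ ‖P x‖ + ‖x - P x‖ := by
      simpa using norm_add_le (P x) (x - P x)
    nlinarith [norm_nonneg (P x)]
  have h4 : ‖S‖ * ‖x‖ * ‖x - P x‖ ≤ ‖S‖ * (2 * ‖P x‖) * (ε * ‖P x‖) := by gcongr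
  have h5 := h.expanding x
  have h6 := h.norm_sq_eq x
  have h7 : ‖x - P x‖ ^ 2 ≤ ‖P x‖ ^ 2 := by
    have : ‖x - P x‖ ≤ ‖P x‖ := hQ.trans (by nlinarith [norm_nonneg (P x)])
    gcongr
  have h8 : 4 * ‖S‖ * ε * ‖P x‖ ^ 2 ≤ a * ‖P x‖ ^ 2 := by gcongr
  have h9 := (abs_le.1 h2).1
  have := h.pos
  nlinarith

/-- Along a curve whose velocity is nearly `S` applied to its position, the cone form decreases. -/
theorem hasDerivAt_coneForm (h : IsHyperbolicSplitting S P a) (hε : 0 < ε) (hε1 : ε ≤ 1)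
    (hη : 4 * η ≤ ε ^ 2 * a) {δ : ℝ → V} {δ' : V} {t : ℝ} (hδ : HasDerivAt δ δ' t)
    (h0 : δ t ≠ 0) (hδ' : ‖δ' - S (δ t)‖ ≤ η * ‖δ t‖) :
    ∃ D < 0, HasDerivAt (fun s => coneForm P ε (δ s)) D t := by
  have hPδ : HasDerivAt (fun s => P (δ s)) (P δ') t := P.hasFDerivAt.comp_hasDerivAt t hδ
  refine ⟨_, ?_, (hδ.sub hPδ).norm_sq.sub (hPδ.norm_sq.const_mul (ε ^ 2))⟩
  set x := δ t with hx
  -- Half of the derivative is ⟨x - P x, δ'⟩ - ε² ⟨P x, δ'⟩. The part from S is at most -ε² a ‖x‖²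
  -- and the error at most 2 η ‖x‖², so 4η ≤ ε² a leaves it negative.
  have e1 : inner ℝ (x - P x) (δ' - P δ') = inner ℝ (x - P x) δ' := by
    rw [inner_sub_right, real_inner_comm (P δ') (x - P x), h.orthogonal, sub_zero]
  have e2 : inner ℝ (P x) (P δ') = inner ℝ (P x) δ' := by
    have := h.orthogonal x δ'
    rw [inner_sub_right] at this
    linarith
  set R := δ' - S x with hR
  have hδR : δ' = S x + R := by rw [hR]; abel
  have e3 : inner ℝ (x - P x) δ' ≤ - (a * ‖x - P x‖ ^ 2) + ‖x‖ * (η * ‖x‖) := by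
    rw [hδR, inner_add_right, real_inner_comm]
    refine add_le_add (h.contracting x) ((real_inner_le_norm _ _).trans ?_)
    gcongr
    exact le_of_sq_le_sq (by nlinarith [h.norm_sq_eq x, sq_nonneg ‖P x‖]) (norm_nonneg _)
  have e4 : a * ‖P x‖ ^ 2 - ‖x‖ * (η * ‖x‖) ≤ inner ℝ (P x) δ' := by
    rw [hδR, inner_add_right, real_inner_comm]
    have h1 : |inner ℝ (P x) R| ≤ ‖x‖ * (η * ‖x‖) := by
      refine (abs_real_inner_le_norm _ _).trans ?_
      gcongr
      exact le_of_sq_le_sq (by nlinarith [h.norm_sq_eq x, sq_nonneg ‖x - P x‖]) (norm_nonneg _)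
    linarith [h.expanding x, (abs_le.1 h1).1]
  simp only [Pi.sub_apply]
  rw [e1, e2]
  have hxpos : 0 < ‖x‖ ^ 2 := by positivity
  have hε2 : ε ^ 2 ≤ 1 := pow_le_one₀ hε.le hε1
  have hη0 : 0 ≤ η := by
    by_contra hneg
    have := (norm_nonneg _).trans hδ'
    nlinarith [norm_pos_iff.2 h0]
  have h6 := h.norm_sq_eq x
  have hε0 : 0 < ε ^ 2 := by positivity
  have ha := h.pos
  have e5 : ε ^ 2 * (a * ‖P x‖ ^ 2 - ‖x‖ * (η * ‖x‖)) ≤ ε ^ 2 * inner ℝ (P x) δ' := by gcongr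
  have e6 : ε ^ 2 * (η * ‖x‖ ^ 2) ≤ 1 * (η * ‖x‖ ^ 2) := by gcongr
  have e7 : ε ^ 2 * (a * ‖x - P x‖ ^ 2) ≤ 1 * (a * ‖x - P x‖ ^ 2) := by gcongr
  have e8 : 4 * η * ‖x‖ ^ 2 ≤ ε ^ 2 * a * ‖x‖ ^ 2 := by gcongr
  have e9 : 0 < ε ^ 2 * a * ‖x‖ ^ 2 := by positivity
  have e10 : ε ^ 2 * a * ‖x‖ ^ 2 = ε ^ 2 * (a * ‖P x‖ ^ 2) + ε ^ 2 * (a * ‖x - P x‖ ^ 2) := by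
    rw [h6]; ring
  nlinarith

theorem continuous_coneForm : Continuous (coneForm P ε) := by
  unfold coneForm
  fun_prop

/-- A curve issuing from the saddle stays in the cone. -/
theorem coneForm_curve_nonpos (h : IsHyperbolicSplitting S P a) (hε : 0 < ε) (hε1 : ε ≤ 1)
    (hη : 4 * η ≤ ε ^ 2 * a) {T : ℝ} {u G : ℝ → V} (hu : ContinuousOn u (Set.Icc 0 T))
    (hu0 : u 0 = 0)
    (hflow : ∀ t ∈ Set.Ioc 0 T, ∃ ρ > (0 : ℝ), HasDerivAt u (ρ • G t) t)
    (hG : ∀ t ∈ Set.Ioc 0 T, ‖G t - S (u t)‖ ≤ η * ‖u t‖) :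
    ∀ t ∈ Set.Icc 0 T, coneForm P ε (u t) ≤ 0 := by
  intro t ht
  -- A positive maximum would lie at some s > 0, as the form vanishes at time 0. The form decreases
  -- along the flow, so it was larger just before s.
  obtain ⟨s, hs, hmax⟩ := isCompact_Icc.exists_isMaxOn ⟨t, ht⟩
    ((continuous_coneForm (P := P) (ε := ε)).comp_continuousOn hu)
  refine (hmax ht).trans ?_
  change coneForm P ε (u s) ≤ 0
  by_contra! hpos
  have hus : u s ≠ 0 := fun e => by simp [e, coneForm] at hpos
  have hs0 : s ≠ 0 := fun e => hus (e ▸ hu0)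
  have hs' : s ∈ Set.Ioc 0 T := ⟨lt_of_le_of_ne hs.1 hs0.symm, hs.2⟩
  obtain ⟨ρ, hρ, hd⟩ := hflow s hs'
  -- Rescaling time by ρ⁻¹ turns the velocity ρ G into G at the point in question. Positivity of ρ
  -- preserves the direction of time.
  have haff : HasDerivAt (fun θ : ℝ => s + ρ⁻¹ * θ) ρ⁻¹ 0 := by
    simpa using ((hasDerivAt_id (0 : ℝ)).const_mul ρ⁻¹).const_add s
  have hd' : HasDerivAt (fun θ => u (s + ρ⁻¹ * θ)) (G s) 0 := by
    have := HasDerivAt.scomp (g₁ := u) (h := fun θ : ℝ => s + ρ⁻¹ * θ) 0 (by simpa using hd) haff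
    simpa [smul_smul, inv_mul_cancel₀ hρ.ne', Function.comp_def] using this
  obtain ⟨D, hD, hder⟩ := h.hasDerivAt_coneForm hε hε1 hη hd' (by simpa using hus)
    (by simpa using hG s hs')
  have hnear : ∀ᶠ θ in 𝓝[<] (0 : ℝ), 0 ≤ s + ρ⁻¹ * θ := by
    have : ∀ᶠ θ in 𝓝 (0 : ℝ), 0 < s + ρ⁻¹ * θ :=
      haff.continuousAt.eventually (lt_mem_nhds (by simpa using hs'.1))
    filter_upwards [this.filter_mono nhdsWithin_le_nhds] with θ hθ using hθ.le
  obtain ⟨θ, hlt, hge, hθ⟩ := ((HasDerivAt.eventually_lt_left_of_neg hder hD).and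
    (hnear.and self_mem_nhdsWithin)).exists
  have hle : s + ρ⁻¹ * θ ≤ T := by
    have : ρ⁻¹ * θ ≤ 0 := mul_nonpos_of_nonneg_of_nonpos (by positivity) (le_of_lt hθ)
    linarith [hs.2]
  have := hmax ⟨hge, hle⟩
  simp only [Function.comp_apply, Set.mem_ofPred_eq] at this
  simp only [mul_zero, add_zero] at hlt
  exact absurd this (not_le.2 hlt)

/-- The difference of two points on curves issuing from the saddle lies in the cone. -/
theorem coneForm_sub_nonpos (h : IsHyperbolicSplitting S P a) (hε : 0 < ε) (hε1 : ε ≤ 1)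
    (hη : 4 * η ≤ ε ^ 2 * a) {T : ℝ} {u G v K : ℝ → V}
    (hu : ContinuousOn u (Set.Icc 0 T)) (hu0 : u 0 = 0)
    (huflow : ∀ t ∈ Set.Ioc 0 T, ∃ ρ > (0 : ℝ), HasDerivAt u (ρ • G t) t)
    (hucone : ∀ t ∈ Set.Icc 0 T, coneForm P ε (u t) ≤ 0)
    (hv : ContinuousOn v (Set.Icc 0 T)) (hv0 : v 0 = 0)
    (hvflow : ∀ t ∈ Set.Ioc 0 T, ∃ ρ > (0 : ℝ), HasDerivAt v (ρ • K t) t)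
    (hvcone : ∀ t ∈ Set.Icc 0 T, coneForm P ε (v t) ≤ 0)
    (hG : ∀ s ∈ Set.Ioc 0 T, ∀ t ∈ Set.Ioc 0 T,
      ‖G s - K t - S (u s - v t)‖ ≤ η * ‖u s - v t‖) :
    ∀ s ∈ Set.Icc 0 T, ∀ t ∈ Set.Icc 0 T, coneForm P ε (u s - v t) ≤ 0 := by
  intro s' hs' t' ht'
  have hcont : ContinuousOn (fun q : ℝ × ℝ => coneForm P ε (u q.1 - v q.2))
      (Set.Icc 0 T ×ˢ Set.Icc 0 T) :=
    (continuous_coneForm (P := P) (ε := ε)).comp_continuousOn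
      ((hu.comp continuousOn_fst fun q hq => hq.1).sub
        (hv.comp continuousOn_snd fun q hq => hq.2))
  -- The two curves carry different time factors ρ and σ, so at equal times their difference obeys
  -- no nearly linear equation. Maximizing over two independent times allows each curve to be
  -- rescaled by its own factor. The edges s = 0 and t = 0 reduce to a single curve.
  obtain ⟨⟨s, t⟩, ⟨hs, ht⟩, hmax⟩ := (isCompact_Icc.prod isCompact_Icc).exists_isMaxOn
    ⟨(s', t'), hs', ht'⟩ hcont
  refine (hmax (Set.mk_mem_prod hs' ht')).trans ?_
  change coneForm P ε (u s - v t) ≤ 0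
  simp only at hs ht
  by_contra! hpos
  have hneg : ∀ x, coneForm P ε (-x) = coneForm P ε x := fun x => by
    simp only [coneForm, map_neg]
    rw [← norm_neg (x - P x), norm_neg (P x)]
    congr 3
    abel
  have hne : u s - v t ≠ 0 := fun e => by simp [e, coneForm] at hpos
  have hs0 : s ≠ 0 := fun e => by
    rw [e, hu0, zero_sub, hneg] at hpos
    exact absurd (hvcone t ht) (not_le.2 hpos)
  have ht0 : t ≠ 0 := fun e => by
    rw [e, hv0, sub_zero] at hpos
    exact absurd (hucone s hs) (not_le.2 hpos)
  have hsI : s ∈ Set.Ioc 0 T := ⟨lt_of_le_of_ne hs.1 hs0.symm, hs.2⟩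
  have htI : t ∈ Set.Ioc 0 T := ⟨lt_of_le_of_ne ht.1 ht0.symm, ht.2⟩
  have haff : ∀ s ρ : ℝ, HasDerivAt (fun θ : ℝ => s + ρ⁻¹ * θ) ρ⁻¹ 0 := fun s ρ => by
    simpa using ((hasDerivAt_id (0 : ℝ)).const_mul ρ⁻¹).const_add s
  have hrep : ∀ (w : ℝ → V) (k : V) (s ρ : ℝ), 0 < ρ → HasDerivAt w (ρ • k) s →
      HasDerivAt (fun θ => w (s + ρ⁻¹ * θ)) k 0 := fun w k s ρ hρ hd => by
    have := HasDerivAt.scomp (g₁ := w) (h := fun θ : ℝ => s + ρ⁻¹ * θ) 0 (by simpa using hd)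
      (haff s ρ)
    simpa [smul_smul, inv_mul_cancel₀ hρ.ne', Function.comp_def] using this
  obtain ⟨ρ, hρ, hd⟩ := huflow s hsI
  obtain ⟨σ, hσ, hd2⟩ := hvflow t htI
  obtain ⟨D, hD, hder⟩ := h.hasDerivAt_coneForm hε hε1 hη
    ((hrep u _ s ρ hρ hd).sub (hrep v _ t σ hσ hd2)) (by simpa using hne)
    (by simpa using hG s hsI t htI)
  have hnear : ∀ s ρ : ℝ, 0 < s → 0 < ρ → s ≤ T →
      ∀ᶠ θ in 𝓝[<] (0 : ℝ), s + ρ⁻¹ * θ ∈ Set.Icc 0 T := by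
    intro s ρ hs hρ hsT
    have : ∀ᶠ θ in 𝓝 (0 : ℝ), 0 < s + ρ⁻¹ * θ :=
      (haff s ρ).continuousAt.eventually (lt_mem_nhds (by simpa using hs))
    filter_upwards [this.filter_mono nhdsWithin_le_nhds, self_mem_nhdsWithin] with θ hθ hθ0
    have : ρ⁻¹ * θ ≤ 0 := mul_nonpos_of_nonneg_of_nonpos (by positivity) (le_of_lt hθ0)
    exact ⟨hθ.le, by linarith⟩
  obtain ⟨θ, hlt, h1, h2⟩ := ((HasDerivAt.eventually_lt_left_of_neg hder hD).and
    ((hnear s ρ hsI.1 hρ hs.2).and (hnear t σ htI.1 hσ ht.2))).exists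
  have := hmax (Set.mk_mem_prod h1 h2)
  simp only [Set.mem_ofPred_eq] at this
  simp only [Pi.sub_apply, mul_zero, add_zero] at hlt
  exact absurd this (not_le.2 hlt)

/-- A priori bound: curves issuing from the saddle stay in a fixed ball for a uniform time. -/
theorem norm_curve_le (h : IsHyperbolicSplitting S P a) (hε : 0 < ε) (hε1 : ε ≤ 1)
    (hεS : 4 * ‖S‖ * ε ≤ a) (hη : 4 * η ≤ ε ^ 2 * a) (hη' : η ≤ a / 16) {T r : ℝ} (hr : 0 < r)
    (hT : T < a / 16 * r ^ 2) {u G : ℝ → V}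
    (hu : ContinuousOn u (Set.Icc 0 T)) (hu0 : u 0 = 0)
    (hflow : ∀ t ∈ Set.Ioc 0 T, ‖u t‖ ≤ r → ∃ ρ > (0 : ℝ), HasDerivAt u (ρ • G t) t)
    (hG : ∀ t ∈ Set.Ioc 0 T, ‖u t‖ ≤ r → ‖G t - S (u t)‖ ≤ η * ‖u t‖)
    (hlevel : ∀ t ∈ Set.Ioc 0 T, ‖u t‖ ≤ r → |t - inner ℝ (S (u t)) (u t) / 2| ≤ η * ‖u t‖ ^ 2) :
    ∀ t ∈ Set.Icc 0 T, ‖u t‖ ≤ r := by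
  by_contra! hcon
  obtain ⟨t₁, ht₁, hbig⟩ := hcon
  have hcomp : IsCompact (Set.Icc 0 T ∩ u ⁻¹' {x | r ≤ ‖x‖}) :=
    isCompact_Icc.of_isClosed_subset
      (hu.preimage_isClosed_of_isClosed isClosed_Icc (isClosed_le continuous_const continuous_norm))
      Set.inter_subset_left
  -- At the first time s with ‖u s‖ ≥ r the curve has so far stayed in the ball, hence in the cone.
  -- Coercivity then gives s ≥ (a/8 - a/16) r², contrary to s ≤ T.
  obtain ⟨s, ⟨hs, hsr⟩, hmin⟩ := hcomp.exists_isLeast ⟨t₁, ht₁, hbig.le⟩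
  have hlt : ∀ t ∈ Set.Ico 0 s, ‖u t‖ < r := by
    intro t ht
    by_contra! hge
    exact absurd (hmin ⟨⟨ht.1, ht.2.le.trans hs.2⟩, hge⟩) (not_le.2 ht.2)
  have hs0 : s ≠ 0 := by
    rintro rfl
    simp only [Set.mem_preimage, Set.mem_ofPred_eq, hu0, norm_zero] at hsr
    linarith
  have hspos : 0 < s := lt_of_le_of_ne hs.1 hs0.symm
  have husr : ‖u s‖ ≤ r := by
    have hcw : Tendsto (fun t => ‖u t‖) (𝓝[Set.Ico 0 s] s) (𝓝 ‖u s‖) :=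
      ((hu s hs).mono fun t ht => ⟨ht.1, ht.2.le.trans hs.2⟩).norm
    have : (𝓝[Set.Ico 0 s] s).NeBot := by
      rw [nhdsWithin_Ico_eq_nhdsLT hspos]
      infer_instance
    exact le_of_tendsto hcw (by
      filter_upwards [self_mem_nhdsWithin] with t ht using (hlt t ht).le)
  have hball : ∀ t ∈ Set.Icc 0 s, ‖u t‖ ≤ r := fun t ht => by
    rcases eq_or_lt_of_le ht.2 with e | e
    · rwa [e]
    · exact (hlt t ⟨ht.1, e⟩).le
  have hsub : ∀ t ∈ Set.Ioc 0 s, t ∈ Set.Ioc 0 T ∧ ‖u t‖ ≤ r := fun t ht =>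
    ⟨⟨ht.1, ht.2.trans hs.2⟩, hball t ⟨ht.1.le, ht.2⟩⟩
  have hcone := h.coneForm_curve_nonpos hε hε1 hη
    (hu.mono (Set.Icc_subset_Icc_right hs.2)) hu0
    (fun t ht => hflow t (hsub t ht).1 (hsub t ht).2)
    (fun t ht => hG t (hsub t ht).1 (hsub t ht).2) s ⟨hspos.le, le_rfl⟩
  have hco := h.coercive hε.le hε1 hεS hcone
  have hl := (abs_le.1 (hlevel s ⟨hspos, hs.2⟩ husr)).1
  have hr2 : r ^ 2 ≤ ‖u s‖ ^ 2 := pow_le_pow_left₀ hr.le hsr 2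
  have : η * ‖u s‖ ^ 2 ≤ a / 16 * ‖u s‖ ^ 2 := by gcongr
  have : a / 16 * r ^ 2 ≤ a / 16 * ‖u s‖ ^ 2 := by
    have := h.pos
    gcongr
  linarith [hs.2]

variable {E : Type*} [NormedAddCommGroup E] [NormedSpace ℝ E] {L : V →L[ℝ] E} {c θ κ l : ℝ}

/-- Two points of the cone on the same level are separated by the directions of their images
under a map that is nondegenerate on the cone. -/
theorem separation (hη0 : 0 ≤ η)
    (hsymm : ∀ x y, inner ℝ (S x) y = inner ℝ x (S y)) (hc : 0 < c) (hL : ∀ x, c * ‖P x‖ ≤ ‖L (P x)‖)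
    (hθ0 : 0 ≤ θ) (hθ1 : θ ≤ 1 / 4) (hsmall : κ + η + (‖L‖ + c) * ε ≤ c * θ)
    (hθ : 9 * ‖S‖ * θ + 4 * η < a / 4) (hκ : 0 ≤ κ) (hl : 0 ≤ l)
    {u v : V} {mu mv : E}
    (hQδ : ‖(u - v) - P (u - v)‖ ≤ ε * ‖u - v‖) (hQv : ‖v - P v‖ ≤ ε * ‖v‖)
    (hv : a / 4 * ‖v‖ ^ 2 ≤ inner ℝ (S v) v)
    (hlevel : |inner ℝ (S u) u - inner ℝ (S v) v| ≤ η * (‖u‖ + ‖v‖) * ‖u - v‖)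
    (hmδ : ‖mu - mv - L (u - v)‖ ≤ η * ‖u - v‖) (hmv : ‖mv - L v‖ ≤ η * ‖v‖) :
    κ * ‖u - v‖ ≤ ‖mu - l • mv‖ := by
  by_contra! hcon
  set δ := u - v with hδ
  set β := l - 1 with hβ
  -- This is u - l v. If mu is nearly l mv, then L x is small. Since x - P x is also small and L is
  -- bounded below on the range of P, x is small compared with ‖δ‖ + |β| ‖v‖.
  set x := δ - β • v with hx
  set σ := |β| * ‖v‖ with hσ
  have hσ0 : 0 ≤ σ := by positivity
  have hβv : ‖β • v‖ = σ := by rw [norm_smul, Real.norm_eq_abs]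
  have hQx : ‖x - P x‖ ≤ ε * (‖δ‖ + σ) := by
    have e : x - P x = (δ - P δ) - β • (v - P v) := by
      simp only [hx, map_sub, map_smul, smul_sub]
      abel
    rw [e]
    refine (norm_sub_le _ _).trans ?_
    rw [norm_smul, Real.norm_eq_abs, mul_add]
    refine add_le_add hQδ ?_
    calc |β| * ‖v - P v‖ ≤ |β| * (ε * ‖v‖) := by gcongr
      _ = ε * σ := by rw [hσ]; ring
  have hLx : ‖L x‖ ≤ κ * ‖δ‖ + η * (‖δ‖ + σ) := by
    have e : L x = (mu - l • mv) - (mu - mv - L δ) + β • (mv - L v) := by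
      simp only [hx, map_sub, map_smul, smul_sub, hβ, sub_smul, one_smul]
      abel
    rw [e]
    refine (norm_add_le _ _).trans ?_
    have e1 : ‖β • (mv - L v)‖ ≤ η * σ := by
      rw [norm_smul, Real.norm_eq_abs]
      calc |β| * ‖mv - L v‖ ≤ |β| * (η * ‖v‖) := by gcongr
        _ = η * σ := by rw [hσ]; ring
    have e2 := norm_sub_le (mu - l • mv) (mu - mv - L δ)
    linarith
  have hPx : c * ‖P x‖ ≤ ‖L x‖ + ‖L‖ * ‖x - P x‖ := by
    have e : L (P x) = L x - L (x - P x) := by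
      have := L.map_sub x (P x)
      rw [this, sub_sub_cancel]
    refine (hL x).trans ?_
    rw [e]
    exact (norm_sub_le _ _).trans (add_le_add le_rfl (L.le_opNorm _))
  have hxle : ‖x‖ ≤ θ * (‖δ‖ + σ) := by
    have e1 : ‖x‖ ≤ ‖P x‖ + ‖x - P x‖ := by simpa using norm_add_le (P x) (x - P x)
    have e2 : ‖L‖ * ‖x - P x‖ ≤ ‖L‖ * (ε * (‖δ‖ + σ)) := by gcongr
    have e3 : c * ‖x - P x‖ ≤ c * (ε * (‖δ‖ + σ)) := by gcongr
    have e4 : κ * ‖δ‖ ≤ κ * (‖δ‖ + σ) := by gcongr; linarith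
    have e5 : (κ + η + (‖L‖ + c) * ε) * (‖δ‖ + σ) ≤ c * θ * (‖δ‖ + σ) := by gcongr
    have e6 : c * ‖x‖ ≤ c * (‖P x‖ + ‖x - P x‖) := by gcongr
    have : c * ‖x‖ ≤ c * (θ * (‖δ‖ + σ)) := by linarith
    exact le_of_mul_le_mul_left this hc
  have hδle : ‖δ‖ ≤ 2 * σ := by
    have e : δ = β • v + x := by rw [hx]; abel
    have e1 : ‖δ‖ ≤ σ + ‖x‖ := by
      calc ‖δ‖ = ‖β • v + x‖ := congrArg norm e
        _ ≤ _ := (norm_add_le _ _).trans (by rw [hβv])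
    have e2 : θ * (‖δ‖ + σ) ≤ 1 / 4 * (‖δ‖ + σ) := by gcongr
    linarith
  have hx3 : ‖x‖ ≤ 3 * θ * σ := by
    have : θ * (‖δ‖ + σ) ≤ θ * (2 * σ + σ) := by gcongr
    linarith
  set w := (1 + l) * ‖v‖ with hw
  have hw0 : 0 ≤ w := by positivity
  have hβl : |β| ≤ 1 + l := by
    rw [abs_le]
    constructor <;> simp only [hβ] <;> linarith
  have hσw : σ ≤ w := by
    rw [hσ, hw]
    gcongr
  have hvw : ‖v‖ ≤ w := by
    have : 0 ≤ l * ‖v‖ := by positivity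
    rw [hw, add_mul, one_mul]
    linarith
  have huv : ‖u + v‖ ≤ 2 * w ∧ ‖u‖ + ‖v‖ ≤ 2 * w := by
    have e : u = l • v + x := by
      rw [hx, hδ, hβ, sub_smul, one_smul]
      abel
    have e1 : ‖u‖ ≤ l * ‖v‖ + ‖x‖ := by
      calc ‖u‖ = ‖l • v + x‖ := congrArg norm e
        _ ≤ _ := (norm_add_le _ _).trans (by rw [norm_smul, Real.norm_of_nonneg hl])
    have e2 : ‖x‖ ≤ w := by
      have : 3 * θ * σ ≤ 1 * w := by
        gcongr
        linarith
      linarith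
    have e3 : ‖u‖ + ‖v‖ ≤ 2 * w := by
      have : w = ‖v‖ + l * ‖v‖ := by rw [hw]; ring
      linarith
    exact ⟨(norm_add_le u v).trans e3, e3⟩
  -- For u nearly l v the form changes by about (l² - 1) ⟨S v, v⟩ = β (1 + l) ⟨S v, v⟩. Coercivity
  -- makes this large unless β v = 0, while `hlevel` makes it small.
  have hdiff : inner ℝ (S u) u - inner ℝ (S v) v = β * ((1 + l) * inner ℝ (S v) v + inner ℝ (S x) v) + inner ℝ (S (u + v)) x := by
    have e1 : inner ℝ (S u) u - inner ℝ (S v) v = inner ℝ (S (u + v)) δ := by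
      simp only [hδ, map_add, inner_add_left, inner_sub_right]
      rw [hsymm v u, real_inner_comm (S u) v]
      ring
    have e2 : δ = β • v + x := by rw [hx]; abel
    have e3 : u + v = (1 + l) • v + x := by
      rw [hx, hδ, hβ, sub_smul, one_smul, add_smul, one_smul]
      abel
    have e4 : inner ℝ (S (u + v)) v = (1 + l) * inner ℝ (S v) v + inner ℝ (S x) v := by
      rw [e3, map_add, map_smul, inner_add_left, real_inner_smul_left]
    rw [e1]
    nth_rewrite 1 [e2]
    rw [inner_add_right, real_inner_smul_right, e4]
  have hS1 : |inner ℝ (S x) v| ≤ ‖S‖ * ‖x‖ * ‖v‖ :=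
    (abs_real_inner_le_norm _ _).trans
      (mul_le_mul_of_nonneg_right (S.le_opNorm x) (norm_nonneg _))
  have hS2 : |inner ℝ (S (u + v)) x| ≤ ‖S‖ * (2 * w) * (3 * θ * σ) := by
    refine (abs_real_inner_le_norm _ _).trans ?_
    have := S.le_opNorm (u + v)
    gcongr
    exact this.trans (mul_le_mul_of_nonneg_left huv.1 (norm_nonneg _))
  have hlow : a / 4 * w * σ - 3 * ‖S‖ * θ * w * σ ≤
      |β * ((1 + l) * inner ℝ (S v) v + inner ℝ (S x) v)| := by
    rw [abs_mul]
    have e1 : (1 + l) * (a / 4 * ‖v‖ ^ 2) - ‖S‖ * (3 * θ * σ) * ‖v‖ ≤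
        |(1 + l) * inner ℝ (S v) v + inner ℝ (S x) v| := by
      refine le_trans ?_ (le_abs_self _)
      have e2 : (1 + l) * (a / 4 * ‖v‖ ^ 2) ≤ (1 + l) * inner ℝ (S v) v := by gcongr
      have e3 : ‖S‖ * ‖x‖ * ‖v‖ ≤ ‖S‖ * (3 * θ * σ) * ‖v‖ := by gcongr
      linarith [(abs_le.1 hS1).1]
    have e4 := mul_le_mul_of_nonneg_left e1 (abs_nonneg β)
    refine le_trans ?_ e4
    have e5 : |β| * (‖S‖ * (3 * θ * σ) * ‖v‖) ≤ 3 * ‖S‖ * θ * w * σ := by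
      calc |β| * (‖S‖ * (3 * θ * σ) * ‖v‖) = 3 * ‖S‖ * θ * σ * σ := by rw [hσ]; ring
        _ ≤ 3 * ‖S‖ * θ * w * σ := by gcongr
    have e6 : |β| * ((1 + l) * (a / 4 * ‖v‖ ^ 2)) = a / 4 * w * σ := by rw [hw, hσ]; ring
    linarith
  have hup : |β * ((1 + l) * inner ℝ (S v) v + inner ℝ (S x) v)| ≤ η * (2 * w) * (2 * σ) +
      ‖S‖ * (2 * w) * (3 * θ * σ) := by
    have e1 : β * ((1 + l) * inner ℝ (S v) v + inner ℝ (S x) v) =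
        (inner ℝ (S u) u - inner ℝ (S v) v) - inner ℝ (S (u + v)) x := by rw [hdiff]; ring
    rw [e1]
    refine (abs_sub _ _).trans (add_le_add (hlevel.trans ?_) hS2)
    have := huv.2
    gcongr
  -- The lower bound loses 3 ‖S‖ θ and the upper bound is 6 ‖S‖ θ + 4 η, each times w σ. This is the
  -- origin of 9 ‖S‖ θ + 4 η < a/4 in `hθ`.
  have hzero : w * σ = 0 := by
    by_contra hne
    have hpos : 0 < w * σ := lt_of_le_of_ne (by positivity) (Ne.symm hne)
    have : (9 * ‖S‖ * θ + 4 * η) * (w * σ) < a / 4 * (w * σ) := by gcongr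
    linarith
  have hσz : σ = 0 := by
    rcases mul_eq_zero.1 hzero with e | e
    · linarith
    · exact e
  have hδz : ‖δ‖ = 0 := le_antisymm (by linarith) (norm_nonneg _)
  rw [hδz, mul_zero] at hcon
  exact absurd (norm_nonneg (mu - l • mv)) (not_le.2 hcon)

/-- Uniform separation for a family of curves issuing from a hyperbolic saddle: at small levels
`t`, points on different curves have images in different directions, quantitatively. -/
theorem exists_uniform_separation (h : IsHyperbolicSplitting S P a)
    (hsymm : ∀ x y, inner ℝ (S x) y = inner ℝ x (S y)) (hc : 0 < c) (hL : ∀ x, c * ‖P x‖ ≤ ‖L (P x)‖)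
    {ι : Type*} {u G : ι → ℝ → V} {m : ι → ℝ → E}
    (hstart : ∀ i, Tendsto (u i) (𝓝[>] 0) (𝓝 0))
    (hcont : ∀ i, ∀ t > 0, ContinuousAt (u i) t)
    (hflow : ∃ r > 0, ∀ i, ∀ t > 0, t ≤ r → ‖u i t‖ ≤ r →
      ∃ ρ > (0 : ℝ), HasDerivAt (u i) (ρ • G i t) t)
    (hG : ∀ η > 0, ∃ r > 0, ∀ i, ∀ t > 0, t ≤ r → ‖u i t‖ ≤ r →
      ‖G i t - S (u i t)‖ ≤ η * ‖u i t‖)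
    (hGG : ∀ η > 0, ∃ r > 0, ∀ i j, ∀ s > 0, ∀ t > 0, s ≤ r → t ≤ r → ‖u i s‖ ≤ r →
      ‖u j t‖ ≤ r → ‖G i s - G j t - S (u i s - u j t)‖ ≤ η * ‖u i s - u j t‖)
    (hlevel : ∀ η > 0, ∃ r > 0, ∀ i, ∀ t > 0, t ≤ r → ‖u i t‖ ≤ r →
      |t - inner ℝ (S (u i t)) (u i t) / 2| ≤ η * ‖u i t‖ ^ 2)
    (hsame : ∀ η > 0, ∃ r > 0, ∀ i j, ∀ t > 0, t ≤ r → ‖u i t‖ ≤ r → ‖u j t‖ ≤ r →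
      |inner ℝ (S (u i t)) (u i t) - inner ℝ (S (u j t)) (u j t)| ≤
        η * (‖u i t‖ + ‖u j t‖) * ‖u i t - u j t‖)
    (hm : ∀ η > 0, ∃ r > 0, ∀ i, ∀ t > 0, t ≤ r → ‖u i t‖ ≤ r →
      ‖m i t - L (u i t)‖ ≤ η * ‖u i t‖)
    (hmm : ∀ η > 0, ∃ r > 0, ∀ i j, ∀ t > 0, t ≤ r → ‖u i t‖ ≤ r → ‖u j t‖ ≤ r →
      ‖m i t - m j t - L (u i t - u j t)‖ ≤ η * ‖u i t - u j t‖) :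
    ∃ κ > 0, ∃ t > 0, ∀ i j, ∀ l : ℝ, 0 ≤ l →
      κ * ‖u i t - u j t‖ ≤ ‖m i t - l • m j t‖ := by
  have ha := h.pos
  set b := ‖S‖ with hb
  have hb0 : 0 ≤ b := norm_nonneg _
  -- With η ≤ a/64 this choice gives 9 ‖S‖ θ + 4 η ≤ (9/80 + 1/16) a < a/4. Below, κ, η and (‖L‖ +
  -- c) ε each take at most a third of c θ.
  set θ := min (1 / 4) (a / (80 * (b + 1))) with hθdef
  have hθ0 : 0 < θ := lt_min (by norm_num) (by positivity)
  have hθb : 9 * b * θ ≤ 9 / 80 * a := by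
    have h1 : θ ≤ a / (80 * (b + 1)) := min_le_right _ _
    rw [le_div_iff₀ (by positivity)] at h1
    nlinarith
  set ε := min 1 (min (a / (4 * (b + 1))) (c * θ / (3 * (‖L‖ + c)))) with hεdef
  have hLc : 0 < ‖L‖ + c := by positivity
  have hε0 : 0 < ε := lt_min one_pos (lt_min (by positivity) (by positivity))
  have hε1 : ε ≤ 1 := min_le_left _ _
  have hεS : 4 * b * ε ≤ a := by
    have h1 : ε ≤ a / (4 * (b + 1)) := (min_le_right _ _).trans (min_le_left _ _)
    rw [le_div_iff₀ (by positivity)] at h1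
    nlinarith
  have hεL : (‖L‖ + c) * ε ≤ c * θ / 3 := by
    have h1 : ε ≤ c * θ / (3 * (‖L‖ + c)) := (min_le_right _ _).trans (min_le_right _ _)
    rw [le_div_iff₀ (by positivity)] at h1
    linarith
  set κ := c * θ / 3 with hκdef
  have hκ0 : 0 < κ := by positivity
  set η := min (ε ^ 2 * a / 4) (min (a / 64) (c * θ / 3)) with hηdef
  have hη0 : 0 < η := lt_min (by positivity) (lt_min (by positivity) (by positivity))
  have hη1 : 4 * η ≤ ε ^ 2 * a := by
    have : η ≤ ε ^ 2 * a / 4 := min_le_left _ _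
    linarith
  have hη2 : η ≤ a / 64 := (min_le_right _ _).trans (min_le_left _ _)
  have hη3 : η ≤ c * θ / 3 := (min_le_right _ _).trans (min_le_right _ _)
  obtain ⟨r₁, hr₁, H₁⟩ := hflow
  obtain ⟨r₂, hr₂, H₂⟩ := hG η hη0
  obtain ⟨r₃, hr₃, H₃⟩ := hGG η hη0
  obtain ⟨r₄, hr₄, H₄⟩ := hlevel η hη0
  obtain ⟨r₅, hr₅, H₅⟩ := hsame η hη0
  obtain ⟨r₆, hr₆, H₆⟩ := hm η hη0
  obtain ⟨r₇, hr₇, H₇⟩ := hmm η hη0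
  obtain ⟨r, hr, hrle⟩ : ∃ r > 0, r ≤ r₁ ∧ r ≤ r₂ ∧ r ≤ r₃ ∧ r ≤ r₄ ∧ r ≤ r₅ ∧ r ≤ r₆ ∧ r ≤ r₇ :=
    ⟨min r₁ (min r₂ (min r₃ (min r₄ (min r₅ (min r₆ r₇))))), by positivity, by simp⟩
  obtain ⟨h1, h2, h3, h4, h5, h6, h7⟩ := hrle
  obtain ⟨T, hT, hTr, hTa⟩ : ∃ T > 0, T ≤ r ∧ T < a / 16 * r ^ 2 :=
    ⟨min r (a / 32 * r ^ 2), by positivity, min_le_left _ _,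
      (min_le_right _ _).trans_lt (by nlinarith [mul_pos ha (pow_pos hr 2)])⟩
  -- The value of `u i` at time 0 is arbitrary. Resetting it to the limit 0 makes the curves
  -- continuous on [0, T].
  set w : ι → ℝ → V := fun i => Function.update (u i) 0 0 with hw
  have hwu : ∀ i, ∀ t > 0, w i t = u i t := fun i t ht => by simp [hw, ht.ne']
  have hwev : ∀ i, ∀ t > 0, w i =ᶠ[𝓝 t] u i := fun i t ht => by
    filter_upwards [lt_mem_nhds ht] with s hs using hwu i s hs
  have hw0 : ∀ i, w i 0 = 0 := fun i => by simp [hw]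
  have hwc : ∀ i, ContinuousOn (w i) (Set.Icc 0 T) := by
    intro i t ht
    rcases eq_or_lt_of_le ht.1 with e | e
    · rw [← e]
      refine continuousWithinAt_update_same.2 ((hstart i).mono_left ?_)
      refine nhdsWithin_mono _ fun s hs => ?_
      exact lt_of_le_of_ne hs.1.1 (Ne.symm hs.2)
    · exact ((hcont i t e).congr (hwev i t e).symm).continuousWithinAt
  have hwball : ∀ i, ∀ t ∈ Set.Icc 0 T, ‖w i t‖ ≤ r := by
    intro i
    refine h.norm_curve_le (G := G i) hε0 hε1 hεS hη1 (by linarith) hr hTa (hwc i) (hw0 i)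
      ?_ ?_ ?_
    · intro t ht hn
      rw [hwu i t ht.1] at hn
      obtain ⟨ρ, hρ, hd⟩ := H₁ i t ht.1 (by linarith [ht.2]) (hn.trans h1)
      exact ⟨ρ, hρ, hd.congr_of_eventuallyEq (hwev i t ht.1)⟩
    · intro t ht hn
      rw [hwu i t ht.1] at hn ⊢
      exact H₂ i t ht.1 (by linarith [ht.2]) (hn.trans h2)
    · intro t ht hn
      rw [hwu i t ht.1] at hn ⊢
      exact H₄ i t ht.1 (by linarith [ht.2]) (hn.trans h4)
  have hball : ∀ i, ∀ t ∈ Set.Ioc 0 T, ‖u i t‖ ≤ r := fun i t ht => by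
    rw [← hwu i t ht.1]
    exact hwball i t ⟨ht.1.le, ht.2⟩
  have hwflow : ∀ i, ∀ t ∈ Set.Ioc 0 T, ∃ ρ > (0 : ℝ), HasDerivAt (w i) (ρ • G i t) t := by
    intro i t ht
    obtain ⟨ρ, hρ, hd⟩ := H₁ i t ht.1 (by linarith [ht.2]) ((hball i t ht).trans h1)
    exact ⟨ρ, hρ, hd.congr_of_eventuallyEq (hwev i t ht.1)⟩
  have hcone : ∀ i, ∀ t ∈ Set.Icc 0 T, coneForm P ε (w i t) ≤ 0 := by
    intro i
    refine h.coneForm_curve_nonpos hε0 hε1 hη1 (hwc i) (hw0 i) (hwflow i) ?_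
    intro t ht
    rw [hwu i t ht.1]
    exact H₂ i t ht.1 (by linarith [ht.2]) ((hball i t ht).trans h2)
  have hcone2 : ∀ i j, coneForm P ε (w i T - w j T) ≤ 0 := by
    intro i j
    refine h.coneForm_sub_nonpos hε0 hε1 hη1 (hwc i) (hw0 i) (hwflow i) (hcone i)
      (hwc j) (hw0 j) (hwflow j) (hcone j) ?_ T ⟨hT.le, le_rfl⟩ T ⟨hT.le, le_rfl⟩
    intro s hs t ht
    rw [hwu i s hs.1, hwu j t ht.1]
    exact H₃ i j s hs.1 t ht.1 (by linarith [hs.2]) (by linarith [ht.2])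
      ((hball i s hs).trans h3) ((hball j t ht).trans h3)
  have hTT : T ∈ Set.Ioc 0 T := ⟨hT, le_rfl⟩
  refine ⟨κ, hκ0, T, hT, fun i j l hl => ?_⟩
  have hci := hcone2 i j
  have hcj := hcone j T ⟨hT.le, le_rfl⟩
  rw [hwu i T hT, hwu j T hT] at hci
  rw [hwu j T hT] at hcj
  exact separation hη0.le hsymm hc hL hθ0.le (min_le_left _ _) (by linarith)
    (by linarith) hκ0.le hl (h.norm_compl_le hε0.le hci) (h.norm_compl_le hε0.le hcj)
    (h.coercive hε0.le hε1 hεS hcj)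
    (H₅ i j T hT (by linarith) ((hball i T hTT).trans h5) ((hball j T hTT).trans h5))
    (H₇ i j T hT (by linarith) ((hball i T hTT).trans h7) ((hball j T hTT).trans h7))
    (H₆ j T hT (by linarith) ((hball j T hTT).trans h6))

end IsHyperbolicSplitting

end Cone

/-! ### Expansions on the zero set of f near a point with ∂f/∂z = 0 ≠ ∂f/∂E. -/

section Local

variable {W : Type*} [NormedAddCommGroup W] [NormedSpace ℂ W] {f : W × ℂ → ℂ} {q₀ : W × ℂ}

theorem HasStrictFDerivAt.eventually_le {X Y : Type*} [NormedAddCommGroup X] [NormedSpace ℂ X]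
    [NormedAddCommGroup Y] [NormedSpace ℂ Y] {g : X → Y} {g' : X →L[ℂ] Y} {x : X}
    (h : HasStrictFDerivAt g g' x) {η : ℝ} (hη : 0 < η) :
    ∀ᶠ p : X × X in 𝓝 (x, x), ‖g p.1 - g p.2 - g' (p.1 - p.2)‖ ≤ η * ‖p.1 - p.2‖ :=
  h.isLittleO.def hη

/-- On the zero set of `f`, near a point with `∂f/∂z = 0 ≠ ∂f/∂E`, the second coordinate varies
slower than the first. -/
theorem eventually_snd_sub_le (hf : ContDiffAt ℂ ∞ f q₀) (hz : ∀ w, fderiv ℂ f q₀ (w, 0) = 0)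
    (hE : fderiv ℂ f q₀ (0, 1) ≠ 0) {η : ℝ} (hη : 0 < η) :
    ∀ᶠ p : (W × ℂ) × (W × ℂ) in 𝓝 (q₀, q₀), f p.1 = 0 → f p.2 = 0 →
      ‖p.1.2 - p.2.2‖ ≤ η * ‖p.1.1 - p.2.1‖ := by
  set e := fderiv ℂ f q₀ (0, 1) with he
  have he0 : 0 < ‖e‖ := norm_pos_iff.2 hE
  have hD : ∀ q, fderiv ℂ f q₀ q = q.2 * e := fun q => by
    have : q = (q.1, 0) + q.2 • ((0 : W), (1 : ℂ)) := by ext <;> simp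
    rw [this, map_add, hz, map_smul, zero_add]
    simp [he]
  have hη' : 0 < ‖e‖ / 2 * min 1 η := by positivity
  filter_upwards [HasStrictFDerivAt.eventually_le (hf.hasStrictFDerivAt (by simp)) hη'] with p hp h1 h2
  rw [h1, h2, sub_zero, zero_sub, norm_neg, hD, norm_mul] at hp
  simp only [Prod.snd_sub] at hp
  have h3 : ‖p.1 - p.2‖ ≤ ‖p.1.1 - p.2.1‖ + ‖p.1.2 - p.2.2‖ := by
    rw [Prod.norm_def]
    exact max_le_add_of_nonneg (norm_nonneg _) (norm_nonneg _)
  set x := ‖p.1.1 - p.2.1‖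
  set y := ‖p.1.2 - p.2.2‖
  have hx : 0 ≤ x := norm_nonneg _
  have hy : 0 ≤ y := norm_nonneg _
  have h4 : ‖e‖ / 2 * min 1 η * ‖p.1 - p.2‖ ≤ ‖e‖ / 2 * min 1 η * (x + y) := by gcongr
  have h5 : ‖e‖ / 2 * min 1 η * y ≤ ‖e‖ / 2 * 1 * y := by
    gcongr
    exact min_le_left _ _
  have h6 : ‖e‖ / 2 * min 1 η * x ≤ ‖e‖ / 2 * η * x := by
    gcongr
    exact min_le_right _ _
  have h7 : ‖e‖ / 2 * y ≤ ‖e‖ / 2 * (η * x) := by linarith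
  exact le_of_mul_le_mul_left h7 (by positivity)

/-- The logarithmic gradient `(∂f/∂E)⁻¹ ∂f/∂z`. -/
def gradRatio (f : W × ℂ → ℂ) (q : W × ℂ) : W →L[ℂ] ℂ :=
  (fderiv ℂ f q (0, 1))⁻¹ • (fderiv ℂ f q).comp (ContinuousLinearMap.inl ℂ W ℂ)

/-- The Hessian in the first variable. -/
def hessianFst (f : W × ℂ → ℂ) (q : W × ℂ) : W →L[ℂ] W →L[ℂ] ℂ :=
  ((ContinuousLinearMap.compL ℂ W (W × ℂ) ℂ).flip (ContinuousLinearMap.inl ℂ W ℂ)).comp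
    ((fderiv ℂ (fderiv ℂ f) q).comp (ContinuousLinearMap.inl ℂ W ℂ))

theorem hessianFst_apply (v w : W) :
    hessianFst f q₀ v w = fderiv ℂ (fderiv ℂ f) q₀ (v, 0) (w, 0) := rfl

theorem hessianFst_comm (hf : ContDiffAt ℂ ∞ f q₀) (v w : W) :
    hessianFst f q₀ v w = hessianFst f q₀ w v := by
  have h := hf.isSymmSndFDerivAt (by simp; exact WithTop.coe_le_coe.2 le_top)
  exact h _ _

theorem hasStrictFDerivAt_fderiv (hf : ContDiffAt ℂ ∞ f q₀) :
    HasStrictFDerivAt (fderiv ℂ f) (fderiv ℂ (fderiv ℂ f) q₀) q₀ :=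
  (hf.fderiv_right (m := 1) (by norm_cast)).hasStrictFDerivAt one_ne_zero

/-- On the zero set this makes the gradient of Im E nearly linear, also for differences.
Differentiating the factor (∂f/∂E)⁻¹ contributes nothing because ∂f/∂z = 0 at q₀, and the
displacement in E is negligible against that in z by `eventually_snd_sub_le`. -/
theorem eventually_gradRatio_sub_le (hf : ContDiffAt ℂ ∞ f q₀)
    (hz : ∀ w, fderiv ℂ f q₀ (w, 0) = 0) (hE : fderiv ℂ f q₀ (0, 1) ≠ 0) {η : ℝ} (hη : 0 < η) :
    ∀ᶠ p : (W × ℂ) × (W × ℂ) in 𝓝 (q₀, q₀), f p.1 = 0 → f p.2 = 0 →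
      ‖gradRatio f p.1 - gradRatio f p.2 -
        (fderiv ℂ f q₀ (0, 1))⁻¹ • hessianFst f q₀ (p.1.1 - p.2.1)‖ ≤ η * ‖p.1.1 - p.2.1‖ := by
  set c := (fderiv ℂ f q₀ (0, 1))⁻¹ with hc
  set R := (ContinuousLinearMap.compL ℂ W (W × ℂ) ℂ).flip (ContinuousLinearMap.inl ℂ W ℂ) with hR
  have hd := hasStrictFDerivAt_fderiv hf
  have h1 : HasStrictFDerivAt (fun q => (fderiv ℂ f q).comp (ContinuousLinearMap.inl ℂ W ℂ))
      (R.comp (fderiv ℂ (fderiv ℂ f) q₀)) q₀ := R.hasStrictFDerivAt.comp q₀ hd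
  have h2 : HasStrictFDerivAt (fun q => fderiv ℂ f q (0, 1)) _ q₀ :=
    hd.clm_apply (hasStrictFDerivAt_const _ _)
  have h3 := ((hasStrictDerivAt_inv hE).comp_hasStrictFDerivAt q₀ h2).smul h1
  have h0 : (fderiv ℂ f q₀).comp (ContinuousLinearMap.inl ℂ W ℂ) = 0 := by
    ext w
    simpa using hz w
  have h4 : HasStrictFDerivAt (gradRatio f) (c • R.comp (fderiv ℂ (fderiv ℂ f) q₀)) q₀ := by
    refine h3.congr_fderiv ?_
    rw [h0]
    ext
    · simp [hc]
    · simp [hc]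
  set D := c • R.comp (fderiv ℂ (fderiv ℂ f) q₀) with hD
  filter_upwards [HasStrictFDerivAt.eventually_le h4 (half_pos (half_pos hη)),
    eventually_snd_sub_le hf hz hE (η := min 1 (η / (2 * (‖D‖ + 1)))) (by positivity)]
    with p hp hs e1 e2
  have hs' := hs e1 e2
  set Δ := p.1 - p.2 with hΔ
  have hΔ1 : ‖Δ‖ ≤ 1 * ‖p.1.1 - p.2.1‖ := by
    rw [Prod.norm_def]
    refine max_le (by simp [hΔ]) (hs'.trans ?_)
    gcongr
    exact min_le_left _ _
  have hsplit : c • hessianFst f q₀ (p.1.1 - p.2.1) = D Δ - D (0, p.1.2 - p.2.2) := by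
    rw [← map_sub]
    have : Δ - (0, p.1.2 - p.2.2) = (p.1.1 - p.2.1, 0) := by ext <;> simp [hΔ]
    rw [this]
    rfl
  rw [hsplit]
  have h5 : ‖D (0, p.1.2 - p.2.2)‖ ≤ η / 2 * ‖p.1.1 - p.2.1‖ := by
    refine (D.le_opNorm _).trans ?_
    have h6 : ‖((0 : W), p.1.2 - p.2.2)‖ = ‖p.1.2 - p.2.2‖ := by
      rw [Prod.norm_def]; simp
    rw [h6]
    have h7 : ‖D‖ * ‖p.1.2 - p.2.2‖ ≤
        (‖D‖ + 1) * (η / (2 * (‖D‖ + 1)) * ‖p.1.1 - p.2.1‖) := by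
      gcongr
      · linarith
      · refine hs'.trans ?_
        gcongr
        exact min_le_right _ _
    refine h7.trans (le_of_eq ?_)
    have : ‖D‖ + 1 ≠ 0 := by positivity
    field_simp
  calc ‖gradRatio f p.1 - gradRatio f p.2 - (D Δ - D (0, p.1.2 - p.2.2))‖
      = ‖(gradRatio f p.1 - gradRatio f p.2 - D Δ) + D (0, p.1.2 - p.2.2)‖ := by
        congr 1; abel
    _ ≤ η / 2 / 2 * ‖Δ‖ + η / 2 * ‖p.1.1 - p.2.1‖ := (norm_add_le _ _).trans (add_le_add hp h5)
    _ ≤ η / 2 / 2 * (1 * ‖p.1.1 - p.2.1‖) + η / 2 * ‖p.1.1 - p.2.1‖ := by gcongr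
    _ ≤ η * ‖p.1.1 - p.2.1‖ := by
      have := mul_nonneg hη.le (norm_nonneg (p.1.1 - p.2.1))
      linarith

/-- Second order expansion in the first variable, in difference form. -/
theorem eventually_taylor_fst (hf : ContDiffAt ℂ ∞ f q₀) (hz : ∀ w, fderiv ℂ f q₀ (w, 0) = 0) :
    ∃ C : ℝ, 0 ≤ C ∧ ∀ η > 0, ∀ᶠ p : (W × ℂ) × (W × ℂ) in 𝓝 (q₀, q₀), p.1.2 = p.2.2 →
      ‖f p.1 - f p.2 - (hessianFst f q₀ (p.1.1 - q₀.1) (p.1.1 - q₀.1) / 2 -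
        hessianFst f q₀ (p.2.1 - q₀.1) (p.2.1 - q₀.1) / 2)‖ ≤
      (η * (‖p.1.1 - q₀.1‖ + ‖p.2.1 - q₀.1‖) + C * ‖p.1.2 - q₀.2‖) * ‖p.1.1 - p.2.1‖ := by
  set D := fderiv ℂ (fderiv ℂ f) q₀ with hD
  refine ⟨‖D‖ + 1, by positivity, fun η hη => ?_⟩
  have hη' : 0 < min η 1 := by positivity
  have hd := (hasStrictFDerivAt_fderiv hf).hasFDerivAt.isLittleO.def hη'
  have hdf : ∀ᶠ q in 𝓝 q₀, DifferentiableAt ℂ f q :=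
    ((hf.of_le (m := 1) (by norm_cast)).eventually (by simp)).mono fun q hq =>
      hq.differentiableAt one_ne_zero
  obtain ⟨r, hr, hball⟩ := Metric.eventually_nhds_iff_ball.1 (hd.and hdf)
  have hnear : ∀ᶠ p : (W × ℂ) × (W × ℂ) in 𝓝 (q₀, q₀), p.1 ∈ Metric.ball q₀ r ∧
      p.2 ∈ Metric.ball q₀ r := by
    exact prod_mem_nhds (Metric.ball_mem_nhds _ hr) (Metric.ball_mem_nhds _ hr)
  filter_upwards [hnear] with p hp hE
  obtain ⟨⟨z₁, E⟩, ⟨z₂, E'⟩⟩ := p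
  simp only at hE
  subst hE
  obtain ⟨z₀, E₀⟩ := q₀
  simp only
  simp only [mem_ball_iff_norm, Prod.norm_def, Prod.fst_sub, Prod.snd_sub, max_lt_iff] at hp
  set ρ := ‖z₁ - z₀‖ + ‖z₂ - z₀‖ with hρ
  set ρ' := max ‖z₁ - z₀‖ ‖z₂ - z₀‖ with hρ'
  set B := hessianFst f (z₀, E₀) with hB
  have hk : ∀ z, ‖z - z₀‖ ≤ ρ' →
      HasFDerivAt (fun z => f (z, E) - B (z - z₀) (z - z₀) / 2)
        ((fderiv ℂ f (z, E)).comp (ContinuousLinearMap.inl ℂ W ℂ) - B (z - z₀)) z ∧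
      ‖(fderiv ℂ f (z, E)).comp (ContinuousLinearMap.inl ℂ W ℂ) - B (z - z₀)‖ ≤
        η * ρ + (‖D‖ + 1) * ‖E - E₀‖ := by
    intro z hzρ
    have hzr : ‖z - z₀‖ < r := hzρ.trans_lt (max_lt hp.1.1 hp.2.1)
    have hmem : (z, E) ∈ Metric.ball (z₀, E₀) r := by
      simp only [mem_ball_iff_norm, Prod.norm_def, Prod.fst_sub, Prod.snd_sub, max_lt_iff]
      exact ⟨hzr, hp.1.2⟩
    obtain ⟨h1, h2⟩ := hball _ hmem
    constructor
    · have h3 : HasFDerivAt (fun z => f (z, E))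
          ((fderiv ℂ f (z, E)).comp (ContinuousLinearMap.inl ℂ W ℂ)) z :=
        h2.hasFDerivAt.comp z (hasFDerivAt_prodMk_left z E)
      have h4 : HasFDerivAt (fun z => z - z₀) (ContinuousLinearMap.id ℂ W) z :=
        (hasFDerivAt_id z).sub_const z₀
      have h5 := (B.hasFDerivAt.comp z h4).clm_apply h4
      have h6 := h3.sub (h5.const_mul (1 / 2 : ℂ))
      refine (h6.congr_fderiv ?_).congr_of_eventuallyEq (Eventually.of_forall fun y => ?_)
      · ext w
        simp only [sub_apply, add_apply, smul_apply, ContinuousLinearMap.comp_apply,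
          ContinuousLinearMap.flip_apply, ContinuousLinearMap.id_apply, smul_eq_mul,
          Function.comp_apply]
        rw [hessianFst_comm hf w (z - z₀)]
        ring
      · simp only [Pi.sub_apply, Function.comp_apply]
        ring
    · have h0 : (fderiv ℂ f (z₀, E₀)).comp (ContinuousLinearMap.inl ℂ W ℂ) = 0 := by
        ext w
        simpa using hz w
      have hsplit : (fderiv ℂ f (z, E)).comp (ContinuousLinearMap.inl ℂ W ℂ) - B (z - z₀) =
          (fderiv ℂ f (z, E) - fderiv ℂ f (z₀, E₀) - D ((z, E) - (z₀, E₀))).comp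
            (ContinuousLinearMap.inl ℂ W ℂ) +
          (D (0, E - E₀)).comp (ContinuousLinearMap.inl ℂ W ℂ) := by
        have e1 : ((z, E) - (z₀, E₀) : W × ℂ) = (z - z₀, 0) + (0, E - E₀) := by ext <;> simp
        rw [e1, map_add, ContinuousLinearMap.sub_comp, ContinuousLinearMap.sub_comp, h0,
          ContinuousLinearMap.add_comp]
        have e2 : B (z - z₀) = (D (z - z₀, 0)).comp (ContinuousLinearMap.inl ℂ W ℂ) := rfl
        rw [e2]
        abel
      rw [hsplit]
      have hinl : ∀ A : W × ℂ →L[ℂ] ℂ, ‖A.comp (ContinuousLinearMap.inl ℂ W ℂ)‖ ≤ ‖A‖ := by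
        intro A
        refine ContinuousLinearMap.opNorm_le_bound _ (norm_nonneg _) fun w => ?_
        refine (A.le_opNorm _).trans (le_of_eq ?_)
        simp [Prod.norm_def]
      refine (norm_add_le _ _).trans ?_
      have e3 : ‖((0 : W), E - E₀)‖ = ‖E - E₀‖ := by simp [Prod.norm_def]
      have e4 := (hinl (D (0, E - E₀))).trans (D.le_opNorm _)
      rw [e3] at e4
      have e5 := (hinl _).trans h1
      have e6 : ‖((z, E) - (z₀, E₀) : W × ℂ)‖ ≤ ‖z - z₀‖ + ‖E - E₀‖ := by
        rw [Prod.norm_def]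
        exact max_le_add_of_nonneg (norm_nonneg _) (norm_nonneg _)
      have e7 : ‖z - z₀‖ ≤ ρ :=
        hzρ.trans (max_le_add_of_nonneg (norm_nonneg _) (norm_nonneg _))
      have e8 : min η 1 * ‖((z, E) - (z₀, E₀) : W × ℂ)‖ ≤ η * ρ + 1 * ‖E - E₀‖ := by
        calc min η 1 * ‖((z, E) - (z₀, E₀) : W × ℂ)‖ ≤ min η 1 * (ρ + ‖E - E₀‖) := by
              gcongr
              exact e6.trans (by gcongr)
          _ = min η 1 * ρ + min η 1 * ‖E - E₀‖ := by ring
          _ ≤ _ := by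
              have : 0 ≤ ρ := by positivity
              gcongr
              · exact min_le_left _ _
              · exact min_le_right _ _
      linarith
  -- Mean value inequality at fixed E for f minus its quadratic part. The frozen E costs a mixed
  -- second derivative, whence the term in ‖E - E₀‖.
  have hmv := (convex_closedBall z₀ ρ').norm_image_sub_le_of_norm_hasFDerivWithin_le
    (𝕜 := ℂ) (f := fun z => f (z, E) - B (z - z₀) (z - z₀) / 2)
    (fun z hz => (hk z (mem_closedBall_iff_norm.1 hz)).1.hasFDerivWithinAt)
    (fun z hz => (hk z (mem_closedBall_iff_norm.1 hz)).2)
    (x := z₂) (y := z₁) (mem_closedBall_iff_norm.2 (le_max_right _ _))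
    (mem_closedBall_iff_norm.2 (le_max_left _ _))
  refine le_trans (le_of_eq ?_) hmv
  congr 1
  ring

/-- On a common level of the zero set, the Hessian takes nearly equal values. -/
theorem eventually_hessian_sub_le (hf : ContDiffAt ℂ ∞ f q₀) (h0 : f q₀ = 0)
    (hz : ∀ w, fderiv ℂ f q₀ (w, 0) = 0) (hE : fderiv ℂ f q₀ (0, 1) ≠ 0) {η : ℝ} (hη : 0 < η) :
    ∀ᶠ p : (W × ℂ) × (W × ℂ) in 𝓝 (q₀, q₀), f p.1 = 0 → f p.2 = 0 → p.1.2 = p.2.2 →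
      ‖hessianFst f q₀ (p.1.1 - q₀.1) (p.1.1 - q₀.1) -
        hessianFst f q₀ (p.2.1 - q₀.1) (p.2.1 - q₀.1)‖ ≤
      η * (‖p.1.1 - q₀.1‖ + ‖p.2.1 - q₀.1‖) * ‖p.1.1 - p.2.1‖ := by
  obtain ⟨C, hC, hT⟩ := eventually_taylor_fst hf hz
  -- Comparison with q₀, itself on the zero set, absorbs the term C ‖E - E₀‖ of the Taylor estimate
  -- into the one with η.
  have hsnd : ∀ᶠ p : (W × ℂ) × (W × ℂ) in 𝓝 (q₀, q₀), f p.1 = 0 →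
      ‖p.1.2 - q₀.2‖ ≤ η / (4 * (C + 1)) * ‖p.1.1 - q₀.1‖ := by
    have hten : Tendsto (fun p : (W × ℂ) × (W × ℂ) => (p.1, q₀)) (𝓝 (q₀, q₀)) (𝓝 (q₀, q₀)) :=
      (by fun_prop : Continuous fun p : (W × ℂ) × (W × ℂ) => (p.1, q₀)).tendsto' _ _ rfl
    filter_upwards [hten.eventually (eventually_snd_sub_le hf hz hE
      (η := η / (4 * (C + 1))) (by positivity))] with p hp h1 using hp h1 h0
  filter_upwards [hT (η / 4) (by positivity), hsnd] with p hp hs h1 h2 h3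
  have hp' := hp h3
  rw [h1, h2, sub_zero, zero_sub, norm_neg, ← sub_div, norm_div] at hp'
  have hs' := hs h1
  set x := ‖p.1.1 - q₀.1‖ with hx
  set y := ‖p.2.1 - q₀.1‖ with hy
  have e1 : C * ‖p.1.2 - q₀.2‖ ≤ η / 4 * (x + y) := by
    calc C * ‖p.1.2 - q₀.2‖ ≤ (C + 1) * (η / (4 * (C + 1)) * (x + y)) := by
          gcongr
          · linarith
          · refine hs'.trans ?_
            gcongr
            exact le_add_of_nonneg_right (norm_nonneg _)
      _ = η / 4 * (x + y) := by
          have : C + 1 ≠ 0 := by positivity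
          field_simp
  have e2 : (η / 4 * (x + y) + C * ‖p.1.2 - q₀.2‖) * ‖p.1.1 - p.2.1‖ ≤
      (η / 4 * (x + y) + η / 4 * (x + y)) * ‖p.1.1 - p.2.1‖ := by gcongr
  have e3 : ‖(2 : ℂ)‖ = 2 := by simp
  rw [e3] at hp'
  linarith

/-- Second order expansion of the second coordinate on the zero set. -/
theorem eventually_snd_expansion (hf : ContDiffAt ℂ ∞ f q₀) (h0 : f q₀ = 0)
    (hz : ∀ w, fderiv ℂ f q₀ (w, 0) = 0) (hE : fderiv ℂ f q₀ (0, 1) ≠ 0) {η : ℝ} (hη : 0 < η) :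
    ∀ᶠ q : W × ℂ in 𝓝 q₀, f q = 0 →
      ‖q.2 - q₀.2 + (fderiv ℂ f q₀ (0, 1))⁻¹ *
        hessianFst f q₀ (q.1 - q₀.1) (q.1 - q₀.1) / 2‖ ≤ η * ‖q.1 - q₀.1‖ ^ 2 := by
  set e := fderiv ℂ f q₀ (0, 1) with he
  have he0 : 0 < ‖e‖ := norm_pos_iff.2 hE
  set B := hessianFst f q₀ with hB
  obtain ⟨C, hC, hT⟩ := eventually_taylor_fst hf hz
  -- The constant of the a priori bound ‖τ‖ ≤ K ‖y‖², obtained below by absorbing η' ‖τ‖ into half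
  -- of ‖e‖ ‖τ‖. It turns the error η' ‖τ‖ into a quadratic one.
  set K := (‖B‖ + 1) / (‖e‖ / 2) with hK
  have hK0 : 0 < K := by positivity
  set η' := min (min 1 (‖e‖ / 2)) (‖e‖ * η / (2 + K)) with hη'
  have hη'0 : 0 < η' := by positivity
  have hten1 : Tendsto (fun q : W × ℂ => (q, (q₀.1, q.2))) (𝓝 q₀) (𝓝 (q₀, q₀)) :=
    (by fun_prop : Continuous fun q : W × ℂ => (q, (q₀.1, q.2))).tendsto' _ _ rfl
  have hten2 : Tendsto (fun q : W × ℂ => (q, q₀)) (𝓝 q₀) (𝓝 (q₀, q₀)) :=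
    (by fun_prop : Continuous fun q : W × ℂ => (q, q₀)).tendsto' _ _ rfl
  have hten3 : Tendsto (fun q : W × ℂ => ((q₀.1, q.2), q₀)) (𝓝 q₀) (𝓝 (q₀, q₀)) :=
    (by fun_prop : Continuous fun q : W × ℂ => ((q₀.1, q.2), q₀)).tendsto' _ _ rfl
  filter_upwards [hten1.eventually (hT (η' / 2) (by positivity)),
    hten2.eventually (eventually_snd_sub_le hf hz hE (η := η' / 2 / (C + 1)) (by positivity)),
    hten3.eventually (HasStrictFDerivAt.eventually_le (hf.hasStrictFDerivAt (by simp)) hη'0)]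
    with q h1 h2 h3 hq
  have h1' := h1 rfl
  have h2' := h2 hq h0
  set y := q.1 - q₀.1 with hy
  set τ := q.2 - q₀.2 with hτ
  simp only [sub_self, map_zero, zero_div, sub_zero, norm_zero, add_zero, hq, zero_sub] at h1'
  have e1 : ((q₀.1, q.2) - q₀ : W × ℂ) = τ • ((0 : W), (1 : ℂ)) := by
    ext <;> simp [hτ]
  have e2 : ‖((q₀.1, q.2) - q₀ : W × ℂ)‖ = ‖τ‖ := by
    rw [Prod.norm_def]
    simp [hτ]
  simp only [h0, sub_zero] at h3
  rw [e2, e1, map_smul, smul_eq_mul, ← he] at h3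
  have h1'' : ‖f (q₀.1, q.2) + B y y / 2‖ ≤ η' * ‖y‖ ^ 2 := by
    have e3 : -f (q₀.1, q.2) - B y y / 2 = -(f (q₀.1, q.2) + B y y / 2) := by ring
    rw [e3, norm_neg] at h1'
    refine h1'.trans ?_
    have e4 : C * ‖τ‖ ≤ η' / 2 * ‖y‖ := by
      calc C * ‖τ‖ ≤ (C + 1) * (η' / 2 / (C + 1) * ‖y‖) := by
            gcongr
            linarith
        _ = η' / 2 * ‖y‖ := by
            have : C + 1 ≠ 0 := by positivity
            field_simp
    calc (η' / 2 * ‖y‖ + C * ‖τ‖) * ‖y‖ ≤ (η' / 2 * ‖y‖ + η' / 2 * ‖y‖) * ‖y‖ := by gcongr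
      _ = η' * ‖y‖ ^ 2 := by ring
  -- The value of f at (z₀, E), for z₀ the first coordinate of q₀, is nearly -B(y, y)/2, by
  -- expansion in z starting from f q = 0. It is also nearly τ e, by expansion in E.
  have h4 : ‖τ * e + B y y / 2‖ ≤ η' * ‖y‖ ^ 2 + η' * ‖τ‖ := by
    have e3 : τ * e + B y y / 2 = (f (q₀.1, q.2) + B y y / 2) - (f (q₀.1, q.2) - τ * e) := by ring
    rw [e3]
    exact (norm_sub_le _ _).trans (add_le_add h1'' h3)
  have hηa : η' ≤ 1 := (min_le_left _ _).trans (min_le_left _ _)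
  have hηb : η' ≤ ‖e‖ / 2 := (min_le_left _ _).trans (min_le_right _ _)
  have hηc : η' * (2 + K) ≤ ‖e‖ * η := by
    rw [← le_div_iff₀ (by positivity)]
    exact min_le_right _ _
  have hBy : ‖B y y / 2‖ ≤ ‖B‖ * ‖y‖ ^ 2 := by
    rw [norm_div]
    have e4 := B.le_opNorm₂ y y
    have e5 : ‖(2 : ℂ)‖ = 2 := by simp
    rw [e5]
    have : 0 ≤ ‖B‖ * ‖y‖ ^ 2 := by positivity
    nlinarith
  have h5 : ‖τ‖ ≤ K * ‖y‖ ^ 2 := by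
    have e4 : ‖τ * e‖ ≤ ‖τ * e + B y y / 2‖ + ‖B y y / 2‖ := by
      have := norm_sub_le (τ * e + B y y / 2) (B y y / 2)
      rwa [add_sub_cancel_right] at this
    rw [norm_mul] at e4
    have e5 : η' * ‖τ‖ ≤ ‖e‖ / 2 * ‖τ‖ := by gcongr
    have e6 : η' * ‖y‖ ^ 2 ≤ 1 * ‖y‖ ^ 2 := by gcongr
    rw [hK, div_mul_eq_mul_div, le_div_iff₀ (by positivity)]
    linarith
  have e7 : τ + e⁻¹ * B y y / 2 = e⁻¹ * (τ * e + B y y / 2) := by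
    field_simp
  rw [e7, norm_mul, norm_inv, inv_mul_le_iff₀ he0]
  calc ‖τ * e + B y y / 2‖ ≤ η' * ‖y‖ ^ 2 + η' * ‖τ‖ := h4
    _ ≤ η' * ‖y‖ ^ 2 + η' * (K * ‖y‖ ^ 2) := by gcongr
    _ ≤ η' * (2 + K) * ‖y‖ ^ 2 := by
      have : 0 ≤ η' * ‖y‖ ^ 2 := by positivity
      linarith
    _ ≤ ‖e‖ * η * ‖y‖ ^ 2 := by gcongr
    _ = ‖e‖ * (η * ‖y‖ ^ 2) := by ring

end Local

/-! ### The spectral splitting of a symmetric operator. -/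

section Spectral

variable {V : Type*} [NormedAddCommGroup V] [InnerProductSpace ℝ V] [FiniteDimensional ℝ V]

/-- An invertible symmetric operator is hyperbolic with respect to the projection onto the span of
its eigenvectors with positive eigenvalue. -/
theorem exists_isHyperbolicSplitting (S : V →L[ℝ] V)
    (hsymm : ∀ x y, inner ℝ (S x) y = inner ℝ x (S y)) (hinj : ∀ x, S x = 0 → x = 0) :
    ∃ (P : V →L[ℝ] V) (a : ℝ), IsHyperbolicSplitting S P a ∧
      ∀ x, P x ∈ Submodule.span ℝ {v | ∃ a : ℝ, 0 < a ∧ S v = a • v} := by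
  classical
  have hT : (S : V →ₗ[ℝ] V).IsSymmetric := hsymm
  set b := hT.eigenvectorBasis rfl with hb
  set ev := hT.eigenvalues rfl with hev
  have hSb : ∀ i, S (b i) = ev i • b i := fun i => hT.apply_eigenvectorBasis rfl i
  have hev0 : ∀ i, ev i ≠ 0 := fun i h => by
    have h1 := hSb i
    rw [h, zero_smul] at h1
    exact b.orthonormal.ne_zero i (hinj _ h1)
  have hsum : ∀ x y, inner ℝ x y = ∑ i, inner ℝ (b i) x * inner ℝ (b i) y := fun x y => by
    rw [← b.sum_inner_mul_inner]
    exact Finset.sum_congr rfl fun i _ => by rw [real_inner_comm]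
  have hSc : ∀ i x, inner ℝ (b i) (S x) = ev i * inner ℝ (b i) x := fun i x => by
    rw [← hsymm, hSb, real_inner_smul_left]
  set P : V →L[ℝ] V := ∑ i with 0 < ev i, (innerSL ℝ (b i)).smulRight (b i) with hP
  have hPx : ∀ x, P x = ∑ i with 0 < ev i, inner ℝ (b i) x • b i := fun x => by
    simp [hP, sum_apply]
  have hPc : ∀ i x, inner ℝ (b i) (P x) = if 0 < ev i then inner ℝ (b i) x else 0 := by
    intro i x
    rw [hPx, inner_sum]
    simp only [real_inner_smul_right, orthonormal_iff_ite.1 b.orthonormal]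
    simp
  obtain ⟨a, ha, hale⟩ : ∃ a > 0, ∀ i, a ≤ |ev i| := by
    rcases isEmpty_or_nonempty (Fin (Module.finrank ℝ V)) with hemp | hne
    · exact ⟨1, one_pos, fun i => isEmptyElim i⟩
    · obtain ⟨i, hi⟩ := Finite.exists_min fun i => |ev i|
      exact ⟨|ev i|, abs_pos.2 (hev0 i), hi⟩
  refine ⟨P, a, ⟨ha, fun x y => ?_, fun x => ?_, fun x => ?_⟩, fun x => ?_⟩
  · rw [hsum]
    refine Finset.sum_eq_zero fun i _ => ?_
    rw [inner_sub_right, hPc, hPc]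
    split_ifs <;> simp
  · rw [← real_inner_self_eq_norm_sq, hsum, hsum, Finset.mul_sum]
    refine Finset.sum_le_sum fun i _ => ?_
    rw [hPc, hSc]
    split_ifs with h
    · have h1 := hale i
      rw [abs_of_pos h] at h1
      rw [mul_assoc]
      exact mul_le_mul_of_nonneg_right h1 (mul_self_nonneg _)
    · simp
  · rw [← real_inner_self_eq_norm_sq, hsum, hsum, Finset.mul_sum, ← Finset.sum_neg_distrib]
    refine Finset.sum_le_sum fun i _ => ?_
    rw [inner_sub_right, hPc, hSc]
    split_ifs with h
    · simp
    · have h1 := hale i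
      rw [abs_of_nonpos (not_lt.1 h)] at h1
      rw [sub_zero, mul_assoc]
      nlinarith [mul_self_nonneg (inner ℝ (b i) x)]
  · rw [hPx]
    refine Submodule.sum_mem _ fun i hi => Submodule.smul_mem _ _ (Submodule.subset_span ?_)
    exact ⟨ev i, (Finset.mem_filter.1 hi).2, hSb i⟩

/-- A linear map that is injective on the range of `P` is bounded below there. -/
theorem exists_mul_norm_le_of_injOn_range {E : Type*} [NormedAddCommGroup E] [NormedSpace ℝ E]
    (P : V →L[ℝ] V) (L : V →L[ℝ] E) (h : ∀ x, L (P x) = 0 → P x = 0) :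
    ∃ c > 0, ∀ x, c * ‖P x‖ ≤ ‖L (P x)‖ := by
  set R := (P : V →ₗ[ℝ] V).range with hR
  obtain ⟨K, hK, hanti⟩ := ((L : V →ₗ[ℝ] E).comp R.subtype).exists_antilipschitzWith (by
    rw [LinearMap.ker_eq_bot']
    rintro ⟨_, ⟨x, rfl⟩⟩ hx
    exact Subtype.ext (h x hx))
  refine ⟨(K : ℝ)⁻¹, by positivity, fun x => ?_⟩
  have h1 := hanti.le_mul_dist (⟨P x, ⟨x, rfl⟩⟩ : R) 0
  rw [dist_zero_right, map_zero, dist_zero_right] at h1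
  rw [inv_mul_le_iff₀ (by exact_mod_cast hK)]
  exact h1

end Spectral

/-! ### Derivatives of the characteristic determinant. -/

section CharDet

variable {d N : ℕ} {hop : (Fin d → ℤ) →₀ Matrix (Fin N) (Fin N) ℂ}

theorem contDiffAt_zpow {𝕜 : Type*} [NontriviallyNormedField 𝕜] {n : ℤ} {x : 𝕜} (hx : x ≠ 0)
    {m : ℕ∞ω} : ContDiffAt 𝕜 m (fun y : 𝕜 => y ^ n) x := by
  cases n with
  | ofNat n => simpa using (contDiff_id.pow n).contDiffAt
  | negSucc n =>
    simp only [zpow_negSucc]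
    exact (contDiff_id.pow (n + 1)).contDiffAt.inv (pow_ne_zero _ hx)

variable (hop) in
/-- `det (E - H(z))` as a function of the pair `(z, E)`. -/
def charDetPair (q : (Fin d → ℂ) × ℂ) : ℂ := charDet hop q.1 q.2

/-- The entries are Laurent polynomials in z, hence smooth away from the coordinate hyperplanes. -/
theorem contDiffAt_charDetPair {q : (Fin d → ℂ) × ℂ} (hq : ∀ j, q.1 j ≠ 0) :
    ContDiffAt ℂ ∞ (charDetPair hop) q := by
  have hentry : ∀ i j, ContDiffAt ℂ ∞ (fun q : (Fin d → ℂ) × ℂ =>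
      (q.2 • (1 : Matrix (Fin N) (Fin N) ℂ) - symbol hop q.1) i j) q := by
    intro i j
    simp only [symbol, Finsupp.sum, Matrix.sub_apply, Matrix.smul_apply, Matrix.sum_apply,
      smul_eq_mul]
    refine ContDiffAt.sub (contDiffAt_snd.mul contDiffAt_const) (ContDiffAt.sum fun k _ => ?_)
    refine ContDiffAt.mul (contDiffAt_prod fun l _ => ?_) contDiffAt_const
    have h1 : ContDiffAt ℂ ∞ (fun q : (Fin d → ℂ) × ℂ => q.1 l) q :=
      (contDiff_apply ℂ ℂ l).contDiffAt.comp q contDiffAt_fst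
    exact ContDiffAt.comp (g := fun y : ℂ => y ^ k l) q (contDiffAt_zpow (hq l)) h1
  unfold charDetPair charDet
  simp only [Matrix.det_apply]
  exact ContDiffAt.sum fun σ _ => (contDiffAt_prod fun i _ => hentry _ _).const_smul _

theorem differentiableAt_charDetPair {z : Fin d → ℂ} (hz : ∀ j, z j ≠ 0) (E : ℂ) :
    DifferentiableAt ℂ (charDetPair hop) (z, E) :=
  (contDiffAt_charDetPair (q := (z, E)) hz).differentiableAt (by simp)

theorem charDetZ_eq {z : Fin d → ℂ} (hz : ∀ j, z j ≠ 0) (E : ℂ) (j : Fin d) :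
    charDetZ hop j z E = fderiv ℂ (charDetPair hop) (z, E) (Pi.single j 1, 0) := by
  have h : HasFDerivAt (fun w => charDet hop w E)
      ((fderiv ℂ (charDetPair hop) (z, E)).comp (ContinuousLinearMap.inl ℂ _ ℂ)) z :=
    HasFDerivAt.comp (g := charDetPair hop) (f := fun w => (w, E)) z
      (differentiableAt_charDetPair hz E).hasFDerivAt (hasFDerivAt_prodMk_left z E)
  rw [charDetZ, h.fderiv]
  rfl

theorem charDetE_eq {z : Fin d → ℂ} (hz : ∀ j, z j ≠ 0) (E : ℂ) :
    charDetE hop z E = fderiv ℂ (charDetPair hop) (z, E) (0, 1) := by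
  have h : HasFDerivAt (fun e => charDet hop z e)
      ((fderiv ℂ (charDetPair hop) (z, E)).comp (ContinuousLinearMap.inr ℂ _ ℂ)) E :=
    (differentiableAt_charDetPair hz E).hasFDerivAt.comp E (hasFDerivAt_prodMk_right z E)
  rw [charDetE, h.hasDerivAt.deriv]
  rfl

theorem charDetZZ_eq {z : Fin d → ℂ} (hz : ∀ j, z j ≠ 0) (E : ℂ) (j k : Fin d) :
    charDetZZ hop j k z E =
      hessianFst (charDetPair hop) (z, E) (Pi.single k 1) (Pi.single j 1) := by
  have hev : (fun w => charDetZ hop j w E) =ᶠ[𝓝 z]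
      fun w => fderiv ℂ (charDetPair hop) (w, E) (Pi.single j 1, 0) := by
    have : ∀ᶠ w : Fin d → ℂ in 𝓝 z, ∀ j, w j ≠ 0 := eventually_all.2 fun j =>
      (continuous_apply j).continuousAt.eventually_ne (hz j)
    filter_upwards [this] with w hw using charDetZ_eq hw E j
  have h1 := HasFDerivAt.comp (g := fderiv ℂ (charDetPair hop)) (f := fun w => (w, E)) z
    (hasStrictFDerivAt_fderiv (contDiffAt_charDetPair (hop := hop) (q := (z, E))
      hz)).hasFDerivAt (hasFDerivAt_prodMk_left z E)
  have h := h1.clm_apply (hasFDerivAt_const ((Pi.single j 1, 0) : (Fin d → ℂ) × ℂ) z)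
  rw [charDetZZ, hev.fderiv_eq]
  have h2 := h.fderiv
  simp only [Function.comp_def] at h2
  rw [h2, hessianFst_apply]
  simp

theorem fderiv_charDetPair_fst {z : Fin d → ℂ} {E : ℂ} (hs : IsSaddlePoint hop z E)
    (w : Fin d → ℂ) : fderiv ℂ (charDetPair hop) (z, E) (w, 0) = 0 := by
  have h : (fderiv ℂ (charDetPair hop) (z, E)).comp (ContinuousLinearMap.inl ℂ _ ℂ) = 0 := by
    refine ContinuousLinearMap.coe_injective (LinearMap.pi_ext' fun j => LinearMap.ext_ring ?_)
    simpa using (charDetZ_eq hs.ne_zero E j).symm.trans (hs.critical j)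
  exact congrArg (fun A => A w) h

/-- The energy Hessian in terms of the Hessian of the characteristic polynomial. -/
theorem energyHessian_mulVec {z : Fin d → ℂ} (hz : ∀ j, z j ≠ 0) (E : ℂ) (v : Fin d → ℂ)
    (j : Fin d) : (energyHessian hop z E).mulVec v j =
      - ((fderiv ℂ (charDetPair hop) (z, E) (0, 1))⁻¹ *
        hessianFst (charDetPair hop) (z, E) v (Pi.single j 1)) := by
  have hv : v = ∑ k, v k • (Pi.single k 1 : Fin d → ℂ) := by
    ext i
    simp [Finset.sum_apply, Pi.single_apply]
  conv_rhs => rw [hv]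
  simp only [Matrix.mulVec, dotProduct, energyHessian, Matrix.of_apply, map_sum, map_smul,
    sum_apply, smul_apply, smul_eq_mul, charDetZZ_eq hz, charDetE_eq hz]
  rw [Finset.mul_sum, ← Finset.sum_neg_distrib]
  exact Finset.sum_congr rfl fun k _ => by ring

end CharDet

/-! ### The real Hessian of Im E and the differential of μ at the saddle. -/

section SaddleData

variable {d N : ℕ} {hop : (Fin d → ℤ) →₀ Matrix (Fin N) (Fin N) ℂ} {zs : Fin d → ℂ} {Es : ℂ}

/-- The vector with components `-i conj (φ e_j)`. -/
def gradVec (φ : (Fin d → ℂ) →L[ℂ] ℂ) : EuclideanSpace ℂ (Fin d) :=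
  WithLp.toLp 2 fun j => -Complex.I * conj (φ (Pi.single j 1))

theorem gradVec_apply (φ : (Fin d → ℂ) →L[ℂ] ℂ) (j : Fin d) :
    gradVec φ j = -Complex.I * conj (φ (Pi.single j 1)) := rfl

theorem gradVec_sub (φ ψ : (Fin d → ℂ) →L[ℂ] ℂ) : gradVec (φ - ψ) = gradVec φ - gradVec ψ := by
  ext j
  simp only [gradVec_apply, PiLp.sub_apply, sub_apply, map_sub]
  ring

theorem norm_gradVec_le (φ : (Fin d → ℂ) →L[ℂ] ℂ) : ‖gradVec φ‖ ≤ (d + 1) * ‖φ‖ := by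
  refine le_of_sq_le_sq ?_ (by positivity)
  rw [EuclideanSpace.norm_sq_eq]
  have h : ∀ j, ‖gradVec φ j‖ ^ 2 ≤ ‖φ‖ ^ 2 := fun j => by
    rw [gradVec_apply, norm_mul, norm_neg, Complex.norm_I, one_mul, RCLike.norm_conj]
    gcongr
    refine (φ.le_opNorm _).trans ?_
    rw [Pi.norm_single, norm_one, mul_one]
  calc ∑ j, ‖gradVec φ j‖ ^ 2 ≤ ∑ _j : Fin d, ‖φ‖ ^ 2 := Finset.sum_le_sum fun j _ => h j
    _ = d * ‖φ‖ ^ 2 := by simp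
    _ ≤ ((d + 1) * ‖φ‖) ^ 2 := by
      rw [mul_pow]
      gcongr
      nlinarith [(Nat.cast_nonneg d : (0 : ℝ) ≤ d)]

theorem norm_ofLp_le (y : EuclideanSpace ℂ (Fin d)) : ‖WithLp.ofLp y‖ ≤ ‖y‖ :=
  (pi_norm_le_iff_of_nonneg (norm_nonneg _)).2 fun j => PiLp.norm_apply_le y j

variable (hop zs Es) in
/-- The real Hessian of `Im E` at a saddle point, in Euclidean coordinates. -/
def imHessian : EuclideanSpace ℂ (Fin d) →L[ℝ] EuclideanSpace ℂ (Fin d) :=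
  LinearMap.toContinuousLinearMap
    { toFun := fun v => gradVec ((fderiv ℂ (charDetPair hop) (zs, Es) (0, 1))⁻¹ •
        hessianFst (charDetPair hop) (zs, Es) (WithLp.ofLp v))
      map_add' := fun v w => by
        ext j
        simp only [gradVec_apply, PiLp.add_apply, WithLp.ofLp_add, map_add, add_apply, smul_apply,
          smul_add]
        ring
      map_smul' := fun r v => by
        ext j
        have h : WithLp.ofLp (r • v) = (r : ℂ) • WithLp.ofLp v := by
          ext i
          simp
        simp only [gradVec_apply, PiLp.smul_apply, h, map_smul, smul_apply, smul_eq_mul, map_mul,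
          Complex.conj_ofReal, RingHom.id_apply, Complex.real_smul]
        ring }

theorem imHessian_apply (v : EuclideanSpace ℂ (Fin d)) : imHessian hop zs Es v =
    gradVec ((fderiv ℂ (charDetPair hop) (zs, Es) (0, 1))⁻¹ •
        hessianFst (charDetPair hop) (zs, Es) (WithLp.ofLp v)) := rfl

/-- Identifies the operator built from p with the map v ↦ i conj(A v) that defines
`ascendingDirections`. -/
theorem imHessian_apply_apply (hz : ∀ j, zs j ≠ 0) (v : EuclideanSpace ℂ (Fin d)) (j : Fin d) :
    imHessian hop zs Es v j =
      Complex.I * conj ((energyHessian hop zs Es).mulVec (WithLp.ofLp v) j) := by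
  rw [imHessian_apply, gradVec_apply, energyHessian_mulVec hz, smul_apply, smul_eq_mul, map_neg]
  ring

/-- Since ∂²E/∂z² = -(∂p/∂E)⁻¹ ∂²p/∂z², the right side is the imaginary part of the complex Hessian
form. Symmetry of the operator, and the expansion of the height, are read off from it. -/
theorem inner_imHessian (x y : EuclideanSpace ℂ (Fin d)) :
    inner ℝ (imHessian hop zs Es x) y =
      -((fderiv ℂ (charDetPair hop) (zs, Es) (0, 1))⁻¹ *
        hessianFst (charDetPair hop) (zs, Es) (WithLp.ofLp x) (WithLp.ofLp y)).im := by
  set φ := (fderiv ℂ (charDetPair hop) (zs, Es) (0, 1))⁻¹ •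
        hessianFst (charDetPair hop) (zs, Es) (WithLp.ofLp x) with hφ
  have hy : WithLp.ofLp y = ∑ j, y j • (Pi.single j 1 : Fin d → ℂ) := by
    ext i
    simp [Finset.sum_apply, Pi.single_apply]
  have h1 : (fderiv ℂ (charDetPair hop) (zs, Es) (0, 1))⁻¹ *
        hessianFst (charDetPair hop) (zs, Es) (WithLp.ofLp x) (WithLp.ofLp y) =
      ∑ j, y j * φ (Pi.single j 1) := by
    change φ (WithLp.ofLp y) = _
    conv_lhs => rw [hy, map_sum]
    simp only [map_smul, smul_eq_mul]
  rw [h1, PiLp.inner_apply, Complex.im_sum, ← Finset.sum_neg_distrib]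
  refine Finset.sum_congr rfl fun j _ => ?_
  rw [imHessian_apply, gradVec_apply, ← hφ]
  simp only [Complex.inner, map_mul, map_neg, Complex.conj_I, Complex.conj_conj]
  simp
  ring

theorem imHessian_symm (hz : ∀ j, zs j ≠ 0) (x y : EuclideanSpace ℂ (Fin d)) :
    inner ℝ (imHessian hop zs Es x) y = inner ℝ x (imHessian hop zs Es y) := by
  rw [real_inner_comm (imHessian hop zs Es y) x, inner_imHessian, inner_imHessian,
    hessianFst_comm (contDiffAt_charDetPair (q := (zs, Es)) hz)]

theorem imHessian_injective (hz : ∀ j, zs j ≠ 0) (hn : IsNondegenerate hop zs Es)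
    (x : EuclideanSpace ℂ (Fin d)) (hx : imHessian hop zs Es x = 0) : x = 0 := by
  have h : (energyHessian hop zs Es).mulVec (WithLp.ofLp x) = 0 := by
    ext j
    have := congrArg (fun v : EuclideanSpace ℂ (Fin d) => v j) hx
    simpa [imHessian_apply_apply hz] using this
  have h2 := Matrix.eq_zero_of_mulVec_eq_zero hn.hessian h
  ext j
  exact congrFun h2 j

/-- Lets the transversality hypothesis be applied on the range of the spectral projection. -/
theorem span_positive_le (hz : ∀ j, zs j ≠ 0) (x : EuclideanSpace ℂ (Fin d))
    (hx : x ∈ Submodule.span ℝ {v | ∃ a : ℝ, 0 < a ∧ imHessian hop zs Es v = a • v}) :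
    WithLp.ofLp x ∈ ascendingDirections hop zs Es := by
  have hle : Submodule.span ℝ {v | ∃ a : ℝ, 0 < a ∧ imHessian hop zs Es v = a • v} ≤
      (ascendingDirections hop zs Es).comap (WithLp.linearEquiv 2 ℝ (Fin d → ℂ)).toLinearMap := by
    refine Submodule.span_le.2 ?_
    rintro v ⟨a, ha, hv⟩
    refine Submodule.subset_span ⟨a, ha, fun j => ?_⟩
    have := congrArg (fun v : EuclideanSpace ℂ (Fin d) => v j) hv
    simpa [imHessian_apply_apply hz] using this
  exact hle hx

variable (zs) in
/-- The differential of `z ↦ (log |z_1|, …, log |z_d|)`. -/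
def logModulusDeriv : EuclideanSpace ℂ (Fin d) →L[ℝ] EuclideanSpace ℝ (Fin d) :=
  LinearMap.toContinuousLinearMap
    { toFun := fun v => WithLp.toLp 2 fun j => (v j / zs j).re
      map_add' := fun v w => by
        ext j
        simp [add_div]
      map_smul' := fun r v => by
        ext j
        simp [mul_div_assoc] }

theorem logModulusDeriv_apply (v : EuclideanSpace ℂ (Fin d)) (j : Fin d) :
    logModulusDeriv zs v j = (v j / zs j).re := rfl

/-- Near y = 0, log |w + y| = Re log(1 + y/w) + log |w|, with the complex logarithm taken near 1 and
so off its branch cut. -/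
theorem hasStrictFDerivAt_log_norm {w : ℂ} (hw : w ≠ 0) :
    HasStrictFDerivAt (fun y : ℂ => Real.log ‖w + y‖)
      (Complex.reCLM.comp ((ContinuousLinearMap.mul ℝ ℂ) w⁻¹)) 0 := by
  have h1 : HasStrictDerivAt (fun y : ℂ => Complex.log (1 + y / w)) (w⁻¹) 0 := by
    have h2 : HasStrictDerivAt (fun y : ℂ => 1 + y / w) (w⁻¹) 0 := by
      simpa using ((hasStrictDerivAt_id (0 : ℂ)).div_const w).const_add 1
    have h3 := h2.clog (by simp)
    simpa using h3
  have h4 : HasStrictFDerivAt (fun y : ℂ => (Complex.log (1 + y / w)).re + Real.log ‖w‖)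
      (Complex.reCLM.comp ((ContinuousLinearMap.mul ℝ ℂ) w⁻¹)) 0 := by
    have h5 := (h1.hasStrictFDerivAt.restrictScalars ℝ)
    have h6 := (Complex.reCLM.hasStrictFDerivAt.comp (0 : ℂ) h5).add_const (Real.log ‖w‖)
    refine h6.congr_fderiv ?_
    ext
    simp
    ring
  refine h4.congr_of_eventuallyEq ?_
  have hne : ∀ᶠ y : ℂ in 𝓝 0, 1 + y / w ≠ 0 := by
    have : ContinuousAt (fun y : ℂ => 1 + y / w) 0 := by fun_prop
    exact this.eventually_ne (by simp)
  filter_upwards [hne] with y hy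
  rw [Complex.log_re, ← Real.log_mul (norm_ne_zero_iff.2 hy) (norm_ne_zero_iff.2 hw), ← norm_mul]
  congr 2
  field_simp

theorem hasStrictFDerivAt_logModulus (hz : ∀ j, zs j ≠ 0) :
    HasStrictFDerivAt (fun y : EuclideanSpace ℂ (Fin d) => logModulus (zs + WithLp.ofLp y))
      (logModulusDeriv zs) 0 := by
  rw [hasStrictFDerivAt_euclidean]
  intro j
  have h1 : HasStrictFDerivAt (fun y : EuclideanSpace ℂ (Fin d) => y j)
      (PiLp.proj (𝕜 := ℝ) 2 (fun _ : Fin d => ℂ) j) 0 :=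
    (PiLp.proj (𝕜 := ℝ) 2 (fun _ : Fin d => ℂ) j).hasStrictFDerivAt
  have h2 := HasStrictFDerivAt.comp (g := fun y : ℂ => Real.log ‖zs j + y‖)
    (f := fun y : EuclideanSpace ℂ (Fin d) => y j) 0
    (by simpa using hasStrictFDerivAt_log_norm (hz j)) h1
  refine h2.congr_fderiv ?_
  ext v
  change (_ : ℂ).re = (_ : ℂ).re
  congr 1
  change (zs j)⁻¹ * v j = v j / zs j
  rw [div_eq_inv_mul]

end SaddleData

/-! ### Separation of directions at a small level above the saddle. -/

section LevelSeparation

variable {d N : ℕ} {hop : (Fin d → ℤ) →₀ Matrix (Fin N) (Fin N) ℂ} {zs : Fin d → ℂ} {Es : ℂ}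

variable (zs Es) in
/-- The point of `(z, E)` space at displacement `y` from the saddle and height `t` above it. -/
def saddlePoint (p : EuclideanSpace ℂ (Fin d) × ℝ) : (Fin d → ℂ) × ℂ :=
  (zs + WithLp.ofLp p.1, Es + Complex.I * p.2)

theorem continuous_saddlePoint : Continuous (saddlePoint (d := d) zs Es) := by
  unfold saddlePoint
  fun_prop

theorem saddlePoint_zero : saddlePoint zs Es (0, 0) = (zs, Es) := by simp [saddlePoint]

theorem exists_radius_of_eventually {Φ : ((Fin d → ℂ) × ℂ) × ((Fin d → ℂ) × ℂ) → Prop}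
    (h : ∀ᶠ p in 𝓝 ((zs, Es), (zs, Es)), Φ p) :
    ∃ r > 0, ∀ (y₁ y₂ : EuclideanSpace ℂ (Fin d)) (s t : ℝ), |s| ≤ r → |t| ≤ r → ‖y₁‖ ≤ r →
      ‖y₂‖ ≤ r → Φ (saddlePoint zs Es (y₁, s), saddlePoint zs Es (y₂, t)) := by
  have hc : Tendsto (fun p : (EuclideanSpace ℂ (Fin d) × ℝ) × (EuclideanSpace ℂ (Fin d) × ℝ) =>
      (saddlePoint zs Es p.1, saddlePoint zs Es p.2)) (𝓝 ((0, 0), (0, 0)))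
      (𝓝 ((zs, Es), (zs, Es))) := by
    refine Continuous.tendsto' ?_ _ _ (by simp only [saddlePoint_zero])
    exact (continuous_saddlePoint.comp continuous_fst).prodMk
      (continuous_saddlePoint.comp continuous_snd)
  obtain ⟨r, hr, hball⟩ := Metric.eventually_nhds_iff_ball.1 (hc.eventually h)
  refine ⟨r / 2, half_pos hr, fun y₁ y₂ s t hs ht h1 h2 => ?_⟩
  refine hball ((y₁, s), (y₂, t)) ?_
  simp only [mem_ball_iff_norm, Prod.norm_def, Prod.fst_sub, Prod.snd_sub, max_lt_iff, sub_zero,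
    Real.norm_eq_abs]
  exact ⟨⟨by linarith, by linarith⟩, by linarith, by linarith⟩

/-- At a small level above the saddle, points of distinct ascending lines have images under
`μ` in distinct directions, quantitatively. -/
theorem exists_level_separation (hsaddle : IsSaddlePoint hop zs Es)
    (hnondeg : IsNondegenerate hop zs Es) (htrans : IsTransverse hop zs Es)
    (hBZ : zs ∈ brillouinZone d) {Z : ℝ → EuclideanSpace ℝ (Fin d) → Fin d → ℂ}
    (hline : ∀ ξ, ‖ξ‖ = 1 → IsAscendingLine hop zs Es (Set.Ioi 0) (fun t => Z t ξ)) :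
    ∃ κ > 0, ∃ t > 0, ∀ ξ ζ, ‖ξ‖ = 1 → ‖ζ‖ = 1 → ∀ l : ℝ, 0 ≤ l →
      κ * ‖Z t ξ - Z t ζ‖ ≤ ‖logModulus (Z t ξ) - l • logModulus (Z t ζ)‖ := by
  have hz := hsaddle.ne_zero
  set f := charDetPair hop with hf
  set q₀ : (Fin d → ℂ) × ℂ := (zs, Es) with hq₀
  have hfs : ContDiffAt ℂ ∞ f q₀ := contDiffAt_charDetPair (q := (zs, Es)) hz
  have h0 : f q₀ = 0 := hsaddle.on_surface
  have hfz : ∀ w, fderiv ℂ f q₀ (w, 0) = 0 := fderiv_charDetPair_fst hsaddle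
  have hfE : fderiv ℂ f q₀ (0, 1) ≠ 0 := by
    have := hnondeg.simple
    rwa [charDetE_eq hz] at this
  set S := imHessian hop zs Es with hS
  obtain ⟨P, a, hsplit, hrange⟩ := exists_isHyperbolicSplitting S (imHessian_symm hz)
    (imHessian_injective hz hnondeg)
  obtain ⟨c, hc, hL⟩ := exists_mul_norm_le_of_injOn_range P (logModulusDeriv zs) (fun x hx => by
    have h1 := htrans _ (span_positive_le hz _ (hrange x)) (fun j => by
      have := congrArg (fun v : EuclideanSpace ℝ (Fin d) => v j) hx
      simpa [logModulusDeriv_apply] using this)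
    ext j
    exact congrFun h1 j)
  set u : {ξ : EuclideanSpace ℝ (Fin d) // ‖ξ‖ = 1} → ℝ → EuclideanSpace ℂ (Fin d) :=
    fun ξ t => WithLp.toLp 2 (Z t ξ - zs) with hu
  have hpt : ∀ ξ t, saddlePoint zs Es (u ξ t, t) = (Z t ξ, Es + Complex.I * t) := fun ξ t => by
    simp [saddlePoint, hu]
  have hsurf : ∀ ξ, ∀ t > 0, f (saddlePoint zs Es (u ξ t, t)) = 0 := fun ξ t ht => by
    rw [hpt]
    exact (hline ξ ξ.2).on_surface t ht
  have hfst : ∀ (y₁ y₂ : EuclideanSpace ℂ (Fin d)) (s t : ℝ),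
      (saddlePoint zs Es (y₁, s)).1 - (saddlePoint zs Es (y₂, t)).1 = WithLp.ofLp (y₁ - y₂) :=
    fun y₁ y₂ s t => by simp [saddlePoint]
  have hfst0 : ∀ (y : EuclideanSpace ℂ (Fin d)) (s : ℝ),
      (saddlePoint zs Es (y, s)).1 - q₀.1 = WithLp.ofLp y := fun y s => by
    simp [saddlePoint, hq₀]
  -- This is the gradient of Im E on the energy surface. The given flow is a positive multiple of it
  -- that is singular at the saddle, whereas G extends there and is nearly S applied to the
  -- displacement.
  set G : {ξ : EuclideanSpace ℝ (Fin d) // ‖ξ‖ = 1} → ℝ → EuclideanSpace ℂ (Fin d) :=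
    fun ξ t => gradVec (gradRatio f (saddlePoint zs Es (u ξ t, t))) with hG
  have hderiv : ∀ ξ, ∀ t > 0, HasDerivAt (u ξ)
      (WithLp.toLp 2 (ascentVelocity hop (Z t ξ) (Es + Complex.I * t))) t := fun ξ t ht => by
    have h1 := ((hline ξ ξ.2).flow t ht).sub_const zs
    exact ((PiLp.continuousLinearEquiv 2 ℝ (fun _ : Fin d => ℂ)).symm.hasFDerivAt).comp_hasDerivAt
      t h1
  have hgrad : ∀ η > 0, ∃ r > 0, ∀ (y₁ y₂ : EuclideanSpace ℂ (Fin d)) (s t : ℝ), |s| ≤ r →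
      |t| ≤ r → ‖y₁‖ ≤ r → ‖y₂‖ ≤ r → f (saddlePoint zs Es (y₁, s)) = 0 →
      f (saddlePoint zs Es (y₂, t)) = 0 →
      ‖gradVec (gradRatio f (saddlePoint zs Es (y₁, s))) -
        gradVec (gradRatio f (saddlePoint zs Es (y₂, t))) - S (y₁ - y₂)‖ ≤ η * ‖y₁ - y₂‖ := by
    intro η hη
    obtain ⟨r, hr, H⟩ := exists_radius_of_eventually (eventually_gradRatio_sub_le hfs hfz hfE
      (η := η / (d + 1)) (by positivity))
    refine ⟨r, hr, fun y₁ y₂ s t hs ht h1 h2 e1 e2 => ?_⟩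
    have h3 := H y₁ y₂ s t hs ht h1 h2 e1 e2
    simp only [hfst] at h3
    rw [hS, imHessian_apply, ← gradVec_sub, ← gradVec_sub]
    refine (norm_gradVec_le _).trans ?_
    calc (d + 1 : ℝ) * _ ≤ (d + 1) * (η / (d + 1) * ‖WithLp.ofLp (y₁ - y₂)‖) := by gcongr
      _ = η * ‖WithLp.ofLp (y₁ - y₂)‖ := by field_simp
      _ ≤ η * ‖y₁ - y₂‖ := by
        gcongr
        exact norm_ofLp_le _
  have hlog : ∀ η > 0, ∃ r > 0, ∀ (y₁ y₂ : EuclideanSpace ℂ (Fin d)), ‖y₁‖ ≤ r → ‖y₂‖ ≤ r →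
      ‖logModulus (zs + WithLp.ofLp y₁) - logModulus (zs + WithLp.ofLp y₂) -
        logModulusDeriv zs (y₁ - y₂)‖ ≤ η * ‖y₁ - y₂‖ := by
    intro η hη
    obtain ⟨r, hr, H⟩ := Metric.eventually_nhds_iff_ball.1
      ((hasStrictFDerivAt_logModulus hz).isLittleO.def hη)
    refine ⟨r / 2, half_pos hr, fun y₁ y₂ h1 h2 => H (y₁, y₂) ?_⟩
    simp only [mem_ball_iff_norm, Prod.norm_def, Prod.fst_sub, Prod.snd_sub, max_lt_iff, sub_zero]
    exact ⟨by linarith, by linarith⟩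
  -- As the saddle lies on the Brillouin zone, μ has no constant term in its expansion and is nearly
  -- L of the displacement.
  have hlog0 : logModulus zs = 0 := by
    ext j
    simp [logModulus, hBZ j]
  have hZu : ∀ ξ t, zs + WithLp.ofLp (u ξ t) = Z t ξ := fun ξ t => by simp [hu]
  have key : ∃ κ > 0, ∃ t > 0, ∀ ξ ζ, ∀ l : ℝ, 0 ≤ l →
      κ * ‖u ξ t - u ζ t‖ ≤ ‖logModulus (Z t ξ) - l • logModulus (Z t ζ)‖ := by
    refine hsplit.exists_uniform_separation (imHessian_symm hz) hc hL
      (u := u) (G := G) (m := fun ξ t => logModulus (Z t ξ)) ?_ ?_ ?_ ?_ ?_ ?_ ?_ ?_ ?_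
    · intro ξ
      have h1 : Tendsto (fun t => Z t ξ - zs) (𝓝[>] 0) (𝓝 (zs - zs)) :=
        (hline ξ ξ.2).start.sub_const zs
      rw [sub_self] at h1
      exact ((PiLp.continuous_toLp 2 (fun _ : Fin d => ℂ)).tendsto' 0 0 rfl).comp h1
    · exact fun ξ t ht => (hderiv ξ t ht).continuousAt
    · have hev : ∀ᶠ p : ((Fin d → ℂ) × ℂ) × ((Fin d → ℂ) × ℂ) in 𝓝 (q₀, q₀),
          fderiv ℂ f p.1 (0, 1) ≠ 0 := by
        have h1 : ContinuousAt (fun p : ((Fin d → ℂ) × ℂ) × ((Fin d → ℂ) × ℂ) =>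
            fderiv ℂ f p.1 (0, 1)) (q₀, q₀) :=
          ContinuousAt.comp (g := fun q => fderiv ℂ f q (0, 1)) (f := Prod.fst)
            ((hasStrictFDerivAt_fderiv hfs).hasFDerivAt.continuousAt.clm_apply continuousAt_const)
            continuousAt_fst
        exact h1.eventually_ne hfE
      obtain ⟨r, hr, H⟩ := exists_radius_of_eventually hev
      refine ⟨r, hr, fun ξ t ht htr hur => ?_⟩
      have hne := H (u ξ t) (u ξ t) t t (by rwa [abs_of_pos ht]) (by rwa [abs_of_pos ht]) hur hur
      simp only [hpt] at hne
      have hzne := (hline ξ ξ.2).ne_zero t ht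
      have hpE := charDetE_eq (hop := hop) hzne (Es + Complex.I * t)
      obtain ⟨j₀, hj₀⟩ := (hline ξ ξ.2).regular t ht
      have hsum : 0 < ∑ k, ‖charDetZ hop k (Z t ξ) (Es + Complex.I * t)‖ ^ 2 :=
        Finset.sum_pos' (fun k _ => by positivity) ⟨j₀, Finset.mem_univ _, by positivity⟩
      set e := fderiv ℂ f (Z t ξ, Es + Complex.I * t) (0, 1) with he
      -- This is 1/|∇h|² on the energy surface, because E_k = -p_k / p_E.
      refine ⟨‖e‖ ^ 2 / ∑ k, ‖charDetZ hop k (Z t ξ) (Es + Complex.I * t)‖ ^ 2, by positivity, ?_⟩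
      refine (hderiv ξ t ht).congr_deriv ?_
      ext j
      have hG' : G ξ t j = -Complex.I * conj (e⁻¹ * charDetZ hop j (Z t ξ) (Es + Complex.I * t)) := by
        simp only [hG, hpt, gradVec_apply]
        rw [charDetZ_eq hzne]
        rfl
      rw [PiLp.smul_apply, hG', Complex.real_smul]
      simp only [ascentVelocity]
      rw [hpE]
      push_cast
      rw [← Complex.mul_conj' e, map_mul, map_inv₀]
      have hce : conj e ≠ 0 := (map_ne_zero _).2 hne
      change -Complex.I * e * _ / _ = _
      field_simp
    · intro η hη
      obtain ⟨r, hr, H⟩ := hgrad η hη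
      refine ⟨r, hr, fun ξ t ht htr hur => ?_⟩
      have h1 := H (u ξ t) 0 t 0 (by rwa [abs_of_pos ht]) (by simpa using hr.le) hur
        (by simpa using hr.le) (hsurf ξ t ht) (by rw [saddlePoint_zero]; exact h0)
      have h2 : gradRatio f (zs, Es) = 0 := by
        ext w
        change (fderiv ℂ f q₀ (0, 1))⁻¹ * fderiv ℂ f q₀ (w, 0) = 0
        rw [hfz, mul_zero]
      have h3 : gradVec (0 : (Fin d → ℂ) →L[ℂ] ℂ) = 0 := by
        simpa using gradVec_sub (0 : (Fin d → ℂ) →L[ℂ] ℂ) 0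
      rw [saddlePoint_zero, h2, h3, sub_zero, sub_zero] at h1
      exact h1
    · intro η hη
      obtain ⟨r, hr, H⟩ := hgrad η hη
      exact ⟨r, hr, fun ξ ζ s hs t ht hsr htr h1 h2 => H (u ξ s) (u ζ t) s t
        (by rwa [abs_of_pos hs]) (by rwa [abs_of_pos ht]) h1 h2 (hsurf ξ s hs) (hsurf ζ t ht)⟩
    · intro η hη
      have hten : Tendsto (fun p : ((Fin d → ℂ) × ℂ) × ((Fin d → ℂ) × ℂ) => p.1) (𝓝 (q₀, q₀))
          (𝓝 q₀) := continuous_fst.tendsto' _ _ rfl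
      obtain ⟨r, hr, H⟩ := exists_radius_of_eventually
        (hten.eventually (eventually_snd_expansion hfs h0 hfz hfE hη))
      refine ⟨r, hr, fun ξ t ht htr hur => ?_⟩
      have h1 := H (u ξ t) (u ξ t) t t (by rwa [abs_of_pos ht]) (by rwa [abs_of_pos ht]) hur hur
        (hsurf ξ t ht)
      rw [hfst0] at h1
      have h2 : t - inner ℝ (S (u ξ t)) (u ξ t) / 2 = ((saddlePoint zs Es (u ξ t, t)).2 - q₀.2 +
          (fderiv ℂ f q₀ (0, 1))⁻¹ *
            hessianFst f q₀ (WithLp.ofLp (u ξ t)) (WithLp.ofLp (u ξ t)) / 2).im := by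
        have h3 : (saddlePoint zs Es (u ξ t, t)).2 - q₀.2 = Complex.I * t := by
          simp [saddlePoint, hq₀]
        rw [h3, inner_imHessian, Complex.add_im]
        have h4 : ∀ w : ℂ, (w / 2).im = w.im / 2 := fun w => by simp
        rw [h4]
        simp
        ring
      rw [h2]
      refine (Complex.abs_im_le_norm _).trans (h1.trans ?_)
      gcongr
      exact norm_ofLp_le _
    · intro η hη
      obtain ⟨r, hr, H⟩ := exists_radius_of_eventually
        (eventually_hessian_sub_le hfs h0 hfz hfE
          (η := η / (‖(fderiv ℂ f q₀ (0, 1))⁻¹‖ + 1)) (by positivity))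
      refine ⟨r, hr, fun ξ ζ t ht htr h1 h2 => ?_⟩
      have h3 := H (u ξ t) (u ζ t) t t (by rwa [abs_of_pos ht]) (by rwa [abs_of_pos ht]) h1 h2
        (hsurf ξ t ht) (hsurf ζ t ht) rfl
      simp only [hfst, hfst0] at h3
      rw [inner_imHessian, inner_imHessian, neg_sub_neg, ← Complex.sub_im, ← mul_sub]
      refine (Complex.abs_im_le_norm _).trans ?_
      rw [norm_mul, norm_sub_rev]
      set c' := (fderiv ℂ f q₀ (0, 1))⁻¹ with hc'
      calc ‖c'‖ * _ ≤ (‖c'‖ + 1) * (η / (‖c'‖ + 1) * (‖u ξ t‖ + ‖u ζ t‖) * ‖u ξ t - u ζ t‖) := by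
            gcongr
            · linarith
            · refine h3.trans ?_
              gcongr <;> exact norm_ofLp_le _
        _ = η * (‖u ξ t‖ + ‖u ζ t‖) * ‖u ξ t - u ζ t‖ := by
            have : ‖c'‖ + 1 ≠ 0 := by positivity
            field_simp
    · intro η hη
      obtain ⟨r, hr, H⟩ := hlog η hη
      refine ⟨r, hr, fun ξ t ht htr hur => ?_⟩
      have h1 := H (u ξ t) 0 hur (by simpa using hr.le)
      rw [hZu] at h1
      simpa [hlog0] using h1
    · intro η hη
      obtain ⟨r, hr, H⟩ := hlog η hη
      refine ⟨r, hr, fun ξ ζ t ht htr h1 h2 => ?_⟩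
      have h3 := H (u ξ t) (u ζ t) h1 h2
      rwa [hZu, hZu] at h3
  obtain ⟨κ, hκ, t, ht, H⟩ := key
  refine ⟨κ, hκ, t, ht, fun ξ ζ hξ hζ l hl => ?_⟩
  refine le_trans ?_ (H ⟨ξ, hξ⟩ ⟨ζ, hζ⟩ l hl)
  gcongr
  refine le_trans (le_of_eq ?_) (norm_ofLp_le _)
  simp [hu]

end LevelSeparation

/-! ### From separated directions to an injective, immersive cone map. -/

section ConeSeparation

variable {d : ℕ} {W : Type*} [NormedAddCommGroup W]
  {f : EuclideanSpace ℝ (Fin d) → EuclideanSpace ℝ (Fin d)} {g : EuclideanSpace ℝ (Fin d) → W}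
  {κ : ℝ}

theorem norm_inv_norm_smul {x : EuclideanSpace ℝ (Fin d)} (hx : x ≠ 0) : ‖‖x‖⁻¹ • x‖ = 1 := by
  simp [norm_smul, hx]

/-- A separation of the directions of `f` is a lower bound for the variation of its cone map. -/
theorem norm_sub_le_unitConeMap_sub (hf : ∀ ξ, ‖ξ‖ = 1 → f ξ ≠ 0)
    (hsep : ∀ ξ ζ, ‖ξ‖ = 1 → ‖ζ‖ = 1 → ∀ l : ℝ, 0 ≤ l → κ * ‖g ξ - g ζ‖ ≤ ‖f ξ - l • f ζ‖)
    {x y : EuclideanSpace ℝ (Fin d)} (hx : x ≠ 0) (hy : y ≠ 0) :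
    κ * ‖g (‖x‖⁻¹ • x) - g (‖y‖⁻¹ • y)‖ ≤
      ‖f (‖x‖⁻¹ • x)‖ / ‖x‖ * ‖unitConeMap f x - unitConeMap f y‖ := by
  have h1 : ∀ z : EuclideanSpace ℝ (Fin d), z ≠ 0 →
      f (‖z‖⁻¹ • z) = (‖f (‖z‖⁻¹ • z)‖ / ‖z‖) • unitConeMap f z := fun z hz => by
    have h2 : ‖f (‖z‖⁻¹ • z)‖ ≠ 0 := norm_ne_zero_iff.2 (hf _ (norm_inv_norm_smul hz))
    have h3 : ‖z‖ ≠ 0 := norm_ne_zero_iff.2 hz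
    rw [unitConeMap, smul_smul, smul_smul]
    have : ‖f (‖z‖⁻¹ • z)‖ / ‖z‖ * (‖z‖ * ‖f (‖z‖⁻¹ • z)‖⁻¹) = 1 := by
      generalize ‖f (‖z‖⁻¹ • z)‖ = c at h2
      field_simp
    rw [mul_assoc, this, one_smul]
  have hqy : ‖f (‖y‖⁻¹ • y)‖ / ‖y‖ ≠ 0 := div_ne_zero
    (norm_ne_zero_iff.2 (hf _ (norm_inv_norm_smul hy))) (norm_ne_zero_iff.2 hy)
  -- This l rescales f at the direction of y so that both values carry the same factor
  -- ‖f(x/‖x‖)‖/‖x‖ in front of the cone map.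
  refine (hsep _ _ (norm_inv_norm_smul hx) (norm_inv_norm_smul hy)
    (‖f (‖x‖⁻¹ • x)‖ / ‖x‖ / (‖f (‖y‖⁻¹ • y)‖ / ‖y‖)) (by positivity)).trans (le_of_eq ?_)
  nth_rewrite 1 [h1 x hx]
  nth_rewrite 2 [h1 y hy]
  rw [smul_smul, div_mul_cancel₀ _ hqy, ← smul_sub, norm_smul, Real.norm_of_nonneg (by positivity)]

/-- Equal values have equal norms, so x and y do too. The separation then makes g agree at their
directions, and g is injective on the sphere. -/
theorem unitConeMap_injective (hκ : 0 < κ) (hf : ∀ ξ, ‖ξ‖ = 1 → f ξ ≠ 0)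
    (hsep : ∀ ξ ζ, ‖ξ‖ = 1 → ‖ζ‖ = 1 → ∀ l : ℝ, 0 ≤ l → κ * ‖g ξ - g ζ‖ ≤ ‖f ξ - l • f ζ‖)
    (hg : Set.InjOn g (Metric.sphere 0 1)) : Function.Injective (unitConeMap f) := by
  intro x y hxy
  have hnorm : ‖x‖ = ‖y‖ := by rw [← norm_unitConeMap hf x, hxy, norm_unitConeMap hf]
  by_cases hx : x = 0
  · rw [hx, norm_zero] at hnorm
    rw [hx, norm_eq_zero.1 hnorm.symm]
  have hy : y ≠ 0 := by rwa [← norm_ne_zero_iff, ← hnorm, norm_ne_zero_iff]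
  have h1 := norm_sub_le_unitConeMap_sub hf hsep hx hy
  rw [hxy, sub_self, norm_zero, mul_zero] at h1
  have h2 : g (‖x‖⁻¹ • x) = g (‖y‖⁻¹ • y) := by
    rw [← sub_eq_zero, ← norm_le_zero_iff]
    exact nonpos_of_mul_nonpos_right h1 hκ
  have h3 := hg (by simpa using norm_inv_norm_smul hx) (by simpa using norm_inv_norm_smul hy) h2
  rw [hnorm] at h3
  exact smul_right_injective _ (inv_ne_zero (norm_ne_zero_iff.2 hy)) h3

variable [NormedSpace ℝ W]

theorem fderiv_apply_eq_zero_of_norm_sub_le {X Y : Type*} [NormedAddCommGroup X] [NormedSpace ℝ X]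
    [NormedAddCommGroup Y] [NormedSpace ℝ Y] {F : X → Y} {G : X → W} {x k : X} {C : ℝ}
    (hF : DifferentiableAt ℝ F x) (hG : DifferentiableAt ℝ G x)
    (hle : ∀ᶠ y in 𝓝 x, ‖G y - G x‖ ≤ C * ‖F y - F x‖) (hk : fderiv ℝ F x k = 0) :
    fderiv ℝ G x k = 0 := by
  have hline : HasDerivAt (fun s : ℝ => x + s • k) k 0 := by
    simpa using ((hasDerivAt_id (0 : ℝ)).smul_const k).const_add x
  have hx : x + (0 : ℝ) • k = x := by simp
  have hF' : HasDerivAt (fun s : ℝ => F (x + s • k)) 0 0 := by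
    rw [← hk]
    refine HasFDerivAt.comp_hasDerivAt (0 : ℝ) (f := fun s : ℝ => x + s • k) ?_ hline
    rw [hx]
    exact hF.hasFDerivAt
  have hG' : HasDerivAt (fun s : ℝ => G (x + s • k)) (fderiv ℝ G x k) 0 := by
    refine HasFDerivAt.comp_hasDerivAt (0 : ℝ) (f := fun s : ℝ => x + s • k) ?_ hline
    rw [hx]
    exact hG.hasFDerivAt
  refine hG'.unique ?_
  rw [hasDerivAt_iff_isLittleO] at hF' ⊢
  simp only [smul_zero, sub_zero, hx] at hF' ⊢
  refine Asymptotics.IsBigO.trans_isLittleO ?_ hF'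
  refine Asymptotics.IsBigO.of_bound C ?_
  have hten : Tendsto (fun s : ℝ => x + s • k) (𝓝 0) (𝓝 x) := by
    simpa [hx] using hline.continuousAt.tendsto
  exact hten.eventually hle

/-- By homogeneity x may be taken of norm one. A kernel vector is orthogonal to x because the norm
is preserved, and the separation passes the vanishing derivative on to g, which is an immersion of
the sphere. -/
theorem unitConeMap_immersion (hκ : 0 < κ) (hf : ∀ ξ, ‖ξ‖ = 1 → f ξ ≠ 0)
    (hsep : ∀ ξ ζ, ‖ξ‖ = 1 → ‖ζ‖ = 1 → ∀ l : ℝ, 0 ≤ l → κ * ‖g ξ - g ζ‖ ≤ ‖f ξ - l • f ζ‖)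
    (hF : DifferentiableOn ℝ (unitConeMap f) {0}ᶜ)
    (hg : DifferentiableOn ℝ (fun x => g (‖x‖⁻¹ • x)) {0}ᶜ)
    (himm : ∀ ξ v : EuclideanSpace ℝ (Fin d), ‖ξ‖ = 1 → inner ℝ ξ v = 0 → v ≠ 0 →
      fderiv ℝ (fun x => g (‖x‖⁻¹ • x)) ξ v ≠ 0)
    (x : EuclideanSpace ℝ (Fin d)) (hx : x ≠ 0) (k : EuclideanSpace ℝ (Fin d))
    (hk : fderiv ℝ (unitConeMap f) x k = 0) : k = 0 := by
  wlog hx1 : ‖x‖ = 1 generalizing x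
  · refine this (‖x‖⁻¹ • x) (norm_ne_zero_iff.1 (by simp [norm_inv_norm_smul hx])) ?_
      (norm_inv_norm_smul hx)
    rwa [fderiv_homogeneous (fun c hc x => unitConeMap_smul f hc x)
      (inv_pos.2 (norm_pos_iff.2 hx))]
  have hmem : ({0}ᶜ : Set (EuclideanSpace ℝ (Fin d))) ∈ 𝓝 x := isOpen_compl_singleton.mem_nhds hx
  have hFx := hF.differentiableAt hmem
  have hgx := hg.differentiableAt hmem
  have horth : inner ℝ x k = 0 := by
    have h1 := hFx.hasFDerivAt.norm_sq
    simp only [norm_unitConeMap hf] at h1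
    have h2 := congrArg (fun A : EuclideanSpace ℝ (Fin d) →L[ℝ] ℝ => A k)
      (h1.unique (hasFDerivAt_id x).norm_sq)
    simp [hk] at h2
    exact h2
  by_contra hk0
  refine himm x k hx1 horth hk0 (fderiv_apply_eq_zero_of_norm_sub_le (F := unitConeMap f)
    (C := κ⁻¹ * (‖f (‖x‖⁻¹ • x)‖ / ‖x‖)) hFx hgx ?_ hk)
  filter_upwards [hmem] with y hy
  have h1 := norm_sub_le_unitConeMap_sub hf hsep hx hy
  rw [norm_sub_rev, norm_sub_rev (unitConeMap f y), mul_assoc, ← div_eq_inv_mul, le_div_iff₀ hκ,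
    mul_comm]
  exact h1

end ConeSeparation

/-! ### Constancy of the winding number and its value. -/

section Weight

variable {d N : ℕ} {hop : (Fin d → ℤ) →₀ Matrix (Fin N) (Fin N) ℂ} {zs : Fin d → ℂ} {Es : ℂ}
  {Z : ℝ → EuclideanSpace ℝ (Fin d) → Fin d → ℂ}

theorem logModulus_ne_zero_of_notMem_pbcSpectrum {w : Fin d → ℂ} {E : ℂ} (hw : ∀ j, w j ≠ 0)
    (hsurf : charDet hop w E = 0) (hE : E ∉ pbcSpectrum hop) : logModulus w ≠ 0 := by
  intro h
  refine hE ⟨w, fun j => ?_, hsurf⟩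
  have h1 : Real.log ‖w j‖ = 0 := congrArg (fun v : EuclideanSpace ℝ (Fin d) => v j) h
  exact Real.eq_one_of_pos_of_log_eq_zero (norm_pos_iff.2 (hw j)) h1

theorem contDiffOn_unitConeMap_logModulus
    (hZ : ContDiffOn ℝ ∞ (fun q : ℝ × EuclideanSpace ℝ (Fin d) => Z q.1 (‖q.2‖⁻¹ • q.2))
      (Set.Ioi 0 ×ˢ {0}ᶜ))
    (hne : ∀ t > 0, ∀ ξ, ‖ξ‖ = 1 → ∀ j, Z t ξ j ≠ 0)
    (hlog : ∀ t > 0, ∀ ξ, ‖ξ‖ = 1 → logModulus (Z t ξ) ≠ 0) :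
    ContDiffOn ℝ ∞ (fun q : ℝ × EuclideanSpace ℝ (Fin d) =>
      unitConeMap (fun ξ => logModulus (Z q.1 ξ)) q.2) (Set.Ioi 0 ×ˢ {0}ᶜ) := by
  have h1 : ContDiffOn ℝ ∞ (fun q : ℝ × EuclideanSpace ℝ (Fin d) =>
      logModulus (Z q.1 (‖q.2‖⁻¹ • q.2))) (Set.Ioi 0 ×ˢ {0}ᶜ) := by
    rw [contDiffOn_euclidean]
    intro j
    have h2 : ContDiffOn ℝ ∞ (fun q : ℝ × EuclideanSpace ℝ (Fin d) =>
        Z q.1 (‖q.2‖⁻¹ • q.2) j) (Set.Ioi 0 ×ˢ {0}ᶜ) := contDiffOn_pi.1 hZ j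
    have hj : ∀ q ∈ (Set.Ioi 0 ×ˢ {0}ᶜ : Set (ℝ × EuclideanSpace ℝ (Fin d))),
        Z q.1 (‖q.2‖⁻¹ • q.2) j ≠ 0 := fun q hq =>
      hne q.1 hq.1 _ (norm_inv_norm_smul hq.2) j
    exact (h2.norm ℝ hj).log fun q hq => norm_ne_zero_iff.2 (hj q hq)
  have h3 : ContDiffOn ℝ ∞ (fun q : ℝ × EuclideanSpace ℝ (Fin d) => ‖q.2‖)
      (Set.Ioi 0 ×ˢ {0}ᶜ) := contDiffOn_snd.norm ℝ fun q hq => hq.2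
  have h4 : ∀ q ∈ (Set.Ioi 0 ×ˢ {0}ᶜ : Set (ℝ × EuclideanSpace ℝ (Fin d))),
      logModulus (Z q.1 (‖q.2‖⁻¹ • q.2)) ≠ 0 := fun q hq =>
    hlog q.1 hq.1 _ (norm_inv_norm_smul hq.2)
  exact h3.smul (((h1.norm ℝ h4).inv fun q hq => norm_ne_zero_iff.2 (h4 q hq)).smul h1)

/-- There is a smooth radial weight, supported away from the origin, of nonzero total mass. -/
theorem exists_radial_cutoff (hd : 0 < d) : ∃ φ : ℝ → ℝ, ContDiff ℝ ∞ φ ∧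
    (∀ r, φ r ≠ 0 → r ∈ Set.Icc (1 : ℝ) 3) ∧
      ∫ x : EuclideanSpace ℝ (Fin d), φ ‖x‖ ≠ 0 := by
  have : NeZero d := ⟨hd.ne'⟩
  let b : ContDiffBump (2 : ℝ) := ⟨1 / 2, 1, by norm_num, by norm_num⟩
  have hsupp : ∀ r, b r ≠ 0 → r ∈ Set.Icc (1 : ℝ) 3 := fun r hr => by
    have h1 : r ∈ Metric.ball (2 : ℝ) 1 := by
      have h2 : r ∈ Function.support b := hr
      rwa [b.support_eq] at h2
    rw [Real.ball_eq_Ioo] at h1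
    exact ⟨by linarith [h1.1], by linarith [h1.2]⟩
  refine ⟨b, b.contDiff, hsupp, ne_of_gt ?_⟩
  have hcont : Continuous fun x : EuclideanSpace ℝ (Fin d) => b ‖x‖ :=
    b.continuous.comp continuous_norm
  have hcs : HasCompactSupport fun x : EuclideanSpace ℝ (Fin d) => b ‖x‖ := by
    refine HasCompactSupport.intro (isCompact_closedBall (0 : EuclideanSpace ℝ (Fin d)) 3) ?_
    intro x hx
    by_contra hb
    exact hx (by simpa using (hsupp _ hb).2)
  obtain ⟨x, hx⟩ := exists_norm_eq (EuclideanSpace ℝ (Fin d)) (zero_le_two : (0 : ℝ) ≤ 2)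
  refine hcont.integral_pos_of_hasCompactSupport_nonneg_nonzero hcs (fun y => b.nonneg) (x := x) ?_
  rw [hx]
  exact (b.pos_of_mem_ball (by simp [b])).ne'

/-- The winding number of `ξ ↦ μ(Z t ξ)` does not depend on `t`, as long as no flow line meets
the Brillouin zone. -/
theorem windingNumber_logModulus_eq (hd : 0 < d)
    (hZ : ContDiffOn ℝ ∞ (fun q : ℝ × EuclideanSpace ℝ (Fin d) => Z q.1 (‖q.2‖⁻¹ • q.2))
      (Set.Ioi 0 ×ˢ {0}ᶜ))
    (hne : ∀ t > 0, ∀ ξ, ‖ξ‖ = 1 → ∀ j, Z t ξ j ≠ 0)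
    (hlog : ∀ t > 0, ∀ ξ, ‖ξ‖ = 1 → logModulus (Z t ξ) ≠ 0) {s t : ℝ} (hs : 0 < s) (ht : 0 < t) :
    windingNumber (fun ξ => logModulus (Z s ξ)) = windingNumber (fun ξ => logModulus (Z t ξ)) := by
  obtain ⟨φ, hφ, hsupp, hint⟩ := exists_radial_cutoff hd
  refine mul_right_cancel₀ hint ?_
  rw [windingNumber_mul_integral hd, windingNumber_mul_integral hd]
  exact integral_cutoff_mul_det_eq hd hφ one_pos hsupp
    (F := fun q => unitConeMap (fun ξ => logModulus (Z q.1 ξ)) q.2)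
    (contDiffOn_unitConeMap_logModulus hZ hne hlog)
    (fun t ht x _ => norm_unitConeMap (hlog t ht) x) hs ht

theorem contDiffOn_slice {W : Type*} [NormedAddCommGroup W] [NormedSpace ℝ W]
    {H : ℝ × EuclideanSpace ℝ (Fin d) → W} (hH : ContDiffOn ℝ ∞ H (Set.Ioi 0 ×ˢ {0}ᶜ)) {t : ℝ}
    (ht : 0 < t) : ContDiffOn ℝ ∞ (fun x => H (t, x)) {0}ᶜ :=
  ContDiffOn.comp (g := H) (f := fun x : EuclideanSpace ℝ (Fin d) => (t, x)) hH
    (contDiff_const.prodMk contDiff_id).contDiffOn fun _ hx => Set.mk_mem_prod ht hx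

/-- At the small level of `exists_level_separation` the cone map is an injective immersion, so its
degree integral is a nonzero integer multiple of the radial mass. -/
theorem exists_windingNumber_eq (hd : 0 < d) (hsaddle : IsSaddlePoint hop zs Es)
    (hnondeg : IsNondegenerate hop zs Es) (htrans : IsTransverse hop zs Es)
    (hBZ : zs ∈ brillouinZone d) (hZ : IsAscendingParametrization hop zs Es Z)
    (hlog : ∀ t > 0, ∀ ξ, ‖ξ‖ = 1 → logModulus (Z t ξ) ≠ 0) :
    ∃ n : ℤ, n ≠ 0 ∧ ∃ t > 0, windingNumber (fun ξ => logModulus (Z t ξ)) = n := by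
  obtain ⟨κ, hκ, t, ht, hsep⟩ := exists_level_separation hsaddle hnondeg htrans hBZ hZ.line
  have hne : ∀ t > 0, ∀ ξ, ‖ξ‖ = 1 → ∀ j, Z t ξ j ≠ 0 := fun t ht ξ hξ =>
    (hZ.line ξ hξ).ne_zero t ht
  have hF : ContDiffOn ℝ ∞ (unitConeMap fun ξ => logModulus (Z t ξ)) {0}ᶜ :=
    contDiffOn_slice (contDiffOn_unitConeMap_logModulus hZ.smooth hne hlog) ht
  have hg : ContDiffOn ℝ ∞ (fun x : EuclideanSpace ℝ (Fin d) => Z t (‖x‖⁻¹ • x)) {0}ᶜ :=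
    contDiffOn_slice hZ.smooth ht
  obtain ⟨φ, hφ, hsupp, hint⟩ := exists_radial_cutoff hd
  have hinj := unitConeMap_injective hκ (hlog t ht) hsep (hZ.inj t ht)
  have himm := unitConeMap_immersion hκ (hlog t ht) hsep (hF.differentiableOn (by simp))
    (hg.differentiableOn (by simp)) (hZ.immersion t ht)
  obtain ⟨n, hn, hn'⟩ := integral_radial_mul_det hd φ (norm_unitConeMap (hlog t ht))
    (fun c hc x => unitConeMap_smul _ hc x) (hF.of_le (by simp)) hinj himm
  refine ⟨n, hn, t, ht, mul_right_cancel₀ hint ?_⟩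
  rw [windingNumber_mul_integral hd, hn']

end Weight

end BandFlow

end

theorem mainTheorem6 {d N : ℕ} (hd : 0 < d)
    (hop : (Fin d → ℤ) →₀ Matrix (Fin N) (Fin N) ℂ) (zs : Fin d → ℂ) (Es : ℂ)
    (hsaddle : BandFlow.IsSaddlePoint hop zs Es)
    (hnondeg : BandFlow.IsNondegenerate hop zs Es)
    (htrans : BandFlow.IsTransverse hop zs Es)
    (hBZ : zs ∈ BandFlow.brillouinZone d)
    (hspec : ∀ t : ℝ, 0 < t → Es + Complex.I * t ∉ BandFlow.pbcSpectrum hop)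
    (Z : ℝ → EuclideanSpace ℝ (Fin d) → Fin d → ℂ)
    (hZ : BandFlow.IsAscendingParametrization hop zs Es Z) :
    ∃ n : ℤ, n ≠ 0 ∧ BandFlow.HasWeight Z n := by
  have hlog : ∀ t > 0, ∀ ξ, ‖ξ‖ = 1 → BandFlow.logModulus (Z t ξ) ≠ 0 := fun t ht ξ hξ =>
    BandFlow.logModulus_ne_zero_of_notMem_pbcSpectrum ((hZ.line ξ hξ).ne_zero t ht)
      ((hZ.line ξ hξ).on_surface t ht) (hspec t ht)
  obtain ⟨n, hn, t, ht, hw⟩ :=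
    BandFlow.exists_windingNumber_eq hd hsaddle hnondeg htrans hBZ hZ hlog
  -- The winding number is the same at all t > 0, so the limit is its value at the small level.
  refine ⟨n, hn, tendsto_const_nhds.congr' ?_⟩
  filter_upwards [eventually_gt_atTop 0] with s hs
  rw [← hw]
  exact BandFlow.windingNumber_logModulus_eq hd hZ.smooth
    (fun t ht ξ hξ => (hZ.line ξ hξ).ne_zero t ht) hlog ht hs
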